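/- Let $K$ be a field, $S=K[x_1,\dots,x_n,y_1,\dots,y_m]$ ($n,m\ge 0$) the polynomial ring bigraded by $\deg x_i=(1,0)$, $\deg y_j=(0,1)$, let $J\subsetneq S$ be a proper bihomogeneous ideal, and $R=S/J=\bigoplus_{i,j} R_{(i,j)}$, where $R_{(i,j)}=0$ unless $i,j\ge 0$. Let $\mathfrak n_x,\mathfrak n_y\subset R$ be the ideals generated by the classes of $x_1,\dots,x_n$, respectively $y_1,\dots,y_m$. For integers $a,b\ge 0$ with $(a,b)\ne(0,0)$ put $\Delta=\{(sa,sb): s\in\mathbb Z\}$ and $\tilde\Delta=\{(sa,tb): s,t\in\mathbb Z\}$. Consider the subrings $R_\Delta=\bigoplus_{p\in\Delta}R_p$ and $R_{\tilde\Delta}=\bigoplus_{p\in\tilde\Delta}R_p$ of $R$; $R_\Delta$ is graded by $(R_\Delta)_i=R_{(ia,ib)}$ and $R_{\tilde\Delta}$ is bigraded by $(R_{\tilde\Delta})_{(i,j)}=R_{(ia,jb)}$. For integers $c,d\ge 0$ the sidediagonal module $R^{(c,d)}_\Delta=\bigoplus_{p\in\Delta}R_{p+(c,d)}$ is the $\mathbb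 Z$-graded $R_\Delta$-module with components $(R^{(c,d)}_\Delta)_i=R_{(ia+c,ib+d)}$, $i\in\mathbb Z$, and the relative Veronese module $R^{(c,d)}_{\tilde\Delta}=\bigoplus_{p\in\tilde\Delta}R_{p+(c,d)}$ is the bigraded $R_{\tilde\Delta}$-module with components $(R^{(c,d)}_{\tilde\Delta})_{(i,j)}=R_{(ia+c,jb+d)}$, $i,j\in\mathbb Z$. (If $a=0$, only the bidegrees with $i=0$ occur in $R_{\tilde\Delta}$ and $R^{(c,d)}_{\tilde\Delta}$; if $b=0$, only those with $j=0$.) For a finitely generated graded module $N$ over a standard graded $K$-algebra $A$ let $\operatorname{reg}_A N=\sup\{j-i : \operatorname{Tor}^A_i(N,K)_j\neq 0\}$. The module $N$ has a linear $A$-resolution if $N=0$ or $\operatorname{reg}_A N=\min\{i : N_i\ne 0\}$. The algebra $A$ is Koszul if $\operatorname{reg}_A K=0$; for $R$ this refers to the total grading $R_i=\bigoplus_{j+k=i}R_{(j,k)}$. A finitely generated bigraded module $N$ over a standard bigraded $K$-algebra $A$ has a bigraded linear $A$-resolution if there is an integer $e$ with $\operatorname{Tor}^A_i(N,K)_{(j,k)}=0$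 for all $i\ge 0$ and all $j+k\ne i+e$. (1) If $R$ is Koszul, then for all $a,b$ as above and all $c,d\ge 0$ the module $R^{(c,d)}_\Delta$ has a linear $R_\Delta$-resolution and the module $R^{(c,d)}_{\tilde\Delta}$ has a bigraded linear $R_{\tilde\Delta}$-resolution. (2) If $\mathfrak n_x$ and $\mathfrak n_y$ have bigraded linear $R$-resolutions, then for all $a,b$ as above and all $c,d\ge 0$ the module $R^{(c,d)}_\Delta$ has a linear $R_\Delta$-resolution and the module $R^{(c,d)}_{\tilde\Delta}$ has a bigraded linear $R_{\tilde\Delta}$-resolution. -/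

import Mathlib

noncomputable section

/-! ### Graded free resolutions, graded Tor, regularity, linearity -/

section Graded

variable {ι K A M : Type*} [AddCommGroup ι] [Field K] [CommRing A] [Algebra K A]
  [AddCommGroup M] [Module A M] [Module K M]

/-- The ideal of `A` generated by all homogeneous elements of non-zero degree. If `A` is positively
graded with `A₀ = K`, this is the graded maximal ideal, and `A ⧸ irrelevantIdeal 𝒜` is the
residue class field `K` viewed as a trivial `A`-module. -/
def irrelevantIdeal (𝒜 : ι → Submodule K A) : Ideal A :=
  Ideal.span {x | ∃ p : ι, p ≠ 0 ∧ x ∈ 𝒜 p}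

/-- The grading induced on the residue class field `A ⧸ irrelevantIdeal 𝒜`. -/
def residueGrading (𝒜 : ι → Submodule K A) (p : ι) : Submodule K (A ⧸ irrelevantIdeal 𝒜) :=
  (𝒜 p).map (Ideal.Quotient.mkₐ K (irrelevantIdeal 𝒜)).toLinearMap

/-- A graded free resolution `⋯ → F₁ → F₀ → M → 0` of the graded module `(M, ℳ)` over the graded
ring `(A, 𝒜)`. The module `F_i` is `⨁_b A(-deg i b)`, with `b` running over `Fin (rank i)`; all
maps are homogeneous of degree zero. -/
structure GradedFreeResolution (𝒜 : ι → Submodule K A) (ℳ : ι → Submodule K M) where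
  /-- the rank of `F_i` -/
  rank : ℕ → ℕ
  /-- the degrees of the basis elements of `F_i` -/
  deg : (i : ℕ) → Fin (rank i) → ι
  /-- the differential `F_{i+1} → F_i` -/
  d : (i : ℕ) → (Fin (rank (i + 1)) → A) →ₗ[A] (Fin (rank i) → A)
  /-- the augmentation `F_0 → M` -/
  aug : (Fin (rank 0) → A) →ₗ[A] M
  d_homogeneous : ∀ i b b', d i (Pi.single b 1) b' ∈ 𝒜 (deg (i + 1) b - deg i b')
  aug_homogeneous : ∀ b, aug (Pi.single b 1) ∈ ℳ (deg 0 b)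
  aug_surjective : Function.Surjective aug
  exact_zero : Function.Exact (d 0) aug
  exact_succ : ∀ i, Function.Exact (d (i + 1)) (d i)

namespace GradedFreeResolution

variable {𝒜 : ι → Submodule K A} {ℳ : ι → Submodule K M} (F : GradedFreeResolution 𝒜 ℳ)

/-- The degree `p` component of `F_i = ⨁_b A(-deg i b)`. -/
def component (i : ℕ) (p : ι) : Submodule K (Fin (F.rank i) → A) :=
  Submodule.pi Set.univ fun b => 𝒜 (p - F.deg i b)

/-- The submodule `𝔪 F_i`, where `𝔪` is the irrelevant ideal, so that `F_i ⊗ K = F_i / 𝔪 F_i`. -/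
def irrelevant (i : ℕ) : Submodule A (Fin (F.rank i) → A) :=
  irrelevantIdeal 𝒜 • ⊤

/-- The elements of degree `p` of `F_i` whose class is an `i`-cycle of `F ⊗ K`. -/
def cycles : (i : ℕ) → ι → Submodule K (Fin (F.rank i) → A)
  | 0, p => F.component 0 p
  | i + 1, p => F.component (i + 1) p ⊓ ((F.irrelevant i).comap (F.d i)).restrictScalars K

/-- The elements of degree `p` of `F_i` whose class is an `i`-boundary of `F ⊗ K`. -/
def boundaries (i : ℕ) (p : ι) : Submodule K (Fin (F.rank i) → A) :=
  F.component i p ⊓ (LinearMap.range (F.d i) ⊔ F.irrelevant i).restrictScalars K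

/-- The graded component `Tor_i(M, K)_p`: the degree `p` component of the `i`-th homology of
`F ⊗ K`, for the graded free resolution `F` of `M`. -/
abbrev Tor (i : ℕ) (p : ι) : Type _ :=
  F.cycles i p ⧸ (F.boundaries i p).submoduleOf (F.cycles i p)

end GradedFreeResolution

namespace GradedFreeResolution

variable {𝒜 : ℤ → Submodule K A} {ℳ : ℤ → Submodule K M} (F : GradedFreeResolution 𝒜 ℳ)

/-- `t_s(M) = sup {j | Tor_s(M, K)_j ≠ 0}`, which is `-∞` if `Tor_s(M, K) = 0`. -/
def t (s : ℕ) : EReal :=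
  ⨆ j ∈ {j : ℤ | Nontrivial (F.Tor s j)}, ((j : ℝ) : EReal)

/-- The Castelnuovo-Mumford regularity `sup {t_s(M) - s | s ≥ 0}`. -/
def reg : EReal :=
  ⨆ s : ℕ, (F.t s - ((s : ℝ) : EReal))

end GradedFreeResolution

/-- `reg_A M = r`. The graded `Tor` does not depend on the graded free resolution that is
used to compute it. -/
def HasRegularity (𝒜 : ℤ → Submodule K A) (ℳ : ℤ → Submodule K M) (r : EReal) : Prop :=
  ∃ F : GradedFreeResolution 𝒜 ℳ, F.reg = r

/-- A positively graded `K`-algebra is Koszul if `reg_A K = 0`. -/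
def IsKoszulAlgebra (𝒜 : ℤ → Submodule K A) : Prop :=
  HasRegularity 𝒜 (residueGrading 𝒜) 0

/-- `M` has a linear resolution: `M` is zero, or `reg_A M = indeg M = i` for some integer `i`. -/
def HasLinearResolution (𝒜 : ℤ → Submodule K A) (ℳ : ℤ → Submodule K M) : Prop :=
  Subsingleton M ∨
    ∃ i : ℤ, HasRegularity 𝒜 ℳ ((i : ℝ) : EReal) ∧ IsLeast {j : ℤ | ℳ j ≠ ⊥} i

/-- `M` has a bigraded linear resolution: for some integer `a`, `Tor_i(M, K)_{(j,k)} = 0` for all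
`i ≥ 0` and all `(j, k)` with `j + k ≠ i + a`. -/
def HasBigradedLinearResolution (𝒜 : ℤ × ℤ → Submodule K A) (ℳ : ℤ × ℤ → Submodule K M) : Prop :=
  ∃ a : ℤ, ∃ F : GradedFreeResolution 𝒜 ℳ,
    ∀ (i : ℕ) (p : ℤ × ℤ), p.1 + p.2 ≠ i + a → Subsingleton (F.Tor i p)

end Graded

/-! ### Bigraded algebras `R = K[x₁,…,xₙ,y₁,…,yₘ] / J` -/

section Bigraded

variable {K : Type*} [Field K] {n m : ℕ}

/-- The standard bigrading `deg x_i = (1,0)`, `deg y_j = (0,1)`. -/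
def bidegree (n m : ℕ) : Fin n ⊕ Fin m → ℤ × ℤ :=
  Sum.elim (fun _ => (1, 0)) (fun _ => (0, 1))

/-- `J` is bihomogeneous: it contains the bihomogeneous components of each of its elements. -/
def IsBihomogeneous (J : Ideal (MvPolynomial (Fin n ⊕ Fin m) K)) : Prop :=
  ∀ f ∈ J, ∀ p : ℤ × ℤ, MvPolynomial.weightedHomogeneousComponent (bidegree n m) p f ∈ J

variable (J : Ideal (MvPolynomial (Fin n ⊕ Fin m) K))

/-- The component `R_{(i,j)}` of `R = S / J`; it is zero if `i < 0` or `j < 0`. -/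
def bicomponent (p : ℤ × ℤ) : Submodule K (MvPolynomial (Fin n ⊕ Fin m) K ⧸ J) :=
  (MvPolynomial.weightedHomogeneousSubmodule K (bidegree n m) p).map
    (Ideal.Quotient.mkₐ K J).toLinearMap

/-- The component `R_i = ⨁_{j+k=i} R_{(j,k)}` of the total grading of `R`. -/
def totalComponent (i : ℤ) : Submodule K (MvPolynomial (Fin n ⊕ Fin m) K ⧸ J) :=
  ⨆ p ∈ {p : ℤ × ℤ | p.1 + p.2 = i}, bicomponent J p

/-- The ideal `𝔫_x` of `R` generated by the classes of the `x_i`. -/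
def idealX : Ideal (MvPolynomial (Fin n ⊕ Fin m) K ⧸ J) :=
  Ideal.span (Set.range fun i : Fin n => Ideal.Quotient.mk J (MvPolynomial.X (Sum.inl i)))

/-- The ideal `𝔫_y` of `R` generated by the classes of the `y_j`. -/
def idealY : Ideal (MvPolynomial (Fin n ⊕ Fin m) K ⧸ J) :=
  Ideal.span (Set.range fun j : Fin m => Ideal.Quotient.mk J (MvPolynomial.X (Sum.inr j)))

/-- The bigrading of an ideal of `R`. -/
def idealGrading (I : Ideal (MvPolynomial (Fin n ⊕ Fin m) K ⧸ J)) (p : ℤ × ℤ) :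
    Submodule K I :=
  (bicomponent J p).comap (I.subtype.restrictScalars K)

/-- `⨁_{p ∈ D} R_{p + v}`, as a subspace of `R`. -/
def sumAlong (D : AddSubgroup (ℤ × ℤ)) (v : ℤ × ℤ) :
    Submodule K (MvPolynomial (Fin n ⊕ Fin m) K ⧸ J) :=
  ⨆ p ∈ D, bicomponent J (p + v)

theorem one_mem_bicomponent : (1 : MvPolynomial (Fin n ⊕ Fin m) K ⧸ J) ∈ bicomponent J 0 :=
  ⟨1, MvPolynomial.isWeightedHomogeneous_one K (bidegree n m),
    map_one (Ideal.Quotient.mkₐ K J)⟩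

theorem mul_mem_bicomponent {p q : ℤ × ℤ} {x y : MvPolynomial (Fin n ⊕ Fin m) K ⧸ J}
    (hx : x ∈ bicomponent J p) (hy : y ∈ bicomponent J q) : x * y ∈ bicomponent J (p + q) := by
  obtain ⟨f, hf, rfl⟩ := hx
  obtain ⟨g, hg, rfl⟩ := hy
  exact ⟨f * g, MvPolynomial.IsWeightedHomogeneous.mul hf hg,
    map_mul (Ideal.Quotient.mkₐ K J) f g⟩

theorem mul_mem_sumAlong {D : AddSubgroup (ℤ × ℤ)} {v : ℤ × ℤ}
    {x y : MvPolynomial (Fin n ⊕ Fin m) K ⧸ J}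
    (hx : x ∈ sumAlong J D 0) (hy : y ∈ sumAlong J D v) : x * y ∈ sumAlong J D v := by
  have h : sumAlong J D 0 * sumAlong J D v ≤ sumAlong J D v := by
    simp only [sumAlong, Submodule.iSup_mul, Submodule.mul_iSup, iSup_le_iff]
    intro q hq p hp
    refine Submodule.mul_le.2 fun a ha b hb => ?_
    have h' := mul_mem_bicomponent J ha hb
    refine (le_iSup₂_of_le (f := fun r (_ : r ∈ D) => bicomponent J (r + v)) (p + q)
      (D.add_mem hp hq) le_rfl) ?_
    convert h' using 2
    abel
  exact h (Submodule.mul_mem_mul hx hy)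

theorem one_mem_sumAlong (D : AddSubgroup (ℤ × ℤ)) :
    (1 : MvPolynomial (Fin n ⊕ Fin m) K ⧸ J) ∈ sumAlong J D 0 :=
  (le_iSup₂_of_le (f := fun r (_ : r ∈ D) => bicomponent J (r + 0)) 0 D.zero_mem le_rfl)
    (by simpa using one_mem_bicomponent J)

/-- The subalgebra `⨁_{p ∈ D} R_p` of `R`. -/
def subalgebraAlong (D : AddSubgroup (ℤ × ℤ)) :
    Subalgebra K (MvPolynomial (Fin n ⊕ Fin m) K ⧸ J) :=
  (sumAlong J D 0).toSubalgebra (one_mem_sumAlong J D) fun _ _ hx hy => mul_mem_sumAlong J hx hy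

/-- The `⨁_{p ∈ D} R_p`-submodule `⨁_{p ∈ D} R_{p + v}` of `R`. -/
def moduleAlong (D : AddSubgroup (ℤ × ℤ)) (v : ℤ × ℤ) :
    Submodule (subalgebraAlong J D) (MvPolynomial (Fin n ⊕ Fin m) K ⧸ J) where
  carrier := sumAlong J D v
  add_mem' := (sumAlong J D v).add_mem
  zero_mem' := (sumAlong J D v).zero_mem
  smul_mem' := fun r _ hx => mul_mem_sumAlong J r.2 hx

/-- `R_q` as a subspace of `⨁_{p ∈ D} R_p` (for `q ∈ D`). -/
def subalgebraComponent (D : AddSubgroup (ℤ × ℤ)) (q : ℤ × ℤ) :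
    Submodule K (subalgebraAlong J D) :=
  (bicomponent J q).comap (subalgebraAlong J D).val.toLinearMap

/-- `R_{q + v}` as a subspace of `⨁_{p ∈ D} R_{p + v}` (for `q ∈ D`). -/
def moduleComponent (D : AddSubgroup (ℤ × ℤ)) (v q : ℤ × ℤ) :
    Submodule K (moduleAlong J D v) :=
  (bicomponent J (q + v)).comap ((moduleAlong J D v).subtype.restrictScalars K)

/-- The diagonal `Δ = {(sa, sb) | s ∈ ℤ}`. -/
def diagonal (a b : ℕ) : AddSubgroup (ℤ × ℤ) :=
  AddSubgroup.zmultiples ((a : ℤ), (b : ℤ))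

/-- The set `Δ̃ = {(sa, tb) | s, t ∈ ℤ}`. -/
def veroneseLattice (a b : ℕ) : AddSubgroup (ℤ × ℤ) :=
  (AddSubgroup.zmultiples (a : ℤ)).prod (AddSubgroup.zmultiples (b : ℤ))

/-- The grading `(R_Δ)_i = R_{(ia, ib)}` of the diagonal subalgebra `R_Δ`. -/
def diagonalGrading (a b : ℕ) (i : ℤ) : Submodule K (subalgebraAlong J (diagonal a b)) :=
  subalgebraComponent J (diagonal a b) (i * a, i * b)

/-- The grading `i ↦ R_{(ia+c, ib+d)}` of the sidediagonal module of `R`. -/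
def sidediagonalGrading (a b c d : ℕ) (i : ℤ) :
    Submodule K (moduleAlong J (diagonal a b) (c, d)) :=
  moduleComponent J (diagonal a b) (c, d) (i * a, i * b)

/-- The bigrading `(i, j) ↦ R_{(ia, jb)}` of the generalized Veronese subring of `R`. If `a = 0`
(or `b = 0`), the subring lives in the bidegrees with `i = 0` (or `j = 0`). -/
def veroneseGrading (a b : ℕ) (p : ℤ × ℤ) : Submodule K (subalgebraAlong J (veroneseLattice a b)) :=
  open Classical in
  if (a = 0 → p.1 = 0) ∧ (b = 0 → p.2 = 0) then
    subalgebraComponent J (veroneseLattice a b) (p.1 * a, p.2 * b)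
  else ⊥

/-- The bigrading `(i, j) ↦ R_{(ia+c, jb+d)}` of the relative Veronese module of `R`. If `a = 0`
(or `b = 0`), the module lives in the bidegrees with `i = 0` (or `j = 0`). -/
def relativeVeroneseGrading (a b c d : ℕ) (p : ℤ × ℤ) :
    Submodule K (moduleAlong J (veroneseLattice a b) (c, d)) :=
  open Classical in
  if (a = 0 → p.1 = 0) ∧ (b = 0 → p.2 = 0) then
    moduleComponent J (veroneseLattice a b) (c, d) (p.1 * a, p.2 * b)
  else ⊥

/-- The sidediagonal module of `R` has a linear `R_Δ`-resolution. -/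
def SidediagonalIsLinear (a b c d : ℕ) : Prop :=
  HasLinearResolution (diagonalGrading J a b) (sidediagonalGrading J a b c d)

/-- The relative Veronese module of `R` has a bigraded linear resolution over the generalized
Veronese subring of `R`. -/
def RelativeVeroneseIsLinear (a b c d : ℕ) : Prop :=
  HasBigradedLinearResolution (veroneseGrading J a b) (relativeVeroneseGrading J a b c d)

end Bigraded

end

noncomputable section

open Finset

/-! Let `A` be the algebra of the degrees in a lattice (the diagonal or the Veronese lattice),
parametrised by `φ`, and let `R^v` be the strand with components `R_{φ s + v}`. Up to a shift every
nonzero strand starts in degree `0`, and the claim to prove is that `Tor^A_h(R^v, K)` then vanishes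
in degrees larger than `h`. A minimal resolution built step by step from this vanishing is linear.

The central argument (`torVanishes_strandFamily`) supposes that the ideals generated by the
`x`-variables and by the `y`-variables have linear `R`-resolutions. If `v = 0`, the strand is `A`
itself. Otherwise `v` has a positive coordinate, say of type `c`. All components of `R^v` then lie
in the ideal `𝔫_c`, so the `v`-strand of a linear resolution `F` of `𝔫_c` is an exact complex of
`A`-modules over `R^v`. Each `F_i^v` is a direct sum of strands of `R` which, by the arithmetic of
the lattice (`DegreeLattice`), start in degree at most `i`. The long exact sequences of `Tor`
express `Tor_h(R^v)` through `Tor_j(F_i^v)` with `j < h`, covered by induction on `h`, and through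
`Tor_h(F_0^v)`, covered by induction on `|v|` since `F_0` is generated in the degree of a single
variable.

If `R` is Koszul, the linearity of `𝔫_c` has to be proved first (`torVanishes_of_retraction`).
Sending the variables of type `c` to zero is a retraction `κ` of `R` with kernel `𝔫_c`. Let `P` be a
linear resolution of `K`. A cycle of `𝔫_c ⊗ P_i` of total degree larger than `i + 1` bounds a chain
`u` over `R`, and `u` has entries in the irrelevant ideal for degree reasons. The complex `κ(P)`
maps to `R/𝔫_c ⊗ P`, and such a chain map sends cycles with entries in the irrelevant ideal to
boundaries (`ResidueResolution.exists_diff_eq_of_chainMap`). So `u` can be corrected to have entries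
in `𝔫_c`.

Throughout, `Tor` is handled as homology of `N ⊗ P` for a fixed resolution `P` of `K`, with
`TorVanishes` expressing its vanishing in one degree. `GradedFreeResolution.torVanishes` is the part
of the balancing of `Tor` that transfers the hypotheses, which concern resolutions of modules, to
this form. -/

/-! ### Families of submodules with projections -/

/-- Projections onto the members of a family `𝒩` of subspaces that decomposes `N`. -/
structure GradedProj {ι K N : Type*} [Field K] [AddCommGroup N] [Module K N]
    (𝒩 : ι → Submodule K N) where
  /-- the projection onto a component -/
  π : ι → N →+ N
  mem : ∀ p x, π p x ∈ 𝒩 p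
  same : ∀ p, ∀ x ∈ 𝒩 p, π p x = x
  ne : ∀ p q, p ≠ q → ∀ x ∈ 𝒩 p, π q x = 0
  total : ⨆ p, 𝒩 p = ⊤

namespace GradedProj

variable {ι ι' K N M : Type*} [Field K] [AddCommGroup N] [Module K N] [AddCommGroup M] [Module K M]
  {𝒩 : ι → Submodule K N} {ℳ : ι' → Submodule K M}

theorem induction (g : GradedProj 𝒩) {motive : N → Prop}
    (mem : ∀ p, ∀ x ∈ 𝒩 p, motive x) (zero : motive 0)
    (add : ∀ x y, motive x → motive y → motive (x + y)) (x : N) : motive x :=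
  Submodule.iSup_induction 𝒩 (motive := motive) (x := x) (by simp [g.total]) mem zero add

/-- Allowing every larger finite set makes the property additive: for a sum of two elements the
union of the two sets works. -/
theorem exists_sum (g : GradedProj 𝒩) (x : N) :
    ∃ s : Finset ι, ∀ t, s ⊆ t → ∑ p ∈ t, g.π p x = x := by
  classical
  induction x using g.induction with
  | mem p x hx =>
    refine ⟨{p}, fun t ht => ?_⟩
    rw [Finset.sum_eq_single p]
    · exact g.same p x hx
    · intro q _ hq
      exact g.ne p q hq.symm x hx
    · intro h
      exact absurd (ht (Finset.mem_singleton_self p)) h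
  | zero => exact ⟨∅, fun t _ => by simp⟩
  | add x y hx hy =>
    obtain ⟨s, hs⟩ := hx
    obtain ⟨s', hs'⟩ := hy
    refine ⟨s ∪ s', fun t ht => ?_⟩
    simp only [map_add, Finset.sum_add_distrib]
    rw [hs t (Finset.union_subset_left ht), hs' t (Finset.union_subset_right ht)]

theorem sum_proj (g : GradedProj 𝒩) (x : N) : ∃ s : Finset ι, ∑ p ∈ s, g.π p x = x :=
  let ⟨s, hs⟩ := g.exists_sum x
  ⟨s, hs s subset_rfl⟩

theorem eq_zero (g : GradedProj 𝒩) {x : N} (h : ∀ p, g.π p x = 0) : x = 0 := by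
  obtain ⟨s, hs⟩ := g.sum_proj x
  rw [← hs]
  exact Finset.sum_eq_zero fun p _ => h p

/-- The map is only assumed additive because the `K`- and `A`-module structures are not assumed
compatible, so that `A`-linear maps need not be `K`-linear. Injectivity of `e` prevents other
components from contributing to degree `e p`. -/
theorem proj_map (g : GradedProj 𝒩) (g' : GradedProj ℳ) (φ : N →+ M) (e : ι → ι')
    (he : Function.Injective e) (h : ∀ p, ∀ x ∈ 𝒩 p, φ x ∈ ℳ (e p)) (p : ι) (x : N) :
    g'.π (e p) (φ x) = φ (g.π p x) := by
  induction x using g.induction with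
  | mem q x hx =>
    by_cases hq : q = p
    · subst hq
      rw [g.same _ _ hx, g'.same _ _ (h _ _ hx)]
    · rw [g.ne q p hq x hx, g'.ne (e q) (e p) (fun h' => hq (he h')) _ (h _ _ hx), map_zero]
  | zero => simp
  | add x y hx hy => simp only [map_add, hx, hy]

/-- The induced family on a submodule of an `A`-module. -/
def _root_.subFamily {A : Type*} [CommRing A] [Algebra K A] [Module A N] [IsScalarTower K A N]
    (𝒩 : ι → Submodule K N) (Z : Submodule A N) (p : ι) : Submodule K Z :=
  (𝒩 p).comap (Z.subtype.restrictScalars K)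

theorem _root_.mem_subFamily {A : Type*} [CommRing A] [Algebra K A] [Module A N]
    [IsScalarTower K A N] (𝒩 : ι → Submodule K N) (Z : Submodule A N) (p : ι) (z : Z) :
    z ∈ subFamily 𝒩 Z p ↔ (z : N) ∈ 𝒩 p := Iff.rfl

/-- The projections of a submodule that is stable under the projections. -/
def sub {A : Type*} [CommRing A] [Algebra K A] [Module A N] [IsScalarTower K A N]
    (g : GradedProj 𝒩) (Z : Submodule A N) (hZ : ∀ p, ∀ z ∈ Z, g.π p z ∈ Z) :
    GradedProj (subFamily 𝒩 Z) where
  π p := AddMonoidHom.mk' (fun z => ⟨g.π p z, hZ p z z.2⟩) fun x y => by ext; simp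
  mem p x := g.mem p x
  same p x hx := by ext; exact g.same p x hx
  ne p q hpq x hx := by ext; exact g.ne p q hpq x hx
  total := by
    rw [eq_top_iff]
    rintro ⟨z, hz⟩ -
    obtain ⟨s, hs⟩ := g.sum_proj z
    have : (⟨z, hz⟩ : Z) = ∑ p ∈ s, ⟨g.π p z, hZ p z hz⟩ := by
      ext
      simp [hs]
    rw [this]
    exact Submodule.sum_mem _ fun p _ => Submodule.mem_iSup_of_mem p (g.mem p z)

/-- The projections of a finite direct sum of shifts. -/
def pi {r : ℕ} [AddCommGroup ι] (g : GradedProj 𝒩) (d : Fin r → ι) :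
    GradedProj fun p => Submodule.pi Set.univ fun b : Fin r => 𝒩 (p - d b) where
  π p := AddMonoidHom.mk' (fun f b => g.π (p - d b) (f b)) fun x y => by ext; simp
  mem p x := fun b _ => g.mem _ _
  same p x hx := by ext b; exact g.same _ _ (hx b trivial)
  ne p q hpq x hx := by
    ext b
    exact g.ne (p - d b) (q - d b) (fun h => hpq (sub_left_inj.1 h)) _ (hx b trivial)
  total := by
    classical
    rw [eq_top_iff]
    rintro f -
    have : f = ∑ b, Pi.single b (f b) := (Finset.univ_sum_single f).symm
    rw [this]
    refine Submodule.sum_mem _ fun b _ => ?_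
    generalize f b = x
    induction x using g.induction with
    | mem p x hx =>
      refine Submodule.mem_iSup_of_mem (p + d b) fun b' _ => ?_
      by_cases h : b' = b
      · subst h
        simpa using hx
      · simp [Pi.single_eq_of_ne h]
    | zero => simp
    | add x y hx hy =>
      rw [Pi.single_add]
      exact add_mem hx hy

end GradedProj

/-! ### Positively graded algebras and resolutions of the residue field -/

section

variable {ι K A : Type*} [AddCommGroup ι] [Field K] [CommRing A] [Algebra K A]

/-- A graded algebra whose components in non-zero degrees have positive total degree, and whose
component of degree zero is a field. -/
structure PosGrading (𝒜 : ι → Submodule K A) (deg : ι →+ ℤ) extends GradedProj 𝒜 where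
  one_mem : 1 ∈ 𝒜 0
  mul_mem : ∀ p q, ∀ a ∈ 𝒜 p, ∀ b ∈ 𝒜 q, a * b ∈ 𝒜 (p + q)
  pos : ∀ p, ∀ a ∈ 𝒜 p, a ≠ 0 → p ≠ 0 → 0 < deg p
  unit : ∀ a ∈ 𝒜 0, a ≠ 0 → IsUnit a

/-- Compatibility of a family of subspaces of a module with the grading of the ring. -/
def GradedAction {N : Type*} [AddCommGroup N] [Module A N] [Module K N] (𝒜 : ι → Submodule K A)
    (𝒩 : ι → Submodule K N) : Prop :=
  ∀ p q, ∀ a ∈ 𝒜 p, ∀ x ∈ 𝒩 q, a • x ∈ 𝒩 (p + q)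

/-- A graded free resolution `⋯ → P₁ → P₀ = A` of the residue class field, given by matrices. -/
structure ResidueResolution (𝒜 : ι → Submodule K A) where
  /-- the index sets of the bases -/
  β : ℕ → Type
  fin : ∀ i, Fintype (β i)
  /-- the degrees of the basis elements -/
  deg : ∀ i, β i → ι
  /-- the matrices of the differentials -/
  D : ∀ i, β (i + 1) → β i → A
  uniq : Unique (β 0)
  deg_zero : ∀ b, deg 0 b = 0
  homogeneous : ∀ i b b', D i b b' ∈ 𝒜 (deg (i + 1) b - deg i b')
  span_range : Ideal.span (Set.range fun b => D 0 b default) = irrelevantIdeal 𝒜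
  comp : ∀ i b b'', ∑ b', D (i + 1) b b' * D i b' b'' = 0
  exact : ∀ i (z : β (i + 1) → A), (∀ b', ∑ b, D i b b' * z b = 0) →
    ∃ w : β (i + 2) → A, ∀ b', ∑ b, D (i + 1) b b' * w b = z b'

namespace ResidueResolution

attribute [instance] ResidueResolution.fin
attribute [instance] ResidueResolution.uniq

variable {𝒜 : ι → Submodule K A} (P : ResidueResolution 𝒜)
  {N : Type*} [AddCommGroup N] [Module A N] {M : Type*} [AddCommGroup M] [Module A M]

/-- The differential of `N ⊗ P`. -/
def diff (N : Type*) [AddCommGroup N] [Module A N] (i : ℕ) :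
    (P.β (i + 1) → N) →ₗ[A] (P.β i → N) where
  toFun z b' := ∑ b, P.D i b b' • z b
  map_add' x y := by ext; simp [Finset.sum_add_distrib]
  map_smul' a x := by ext; simp [Finset.smul_sum, smul_comm a]

theorem diff_apply (i : ℕ) (z : P.β (i + 1) → N) (b' : P.β i) :
    P.diff N i z b' = ∑ b, P.D i b b' • z b := rfl

theorem diff_diff (i : ℕ) (z : P.β (i + 2) → N) : P.diff N i (P.diff N (i + 1) z) = 0 := by
  ext b''
  simp only [diff_apply, Finset.smul_sum, Pi.zero_apply, smul_smul]
  rw [Finset.sum_comm]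
  refine Finset.sum_eq_zero fun b _ => ?_
  rw [← Finset.sum_smul]
  have := P.comp i b b''
  simp_rw [mul_comm (P.D (i + 1) b _)] at this
  rw [this, zero_smul]

theorem diff_map (φ : N →ₗ[A] M) (i : ℕ) (z : P.β (i + 1) → N) :
    P.diff M i (fun b => φ (z b)) = fun b => φ (P.diff N i z b) := by
  ext b
  simp [diff_apply]

/-- The cycles of `N ⊗ P`. -/
def IsCycle : (i : ℕ) → (P.β i → N) → Prop
  | 0, _ => True
  | i + 1, z => P.diff N i z = 0

theorem isCycle_diff (i : ℕ) (z : P.β (i + 1) → N) : P.IsCycle i (P.diff N i z) := by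
  cases i with
  | zero => trivial
  | succ i => exact P.diff_diff i z

theorem IsCycle.map {i : ℕ} {z : P.β i → N} (h : P.IsCycle i z) (φ : N →ₗ[A] M) :
    P.IsCycle i fun b => φ (z b) := by
  cases i with
  | zero => trivial
  | succ i =>
    change P.diff M i _ = 0
    have h' : P.diff N i z = 0 := h
    rw [diff_map, h']
    ext
    simp

theorem IsCycle.of_map {i : ℕ} {z : P.β i → N} (φ : N →ₗ[A] M) (hφ : Function.Injective φ)
    (h : P.IsCycle i fun b => φ (z b)) : P.IsCycle i z := by
  cases i with
  | zero => trivial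
  | succ i =>
    have h' : P.diff M i (fun b => φ (z b)) = 0 := h
    rw [diff_map] at h'
    change P.diff N i z = 0
    ext b
    exact hφ (by simpa using congrFun h' b)

/-- The entries of the first matrix generate the irrelevant ideal `𝔪`, so the image of `N ⊗ P₁` in
`N ⊗ P₀ = N` is `𝔪N`. Thus the zeroth homology of `N ⊗ P` is `N/𝔪N`. -/
theorem mem_smul_top_iff (N : Type*) [AddCommGroup N] [Module A N] (x : N) :
    x ∈ (irrelevantIdeal 𝒜 • ⊤ : Submodule A N) ↔ ∃ w, P.diff N 0 w = fun _ => x := by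
  constructor
  · intro hx
    rw [← P.span_range] at hx
    induction hx using Submodule.smul_induction_on' with
    | smul a ha y hy =>
      obtain ⟨c, hc⟩ := (Submodule.mem_span_range_iff_exists_fun A).1 ha
      refine ⟨fun b => c b • y, ?_⟩
      ext b'
      rw [Unique.eq_default b', diff_apply]
      simp only [smul_smul, ← Finset.sum_smul]
      rw [← hc]
      simp [mul_comm]
    | add x _ y _ hx hy =>
      obtain ⟨w, hw⟩ := hx
      obtain ⟨w', hw'⟩ := hy
      exact ⟨w + w', by rw [map_add, hw, hw']; rfl⟩
  · rintro ⟨w, hw⟩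
    have := congrFun hw default
    rw [diff_apply] at this
    rw [← this]
    refine Submodule.sum_mem _ fun b _ => Submodule.smul_mem_smul ?_ trivial
    rw [← P.span_range]
    exact Ideal.subset_span ⟨b, rfl⟩

variable [Module K N] [Module K M]

/-- The elements of degree `p` of `N ⊗ P_i`. -/
def Hom (𝒩 : ι → Submodule K N) (i : ℕ) (p : ι) (z : P.β i → N) : Prop :=
  ∀ b, z b ∈ 𝒩 (p - P.deg i b)

variable {P} in
theorem Hom.diff {𝒩 : ι → Submodule K N} (hN : GradedAction 𝒜 𝒩) {i : ℕ} {p : ι}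
    {z : P.β (i + 1) → N} (hz : P.Hom 𝒩 (i + 1) p z) : P.Hom 𝒩 i p (P.diff N i z) := by
  intro b'
  refine Submodule.sum_mem _ fun b _ => ?_
  have := hN _ _ _ (P.homogeneous i b b') _ (hz b)
  convert this using 2
  abel

/-- The vanishing of `Tor_i(N, K)_p`, for a family `𝒩` of subspaces of `N`. -/
def TorVanishes (𝒩 : ι → Submodule K N) (i : ℕ) (p : ι) : Prop :=
  ∀ z : P.β i → N, P.Hom 𝒩 i p z → P.IsCycle i z →
    ∃ w : P.β (i + 1) → N, P.Hom 𝒩 (i + 1) p w ∧ P.diff N i w = z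

variable {𝒩 : ι → Submodule K N} {ℳ : ι → Submodule K M}

/-- Part of the long exact sequence of `Tor`, for a quotient. -/
theorem TorVanishes.quotient (hN : GradedAction 𝒜 𝒩) (φ : N →ₗ[A] M)
    (hsurj : ∀ p, ∀ y ∈ ℳ p, ∃ x ∈ 𝒩 p, φ x = y) {i : ℕ} {p : ι} (h : P.TorVanishes 𝒩 i p)
    (hφ : ∀ p, ∀ x ∈ 𝒩 p, φ x ∈ ℳ p)
    (hZ : ∀ k, i = k + 1 → ∀ y : P.β k → N, P.Hom 𝒩 k p y → (∀ b, φ (y b) = 0) → P.IsCycle k y →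
      (∃ u, P.Hom 𝒩 (k + 1) p u ∧ P.diff N k u = y) →
      ∃ w : P.β (k + 1) → N, P.Hom 𝒩 (k + 1) p w ∧ (∀ b, φ (w b) = 0) ∧ P.diff N k w = y) :
    P.TorVanishes ℳ i p := by
  intro z hz hcyc
  choose u hu hφu using fun b => hsurj _ (z b) (hz b)
  -- A lift `u` of the cycle `z` need not be a cycle. Its boundary has entries in the kernel and
  -- bounds over `N`, so `hZ`, the injectivity of the map from `Tor_k` of the kernel to `Tor_k(N)`,
  -- provides a correction `w` with entries in the kernel.
  obtain ⟨u', hu', hφu', hcyc'⟩ : ∃ u' : P.β i → N, P.Hom 𝒩 i p u' ∧ (∀ b, φ (u' b) = z b) ∧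
      P.IsCycle i u' := by
    cases i with
    | zero => exact ⟨u, hu, hφu, trivial⟩
    | succ k =>
      have hc : P.diff M k z = 0 := hcyc
      obtain ⟨w, hw, hφw, hwu⟩ := hZ k rfl (P.diff N k u) (Hom.diff hN hu) (fun b => by
        have := congrFun (P.diff_map φ k u) b
        simp only [hφu] at this
        rw [← this]
        exact congrFun hc b) (P.isCycle_diff k u) ⟨u, hu, rfl⟩
      refine ⟨u - w, fun b => sub_mem (hu b) (hw b), fun b => ?_, ?_⟩
      · simp [hφu, hφw]
      · change P.diff N k (u - w) = 0
        rw [map_sub, hwu, sub_self]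
  obtain ⟨w, hw, hwu⟩ := h u' hu' hcyc'
  refine ⟨fun b => φ (w b), fun b => hφ _ _ (hw b), ?_⟩
  rw [diff_map, hwu]
  ext b
  exact hφu' b

/-- When `Tor_k` of the kernel vanishes, the lifting condition of `TorVanishes.quotient` is
automatic. -/
theorem TorVanishes.quotient' (hN : GradedAction 𝒜 𝒩) (φ : N →ₗ[A] M)
    (hsurj : ∀ p, ∀ y ∈ ℳ p, ∃ x ∈ 𝒩 p, φ x = y) {i : ℕ} {p : ι} (h : P.TorVanishes 𝒩 i p)
    (hφ : ∀ p, ∀ x ∈ 𝒩 p, φ x ∈ ℳ p) {𝒵 : ι → Submodule K N}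
    (h𝒵 : ∀ p x, x ∈ 𝒵 p ↔ x ∈ 𝒩 p ∧ φ x = 0)
    (hZ : ∀ k, i = k + 1 → P.TorVanishes 𝒵 k p) : P.TorVanishes ℳ i p := by
  refine TorVanishes.quotient P hN φ hsurj h hφ fun k hk y hy hφy hc _ => ?_
  obtain ⟨w, hw, hwy⟩ := hZ k hk y (fun b => (h𝒵 _ _).2 ⟨hy b, hφy b⟩) hc
  exact ⟨w, fun b => ((h𝒵 _ _).1 (hw b)).1, fun b => ((h𝒵 _ _).1 (hw b)).2, hwy⟩

/-- Part of the long exact sequence of `Tor`, for a kernel. -/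
theorem TorVanishes.kernel (hN : GradedAction 𝒜 𝒩) {Z : Type*} [AddCommGroup Z] [Module A Z]
    [Module K Z] {𝒵 : ι → Submodule K Z} (j : Z →ₗ[A] N) (hj : Function.Injective j)
    (φ : N →ₗ[A] M) (hjφ : ∀ p, ∀ x ∈ 𝒩 p, φ x = 0 → ∃ z ∈ 𝒵 p, j z = x)
    (h𝒵 : ∀ p, ∀ z ∈ 𝒵 p, j z ∈ 𝒩 p ∧ φ (j z) = 0) (hφ : ∀ p, ∀ x ∈ 𝒩 p, φ x ∈ ℳ p)
    (hsurj : ∀ p, ∀ y ∈ ℳ p, ∃ x ∈ 𝒩 p, φ x = y) {i : ℕ} {p : ι} (h : P.TorVanishes 𝒩 i p)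
    (hM : P.TorVanishes ℳ (i + 1) p) : P.TorVanishes 𝒵 i p := by
  intro z hz hcyc
  -- The cycle `z` bounds a chain `w` over `N`. The image of `w` in `M` is a cycle, hence the
  -- boundary of some `v`; subtracting from `w` the boundary of a lift of `v` moves it into the
  -- kernel without changing its own boundary.
  obtain ⟨w, hw, hwz⟩ := h (fun b => j (z b)) (fun b => (h𝒵 _ _ (hz b)).1) (hcyc.map P j)
  obtain ⟨v, hv, hvw⟩ := hM (fun b => φ (w b)) (fun b => hφ _ _ (hw b)) (by
    change P.diff M i _ = 0
    rw [diff_map, hwz]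
    ext b
    exact (h𝒵 _ _ (hz b)).2)
  choose u hu hφu using fun b => hsurj _ (v b) (hv b)
  have key : ∀ b, ∃ y ∈ 𝒵 (p - P.deg (i + 1) b), j y = w b - P.diff N (i + 1) u b := by
    intro b
    refine hjφ _ _ (sub_mem (hw b) (Hom.diff hN hu b)) ?_
    have := congrFun (P.diff_map φ (i + 1) u) b
    simp only [hφu] at this
    rw [map_sub, ← this, hvw, sub_self]
  choose y hy hjy using key
  refine ⟨y, hy, ?_⟩
  ext b
  apply hj
  have := congrFun (P.diff_map j i y) b
  rw [← this]
  simp only [hjy]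
  change P.diff N i (w - P.diff N (i + 1) u) b = _
  rw [map_sub, diff_diff, sub_zero, hwz]

/-- `TorVanishes` only depends on the components of the family. -/
theorem TorVanishes.of_injective {Z : Type*} [AddCommGroup Z] [Module A Z]
    [Module K Z] {𝒵 : ι → Submodule K Z} (j : Z →ₗ[A] N) (hj : Function.Injective j)
    (h₁ : ∀ p, ∀ z ∈ 𝒵 p, j z ∈ 𝒩 p) (h₂ : ∀ p, ∀ x ∈ 𝒩 p, ∃ z ∈ 𝒵 p, j z = x)
    {i : ℕ} {p : ι} (h : P.TorVanishes 𝒩 i p) : P.TorVanishes 𝒵 i p := by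
  intro z hz hc
  obtain ⟨w, hw, hwz⟩ := h (fun b => j (z b)) (fun b => h₁ _ _ (hz b)) (hc.map P j)
  choose y hy hjy using fun b => h₂ _ _ (hw b)
  refine ⟨y, hy, ?_⟩
  ext b
  apply hj
  rw [← congrFun (P.diff_map j i y) b]
  simp only [hjy]
  exact congrFun hwz b

/-- Together with `TorVanishes.of_injective`, this identifies the vanishing for a module with that
for a family of subspaces of a larger module. Strands and syzygies can thus be treated as families
inside `R` or inside a free module. -/
theorem TorVanishes.to_ambient {Z : Type*} [AddCommGroup Z] [Module A Z]
    [Module K Z] {𝒵 : ι → Submodule K Z} (j : Z →ₗ[A] N) (hj : Function.Injective j)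
    (h₁ : ∀ p, ∀ z ∈ 𝒵 p, j z ∈ 𝒩 p) (h₂ : ∀ p, ∀ x ∈ 𝒩 p, ∃ z ∈ 𝒵 p, j z = x)
    {i : ℕ} {p : ι} (h : P.TorVanishes 𝒵 i p) : P.TorVanishes 𝒩 i p := by
  intro x hx hc
  choose z hz hjz using fun b => h₂ _ _ (hx b)
  obtain ⟨w, hw, hwz⟩ := h z hz (IsCycle.of_map P j hj (by simpa only [hjz] using hc))
  refine ⟨fun b => j (w b), fun b => h₁ _ _ (hw b), ?_⟩
  rw [diff_map, hwz]
  ext b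
  exact hjz b

theorem TorVanishes.of_eq_bot {i : ℕ} {p : ι} (h : ∀ q, 𝒩 q = ⊥) : P.TorVanishes 𝒩 i p := by
  intro z hz _
  refine ⟨0, fun b => zero_mem _, ?_⟩
  ext b
  have := hz b
  rw [h, Submodule.mem_bot] at this
  simp [this]

/-- `TorVanishes` for a finite direct sum. -/
theorem TorVanishes.pi {r : ℕ} {𝒩 : Fin r → ι → Submodule K N} {i : ℕ} {p : ι}
    (h : ∀ b, P.TorVanishes (𝒩 b) i p) :
    P.TorVanishes (fun q => Submodule.pi Set.univ fun b => 𝒩 b q) i p := by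
  intro z hz hc
  have key : ∀ b, ∃ w : P.β (i + 1) → N, P.Hom (𝒩 b) (i + 1) p w ∧
      P.diff N i w = fun b' => z b' b := fun b =>
    h b _ (fun b' => hz b' b trivial) (hc.map P (LinearMap.proj b))
  choose w hw hwz using key
  refine ⟨fun c b => w b c, fun c b _ => hw b c, ?_⟩
  ext c b
  have := congrFun (hwz b) c
  rw [← this]
  simp [diff_apply, Finset.sum_apply]

/-- `TorVanishes` for a shifted family. -/
theorem TorVanishes.shift {𝒩' : ι → Submodule K N} {s : ι} (hs : ∀ q, 𝒩' q = 𝒩 (q - s))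
    {i : ℕ} {p : ι} (h : P.TorVanishes 𝒩 i (p - s)) : P.TorVanishes 𝒩' i p := by
  have e : ∀ i (z : P.β i → N), P.Hom 𝒩' i p z ↔ P.Hom 𝒩 i (p - s) z := by
    intro i z
    refine forall_congr' fun b => ?_
    rw [hs]
    have : p - P.deg i b - s = p - s - P.deg i b := by abel
    rw [this]
  intro z hz hc
  obtain ⟨w, hw, hwz⟩ := h z ((e _ _).1 hz) hc
  exact ⟨w, (e _ _).2 hw, hwz⟩

/-- Homogeneous boundaries are boundaries of homogeneous elements. -/
theorem exists_hom_of_diff_eq (g : GradedProj 𝒩) (hN : GradedAction 𝒜 𝒩) {i : ℕ} {p : ι}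
    {z : P.β i → N} (hz : P.Hom 𝒩 i p z) {w : P.β (i + 1) → N} (hw : P.diff N i w = z) :
    P.diff N i (fun b => g.π (p - P.deg (i + 1) b) (w b)) = z := by
  ext b'
  rw [← g.same _ _ (hz b'), ← hw]
  simp only [diff_apply, map_sum]
  refine Finset.sum_congr rfl fun b _ => ?_
  have := g.proj_map g (DistribSMul.toAddMonoidHom N (P.D i b b'))
    (fun q => (P.deg (i + 1) b - P.deg i b') + q) (fun _ _ h => by simpa using h)
    (fun q x hx => hN _ _ _ (P.homogeneous i b b') x hx) (p - P.deg (i + 1) b) (w b)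
  simp only [DistribSMul.toAddMonoidHom_apply] at this
  rw [← this]
  congr 2
  abel

theorem exists_hom_of_mem_smul_top (g : GradedProj 𝒩) (hN : GradedAction 𝒜 𝒩) {p : ι}
    {z : P.β 0 → N} (hz : P.Hom 𝒩 0 p z)
    (hm : z default ∈ (irrelevantIdeal 𝒜 • ⊤ : Submodule A N)) :
    ∃ w, P.Hom 𝒩 1 p w ∧ P.diff N 0 w = z := by
  obtain ⟨w, hw⟩ := (P.mem_smul_top_iff N _).1 hm
  have hw' : P.diff N 0 w = z := by
    rw [hw]
    ext b
    rw [Unique.eq_default b]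
  exact ⟨_, fun b => g.mem _ _, P.exists_hom_of_diff_eq g hN hz hw'⟩

end ResidueResolution

namespace PosGrading

variable {𝒜 : ι → Submodule K A} {deg : ι →+ ℤ}

theorem gradedAction (G : PosGrading 𝒜 deg) : GradedAction 𝒜 𝒜 :=
  fun p q a ha x hx => G.mul_mem p q a ha x hx

theorem gradedAction_pi (G : PosGrading 𝒜 deg) {r : ℕ} (d : Fin r → ι) :
    GradedAction 𝒜 fun p => Submodule.pi Set.univ fun b : Fin r => 𝒜 (p - d b) := by
  intro p q a ha x hx b _
  have : p + q - d b = p + (q - d b) := add_sub_assoc _ _ _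
  change a • x b ∈ 𝒜 (p + q - d b)
  rw [this]
  exact G.mul_mem _ _ a ha _ (hx b trivial)

/-- The degree `0` part of a product with a factor of degree `p ≠ 0` involves the component of
degree `-p` of the other factor, and `p` and `-p` cannot both have positive total degree. -/
theorem proj_zero_of_mem (G : PosGrading 𝒜 deg) {a : A} (ha : a ∈ irrelevantIdeal 𝒜) :
    G.π 0 a = 0 := by
  -- The statement for all multiples of `a` is the one that survives the scalar step of the span
  -- induction.
  suffices h : ∀ c, G.π 0 (c * a) = 0 by simpa using h 1
  induction ha using Submodule.span_induction with
  | mem x h =>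
    obtain ⟨p, hp, hx⟩ := h
    intro c
    have := G.proj_map G.toGradedProj (AddMonoidHom.mulRight x) (fun q => q + p)
      (fun _ _ h => by simpa using h) (fun q y hy => G.mul_mem q p y hy x hx) (-p) c
    simp only [AddMonoidHom.mulRight_apply, neg_add_cancel] at this
    rw [this]
    by_contra hne
    have h1 : G.π (-p) c ≠ 0 := fun h => hne (by rw [h, zero_mul])
    have h2 : x ≠ 0 := fun h => hne (by rw [h, mul_zero])
    have h3 := G.pos _ _ (G.mem (-p) c) h1 (neg_ne_zero.2 hp)
    have h4 := G.pos _ _ hx h2 hp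
    rw [map_neg] at h3
    omega
  | zero => simp
  | add x y _ _ hx hy => intro c; rw [mul_add, map_add, hx, hy, add_zero]
  | smul d x _ hx => intro c; rw [smul_eq_mul, ← mul_assoc]; exact hx _

theorem eq_zero_of_mem (G : PosGrading 𝒜 deg) {a : A} (ha : a ∈ irrelevantIdeal 𝒜) (h0 : a ∈ 𝒜 0) :
    a = 0 := by
  rw [← G.same 0 a h0, G.proj_zero_of_mem ha]

end PosGrading

namespace ResidueResolution

variable {𝒜 : ι → Submodule K A} (P : ResidueResolution 𝒜) {deg : ι →+ ℤ}

theorem torVanishes_ring_succ (G : PosGrading 𝒜 deg) (i : ℕ) (p : ι) :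
    P.TorVanishes 𝒜 (i + 1) p := by
  intro z hz hc
  obtain ⟨w, hw⟩ := P.exact i z (fun b' => congrFun (show P.diff A i z = 0 from hc) b')
  exact ⟨_, fun b => G.mem _ _,
    P.exists_hom_of_diff_eq G.toGradedProj G.gradedAction hz (funext hw)⟩

theorem torVanishes_ring_zero (G : PosGrading 𝒜 deg) {p : ι} (hp : p ≠ 0) :
    P.TorVanishes 𝒜 0 p := by
  intro z hz _
  refine P.exists_hom_of_mem_smul_top G.toGradedProj G.gradedAction hz ?_
  have h := hz default
  rw [P.deg_zero, sub_zero] at h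
  have : z default ∈ irrelevantIdeal 𝒜 := Ideal.subset_span ⟨p, hp, h⟩
  simpa using this

theorem torVanishes_free (G : PosGrading 𝒜 deg) {r : ℕ} (d : Fin r → ι) {i : ℕ} {p : ι}
    (h : i ≠ 0 ∨ ∀ b, p ≠ d b) :
    P.TorVanishes (fun q => Submodule.pi Set.univ fun b : Fin r => 𝒜 (q - d b)) i p := by
  refine TorVanishes.pi P fun b => TorVanishes.shift P (fun q => rfl) ?_
  cases i with
  | zero =>
    exact P.torVanishes_ring_zero G (sub_ne_zero.2 ((h.resolve_left (by simp)) b))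
  | succ i => exact P.torVanishes_ring_succ G i _

end ResidueResolution

end


section

variable {ι K A : Type*} [AddCommGroup ι] [Field K] [CommRing A] [Algebra K A]

/-! ### Graded covers -/

section covers

variable {𝒜 : ι → Submodule K A} {deg : ι →+ ℤ} {N : Type*} [AddCommGroup N] [Module A N]
  [Module K N] {𝒩 : ι → Submodule K N}

/-- The family of the components of `⨁_b A(-d b)`. -/
def freeFamily (𝒜 : ι → Submodule K A) {r : ℕ} (d : Fin r → ι) (p : ι) :
    Submodule K (Fin r → A) :=
  Submodule.pi Set.univ fun b => 𝒜 (p - d b)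

theorem mem_freeFamily {r : ℕ} {d : Fin r → ι} {p : ι} {f : Fin r → A} :
    f ∈ freeFamily 𝒜 d p ↔ ∀ b, f b ∈ 𝒜 (p - d b) := by
  simp [freeFamily, Submodule.mem_pi]

theorem PosGrading.single_mem (G : PosGrading 𝒜 deg) {r : ℕ} (d : Fin r → ι) (b : Fin r) :
    Pi.single b 1 ∈ freeFamily 𝒜 d (d b) := by
  classical
  rw [mem_freeFamily]
  intro b'
  by_cases h : b' = b
  · subst h
    simpa using G.one_mem
  · simp [Pi.single_eq_of_ne h]

/-- A linear map out of a graded free module is homogeneous if it is so on the basis. -/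
theorem map_mem_of_freeFamily (hN : GradedAction 𝒜 𝒩) {r : ℕ} {d : Fin r → ι}
    (φ : (Fin r → A) →ₗ[A] N) (hφ : ∀ b, φ (Pi.single b 1) ∈ 𝒩 (d b)) (p : ι)
    (f : Fin r → A) (hf : f ∈ freeFamily 𝒜 d p) : φ f ∈ 𝒩 p := by
  classical
  rw [mem_freeFamily] at hf
  have : f = ∑ b, f b • (Pi.single b (1 : A) : Fin r → A) := by
    ext c
    simp [Finset.sum_apply, Pi.single_apply]
  rw [this, map_sum]
  refine Submodule.sum_mem _ fun b _ => ?_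
  rw [map_smul]
  simpa using hN _ _ _ (hf b) _ (hφ b)

/-- Homogeneous elements of the image of a homogeneous map lift to homogeneous elements. -/
theorem exists_lift_of_range (G : PosGrading 𝒜 deg) (g : GradedProj 𝒩) (hN : GradedAction 𝒜 𝒩)
    {r : ℕ} {d : Fin r → ι} (φ : (Fin r → A) →ₗ[A] N)
    (hφ : ∀ b, φ (Pi.single b 1) ∈ 𝒩 (d b)) (p : ι) (x : N) (hx : x ∈ 𝒩 p)
    (h : x ∈ LinearMap.range φ) : ∃ f ∈ freeFamily 𝒜 d p, φ f = x := by
  obtain ⟨f, rfl⟩ := h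
  refine ⟨(G.toGradedProj.pi d).π p f, (G.toGradedProj.pi d).mem p f, ?_⟩
  have := (G.toGradedProj.pi d).proj_map g φ.toAddMonoidHom id Function.injective_id
    (map_mem_of_freeFamily hN φ hφ) p f
  simp only [LinearMap.toAddMonoidHom_coe, id] at this
  rw [← this, g.same _ _ hx]

/-- The kernel of a homogeneous map is graded. -/
theorem proj_mem_ker (G : PosGrading 𝒜 deg) (g : GradedProj 𝒩) (hN : GradedAction 𝒜 𝒩)
    {r : ℕ} {d : Fin r → ι} (φ : (Fin r → A) →ₗ[A] N)
    (hφ : ∀ b, φ (Pi.single b 1) ∈ 𝒩 (d b)) (p : ι) (x : Fin r → A) (hx : x ∈ LinearMap.ker φ) :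
    (G.toGradedProj.pi d).π p x ∈ LinearMap.ker φ := by
  have := (G.toGradedProj.pi d).proj_map g φ.toAddMonoidHom id Function.injective_id
    (map_mem_of_freeFamily hN φ hφ) p x
  simp only [LinearMap.toAddMonoidHom_coe, id] at this
  rw [LinearMap.mem_ker, ← this, LinearMap.mem_ker.1 hx, map_zero]

theorem GradedAction.sub {N : Type*} [AddCommGroup N] [Module A N] [Module K N]
    [IsScalarTower K A N] {𝒩 : ι → Submodule K N} (hN : GradedAction 𝒜 𝒩) (Z : Submodule A N) :
    GradedAction 𝒜 (subFamily 𝒩 Z) :=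
  fun p q a ha x hx => hN p q a ha x hx

omit [Algebra K A] in
/-- A linear map out of a free module that is given by the images of a finite set. -/
theorem exists_cover_of_span {T : Finset N} {S : Set ι} (hT : ∀ x ∈ T, ∃ p ∈ S, x ∈ 𝒩 p)
    (hspan : Submodule.span A (T : Set N) = ⊤) :
    ∃ (r : ℕ) (g : Fin r → ι) (φ : (Fin r → A) →ₗ[A] N), Function.Surjective φ ∧ r = T.card ∧
      (∀ b, φ (Pi.single b 1) ∈ 𝒩 (g b)) ∧ (∀ b, g b ∈ S) ∧
      Set.range (fun b => φ (Pi.single b 1)) = T := by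
  classical
  choose! p hp using hT
  refine ⟨T.card, fun b => p (T.equivFin.symm b), Fintype.linearCombination A
    (fun b => ((T.equivFin.symm b : T) : N)), ?_, rfl, fun b => ?_, fun b => ?_, ?_⟩
  · rw [← LinearMap.range_eq_top, Fintype.range_linearCombination, ← hspan]
    congr 1
    ext x
    constructor
    · rintro ⟨b, rfl⟩
      exact (T.equivFin.symm b).2
    · intro hx
      exact ⟨T.equivFin ⟨x, hx⟩, by simp⟩
  · rw [Fintype.linearCombination_apply_single, one_smul]
    exact (hp _ (T.equivFin.symm b).2).2
  · exact (hp _ (T.equivFin.symm b).2).1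
  · ext x
    constructor
    · rintro ⟨b, rfl⟩
      dsimp only
      rw [Fintype.linearCombination_apply_single, one_smul]
      exact (T.equivFin.symm b).2
    · intro hx
      refine ⟨T.equivFin ⟨x, hx⟩, ?_⟩
      dsimp only
      rw [Fintype.linearCombination_apply_single, one_smul]
      simp

omit [Algebra K A] in
/-- Finitely generated graded modules have finite graded covers. -/
theorem exists_cover [Module.Finite A N] (g : GradedProj 𝒩) :
    ∃ (r : ℕ) (d : Fin r → ι) (φ : (Fin r → A) →ₗ[A] N), Function.Surjective φ ∧
      ∀ b, φ (Pi.single b 1) ∈ 𝒩 (d b) := by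
  have hs : Submodule.span A (⋃ p, (𝒩 p : Set N)) = ⊤ := by
    rw [eq_top_iff]
    rintro x -
    induction x using g.induction with
    | mem p x hx => exact Submodule.subset_span (Set.mem_iUnion.2 ⟨p, hx⟩)
    | zero => exact zero_mem _
    | add x y hx hy => exact add_mem hx hy
  have hfg : (Submodule.span A (⋃ p, (𝒩 p : Set N))).FG := by
    rw [hs]
    exact Module.Finite.fg_top
  obtain ⟨T, hT, hT'⟩ := (Submodule.fg_span_iff_fg_span_finset_subset _).1 hfg
  obtain ⟨r, d, φ, h₁, -, h₂, -, -⟩ := exists_cover_of_span (A := A) (𝒩 := 𝒩) (T := T)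
    (S := Set.univ) (fun x hx => by simpa using hT hx) (by rw [← hT', hs])
  exact ⟨r, d, φ, h₁, h₂⟩

/-- A graded module whose `Tor_0` is concentrated in one total degree is generated there. -/
theorem span_eq_top_of_torVanishes (G : PosGrading 𝒜 deg) (P : ResidueResolution 𝒜)
    (g : GradedProj 𝒩) (e : ℤ) (hlow : ∀ p, deg p < e → 𝒩 p = ⊥)
    (hgen : ∀ p, e < deg p → P.TorVanishes 𝒩 0 p) :
    Submodule.span A (⋃ p ∈ {p | deg p = e}, (𝒩 p : Set N)) = ⊤ := by
  set U := Submodule.span A (⋃ p ∈ {p | deg p = e}, (𝒩 p : Set N)) with hU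
  -- Induction on the total degree: above `e`, the vanishing of `Tor_0` puts a homogeneous element
  -- into `𝔪N`, as a combination of homogeneous elements of smaller total degree.
  have key : ∀ n : ℕ, ∀ p, deg p < e + n → ∀ x ∈ 𝒩 p, x ∈ U := by
    intro n
    induction n with
    | zero =>
      intro p hp x hx
      rw [hlow p (by simpa using hp), Submodule.mem_bot] at hx
      rw [hx]
      exact zero_mem _
    | succ n ih =>
      intro p hp x hx
      rcases lt_trichotomy (deg p) e with h | h | h
      · rw [hlow p h, Submodule.mem_bot] at hx
        rw [hx]
        exact zero_mem _
      · exact Submodule.subset_span (Set.mem_biUnion (show p ∈ {p | deg p = e} from h) hx)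
      · obtain ⟨w, hw, hwx⟩ := hgen p h (fun _ => x) (fun b => by
          rw [P.deg_zero, sub_zero]
          exact hx) trivial
        have := congrFun hwx default
        rw [ResidueResolution.diff_apply] at this
        rw [← this]
        refine Submodule.sum_mem _ fun b _ => ?_
        by_cases hD : P.D 0 b default = 0
        · rw [hD, zero_smul]
          exact zero_mem _
        · have hD' := P.homogeneous 0 b default
          rw [P.deg_zero, sub_zero] at hD'
          have hm : P.D 0 b default ∈ irrelevantIdeal 𝒜 := by
            rw [← P.span_range]
            exact Ideal.subset_span ⟨b, rfl⟩
          -- A nonzero entry of the first matrix cannot have degree `0`, since the irrelevant ideal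
          -- contains no nonzero element of that degree.
          have hne : P.deg 1 b ≠ 0 := fun h0 => hD (G.eq_zero_of_mem hm (h0 ▸ hD'))
          have hpos := G.pos _ _ hD' hD hne
          refine Submodule.smul_mem _ _ (ih _ ?_ _ (hw b))
          rw [map_sub]
          push_cast at hp
          linarith
  rw [eq_top_iff]
  rintro x -
  induction x using g.induction with
  | mem p x hx => exact key (deg p - e + 1).toNat p (by
      rcases lt_or_ge (deg p - e + 1) 0 with h | h
      · rw [Int.toNat_of_nonpos h.le]; simp; linarith
      · rw [Int.toNat_of_nonneg h]; linarith) x hx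
  | zero => exact zero_mem _
  | add x y hx hy => exact add_mem hx hy

/-- Minimal covers of graded modules generated in one total degree. -/
theorem exists_minimal_cover [Nontrivial A] [Module.Finite A N] (G : PosGrading 𝒜 deg) (e : ℤ)
    (hspan : Submodule.span A (⋃ p ∈ {p | deg p = e}, (𝒩 p : Set N)) = ⊤) :
    ∃ (r : ℕ) (d : Fin r → ι) (φ : (Fin r → A) →ₗ[A] N), Function.Surjective φ ∧
      (∀ b, φ (Pi.single b 1) ∈ 𝒩 (d b)) ∧ (∀ b, deg (d b) = e) ∧ (∀ b, 𝒩 (d b) ≠ ⊥) ∧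
      ∀ p, deg p ≤ e → ∀ f ∈ freeFamily 𝒜 d p, φ f = 0 → f = 0 := by
  classical
  have hfg : (Submodule.span A (⋃ p ∈ {p | deg p = e}, (𝒩 p : Set N))).FG := by
    rw [hspan]
    exact Module.Finite.fg_top
  have hex : ∃ k, ∃ T : Finset N, (∀ x ∈ T, ∃ p ∈ {p | deg p = e}, x ∈ 𝒩 p) ∧
      Submodule.span A (T : Set N) = ⊤ ∧ T.card = k := by
    obtain ⟨T, hT, hT'⟩ := (Submodule.fg_span_iff_fg_span_finset_subset _).1 hfg
    exact ⟨_, T, fun x hx => by simpa using hT hx, by rw [← hT', hspan], rfl⟩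
  obtain ⟨T, hT, hTs, hTc⟩ := Nat.find_spec hex
  have hmin : ∀ T' : Finset N, T' ⊆ T → Submodule.span A (T' : Set N) = ⊤ → T.card ≤ T'.card := by
    intro T' hsub hs
    rw [hTc]
    exact Nat.find_min' hex ⟨T', fun x hx => hT x (hsub hx), hs, rfl⟩
  obtain ⟨r, d, φ, hφ, hr, hmem, hd, hrange⟩ := exists_cover_of_span (A := A) hT hTs
  have hker : ∀ p, deg p ≤ e → ∀ f ∈ freeFamily 𝒜 d p, φ f = 0 → f = 0 := by
    intro p hp f hf hφf
    rw [mem_freeFamily] at hf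
    by_contra hne
    obtain ⟨b, hb⟩ := Function.ne_iff.1 hne
    -- All generators have total degree `e`, so a coefficient of a relation of total degree at most
    -- `e` has total degree at most `0`. A nonzero one lies in degree `0` and is a unit, which makes
    -- its generator redundant and contradicts the minimality of `T`.
    have hpb : p - d b = 0 := by
      by_contra h
      have h1 := G.pos _ _ (hf b) hb h
      rw [map_sub, show deg (d b) = e from hd b] at h1
      linarith
    have hu : IsUnit (f b) := G.unit _ (hpb ▸ hf b) hb
    let v : Fin r → N := fun b => φ (Pi.single b 1)
    have hv : ∑ c, f c • v c = 0 := by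
      rw [← hφf]
      have : f = ∑ b, f b • (Pi.single b (1 : A) : Fin r → A) := by
        ext c
        simp [Finset.sum_apply, Pi.single_apply]
      conv_rhs => rw [this, map_sum]
      simp [v]
    -- Distinct indices must give distinct generators, so that solving for `v b` uses only elements
    -- of `T.erase (v b)`. This holds since the `r = T.card` vectors have image `T`.
    have hinj : Function.Injective v := by
      have h1 : (Finset.univ.image v).card = (Finset.univ : Finset (Fin r)).card := by
        rw [Finset.card_univ, Fintype.card_fin]
        refine Eq.trans (congrArg _ ?_) hr.symm
        ext x
        rw [← Finset.mem_coe, ← Finset.mem_coe, ← hrange]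
        simp [v]
      exact fun x y hxy => Finset.card_image_iff.1 h1 (by simp) (by simp) hxy
    have hvT : ∀ c, v c ∈ T := fun c => by
      rw [← Finset.mem_coe, ← hrange]
      exact ⟨c, rfl⟩
    have hvb : v b ∈ Submodule.span A ((T.erase (v b) : Finset N) : Set N) := by
      rw [← Finset.add_sum_erase _ _ (Finset.mem_univ b)] at hv
      have h2 : f b • v b ∈ Submodule.span A ((T.erase (v b) : Finset N) : Set N) := by
        rw [eq_neg_of_add_eq_zero_left hv]
        refine neg_mem (Submodule.sum_mem _ fun c hc => Submodule.smul_mem _ _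
          (Submodule.subset_span ?_))
        rw [Finset.mem_coe, Finset.mem_erase]
        exact ⟨fun h => (Finset.ne_of_mem_erase hc) (hinj h), hvT c⟩
      obtain ⟨u, hu⟩ := hu
      rw [← hu] at h2
      have h3 := Submodule.smul_mem _ (↑u⁻¹ : A) h2
      rwa [smul_smul, Units.inv_mul, one_smul] at h3
    have hs : Submodule.span A ((T.erase (v b) : Finset N) : Set N) = ⊤ := by
      rw [eq_top_iff, ← hTs, Submodule.span_le]
      intro x hx
      by_cases hxb : x = v b
      · rw [hxb]
        exact hvb
      · exact Submodule.subset_span (by simp [hxb, Finset.mem_coe.1 hx])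
    have := hmin _ (Finset.erase_subset _ _) hs
    rw [Finset.card_erase_of_mem (hvT b)] at this
    have h5 : 0 < T.card := Finset.card_pos.2 ⟨_, hvT b⟩
    omega
  refine ⟨r, d, φ, hφ, hmem, hd, fun b hb => ?_, hker⟩
  have h0 := hmem b
  rw [hb, Submodule.mem_bot] at h0
  have := hker (d b) (le_of_eq (hd b)) _ (G.single_mem d b) h0
  simpa using congrFun this b

end covers

/-! ### Construction of graded free resolutions -/

/-- A graded submodule of a graded free module. -/
structure Syzygy (ι A : Type*) [CommRing A] where
  /-- the rank of the free module -/
  r : ℕ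
  /-- the degrees of the basis elements -/
  d : Fin r → ι
  /-- the submodule -/
  Z : Submodule A (Fin r → A)

theorem exists_gradedFreeResolution {𝒜 : ι → Submodule K A} {M : Type*} [AddCommGroup M]
    [Module A M] [Module K M] {ℳ : ι → Submodule K M} (Q : ℕ → Syzygy ι A → Prop)
    (S : ℕ → Set ι)
    (step : ∀ i s, Q i s → ∃ (r : ℕ) (d : Fin r → ι) (e : (Fin r → A) →ₗ[A] (Fin s.r → A)),
      (∀ b, e (Pi.single b 1) ∈ freeFamily 𝒜 s.d (d b)) ∧ LinearMap.range e = s.Z ∧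
      Q (i + 1) ⟨r, d, LinearMap.ker e⟩ ∧ ∀ b, d b ∈ S (i + 1))
    {r : ℕ} (d : Fin r → ι) (φ : (Fin r → A) →ₗ[A] M)
    (hφ : ∀ b, φ (Pi.single b 1) ∈ ℳ (d b)) (hsurj : Function.Surjective φ)
    (hQ : Q 0 ⟨r, d, LinearMap.ker φ⟩) (hS : ∀ b, d b ∈ S 0) :
    ∃ F : GradedFreeResolution 𝒜 ℳ, ∀ i b, F.deg i b ∈ S i := by
  -- `Q` is the invariant that allows the next syzygy module to be covered, and the resolution is
  -- obtained by iterating the chosen covers. The sets `S i` record the degrees of the basis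
  -- elements.
  choose! rk dg e hhom hrange hQ' hdg using step
  let next : ℕ → Syzygy ι A → Syzygy ι A := fun i s => ⟨rk i s, dg i s, LinearMap.ker (e i s)⟩
  let seq : ℕ → Syzygy ι A := fun i => Nat.rec ⟨r, d, LinearMap.ker φ⟩ next i
  have hseq : ∀ i, Q i (seq i) := by
    intro i
    induction i with
    | zero => exact hQ
    | succ i ih => exact hQ' i _ ih
  let F : GradedFreeResolution 𝒜 ℳ :=
    { rank := fun i => (seq i).r
      deg := fun i => (seq i).d
      d := fun i => e i (seq i)
      aug := φ
      d_homogeneous := fun i b b' => mem_freeFamily.1 (hhom i (seq i) (hseq i) b) b'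
      aug_homogeneous := hφ
      aug_surjective := hsurj
      exact_zero := LinearMap.exact_iff.2 (hrange 0 _ (hseq 0)).symm
      exact_succ := fun i => LinearMap.exact_iff.2 (hrange (i + 1) _ (hseq (i + 1))).symm }
  refine ⟨F, fun i b => ?_⟩
  cases i with
  | zero => exact hS b
  | succ i => exact hdg i (seq i) (hseq i) b

/-- Over a noetherian graded ring, finitely generated graded modules have graded resolutions by
free modules of finite rank. -/
theorem exists_resolution_of_noetherian {𝒜 : ι → Submodule K A} {deg : ι →+ ℤ}
    [IsNoetherianRing A] (G : PosGrading 𝒜 deg) {M : Type*} [AddCommGroup M]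
    [Module A M] [Module K M] [Module.Finite A M] {ℳ : ι → Submodule K M} (g : GradedProj ℳ)
    (hM : GradedAction 𝒜 ℳ) : Nonempty (GradedFreeResolution 𝒜 ℳ) := by
  obtain ⟨r, d, φ, hsurj, hφ⟩ := exists_cover (A := A) g
  obtain ⟨F, -⟩ := exists_gradedFreeResolution (𝒜 := 𝒜) (ℳ := ℳ)
    (fun _ s => ∀ p, ∀ z ∈ s.Z, (G.toGradedProj.pi s.d).π p z ∈ s.Z) (fun _ => Set.univ)
    (fun i s hs => by
      obtain ⟨r', d', ψ, hψ, hψ'⟩ := exists_cover (A := A) ((G.toGradedProj.pi s.d).sub s.Z hs)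
      have hh : ∀ b, (s.Z.subtype ∘ₗ ψ) (Pi.single b 1) ∈ freeFamily 𝒜 s.d (d' b) :=
        fun b => hψ' b
      refine ⟨r', d', s.Z.subtype ∘ₗ ψ, hh, ?_, ?_, fun b => trivial⟩
      · rw [LinearMap.range_comp, LinearMap.range_eq_top.2 hψ, Submodule.map_top,
          Submodule.range_subtype]
      · exact fun p z hz => proj_mem_ker G (G.toGradedProj.pi s.d) (G.gradedAction_pi s.d)
          (s.Z.subtype ∘ₗ ψ) hh p z hz)
    d φ hφ hsurj (fun p z hz => proj_mem_ker G g hM φ hφ p z hz) (fun b => trivial)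
  exact ⟨F⟩

/-- The first step of a linear resolution. -/
theorem exists_linear_cover {𝒜 : ι → Submodule K A} {deg : ι →+ ℤ} [Nontrivial A]
    (G : PosGrading 𝒜 deg) (P : ResidueResolution 𝒜) {M : Type*}
    [AddCommGroup M] [Module A M] [Module K M] [Module.Finite A M] {ℳ : ι → Submodule K M}
    (g : GradedProj ℳ) (hM : GradedAction 𝒜 ℳ) (e : ℤ) (hlow : ∀ p, deg p < e → ℳ p = ⊥)
    (htor : ∀ (i : ℕ) p, i + e < deg p → P.TorVanishes ℳ i p) (T : Set ι)
    (hT : ∀ p, ℳ p ≠ ⊥ → p ∈ T) (hAT : ∀ p q, q ∈ T → 𝒜 (p - q) ≠ ⊥ → p ∈ T) :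
    ∃ (r : ℕ) (d : Fin r → ι) (φ : (Fin r → A) →ₗ[A] M), Function.Surjective φ ∧
      (∀ b, φ (Pi.single b 1) ∈ ℳ (d b)) ∧ (∀ b, deg (d b) = e ∧ d b ∈ T) ∧
      (∀ p, deg p < e + 1 → subFamily (freeFamily 𝒜 d) (LinearMap.ker φ) p = ⊥) ∧
      (∀ (i : ℕ) p, i + (e + 1) < deg p →
        P.TorVanishes (subFamily (freeFamily 𝒜 d) (LinearMap.ker φ)) i p) ∧
      (∀ p, subFamily (freeFamily 𝒜 d) (LinearMap.ker φ) p ≠ ⊥ → p ∈ T) := by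
  obtain ⟨r, d, φ, hsurj, hφ, hd, hd', hker⟩ := exists_minimal_cover G e
    (span_eq_top_of_torVanishes G P g e hlow fun p hp => htor 0 p (by simpa using hp))
  refine ⟨r, d, φ, hsurj, hφ, fun b => ⟨hd b, hT _ (hd' b)⟩, fun p hp => ?_, fun i p hp => ?_,
    fun p hp => ?_⟩
  -- Minimality of the cover excludes relations of total degree at most `e`, so the kernel starts in
  -- total degree `e + 1`.
  · rw [eq_bot_iff]
    rintro ⟨z, hz⟩ hz'
    have := hker p (by omega) z hz' hz
    simpa using this
  -- In the long exact sequence `Tor_i` of the kernel lies between `Tor_{i+1}(M)` and `Tor_i` of the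
  -- free module; the latter is zero here because its generators have total degree `e`.
  · refine ResidueResolution.TorVanishes.kernel P (ℳ := ℳ) (𝒩 := freeFamily 𝒜 d)
      (G.gradedAction_pi d)
      (LinearMap.ker φ).subtype (Submodule.injective_subtype _) φ
      (fun p x hx h0 => ⟨⟨x, h0⟩, hx, rfl⟩) (fun p z hz => ⟨hz, z.2⟩)
      (map_mem_of_freeFamily hM φ hφ)
      (fun p y hy => exists_lift_of_range G g hM φ hφ p y hy (hsurj y))
      (P.torVanishes_free G d (Or.inr fun b hb => ?_)) (htor (i + 1) p (by push_cast; linarith))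
    rw [hb, hd b] at hp
    linarith [Int.natCast_nonneg i]
  · obtain ⟨⟨z, hz⟩, hz', hne⟩ := (Submodule.ne_bot_iff _).1 hp
    have hz0 : z ≠ 0 := fun h => hne (by simpa using h)
    obtain ⟨b, hb⟩ := Function.ne_iff.1 hz0
    refine hAT p (d b) (hT _ (hd' b)) ((Submodule.ne_bot_iff _).2 ⟨z b, ?_, hb⟩)
    exact mem_freeFamily.1 hz' b
/-- A graded module whose `Tor_i` vanishes in total degrees larger than `i + e`, and which
vanishes in total degrees less than `e`, has a graded free resolution with basis elements of total
degree `i + e` in homological degree `i`. -/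
theorem exists_linear_resolution {𝒜 : ι → Submodule K A} {deg : ι →+ ℤ} [Nontrivial A]
    [IsNoetherianRing A] (G : PosGrading 𝒜 deg) (P : ResidueResolution 𝒜) {M : Type*}
    [AddCommGroup M] [Module A M] [Module K M] [Module.Finite A M] {ℳ : ι → Submodule K M}
    (g : GradedProj ℳ) (hM : GradedAction 𝒜 ℳ) (e : ℤ) (hlow : ∀ p, deg p < e → ℳ p = ⊥)
    (htor : ∀ (i : ℕ) p, i + e < deg p → P.TorVanishes ℳ i p) (T : Set ι)
    (hT : ∀ p, ℳ p ≠ ⊥ → p ∈ T) (hAT : ∀ p q, q ∈ T → 𝒜 (p - q) ≠ ⊥ → p ∈ T) :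
    ∃ F : GradedFreeResolution 𝒜 ℳ, ∀ i b, deg (F.deg i b) = i + e ∧ F.deg i b ∈ T := by
  obtain ⟨r, d, φ, hsurj, hφ, hd, h1, h2, h3⟩ :=
    exists_linear_cover G P g hM e hlow htor T hT hAT
  obtain ⟨F, hF⟩ := exists_gradedFreeResolution (𝒜 := 𝒜) (ℳ := ℳ)
    (fun i s => (∀ p, ∀ z ∈ s.Z, (G.toGradedProj.pi s.d).π p z ∈ s.Z) ∧
      (∀ p, deg p < i + e + 1 → subFamily (freeFamily 𝒜 s.d) s.Z p = ⊥) ∧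
      (∀ j : ℕ, ∀ p, j + (i + e + 1) < deg p →
        P.TorVanishes (subFamily (freeFamily 𝒜 s.d) s.Z) j p) ∧
      (∀ p, subFamily (freeFamily 𝒜 s.d) s.Z p ≠ ⊥ → p ∈ T))
    (fun i => {p | deg p = i + e ∧ p ∈ T})
    (fun i s hs => by
      obtain ⟨hs0, hs1, hs2, hs3⟩ := hs
      obtain ⟨r', d', ψ, hψ, hψ', hd', h1', h2', h3'⟩ := exists_linear_cover G P
        ((G.toGradedProj.pi s.d).sub s.Z hs0) ((G.gradedAction_pi s.d).sub s.Z) (i + e + 1)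
        hs1 hs2 T hs3 hAT
      have hh : ∀ b, (s.Z.subtype ∘ₗ ψ) (Pi.single b 1) ∈ freeFamily 𝒜 s.d (d' b) :=
        fun b => hψ' b
      have hk : LinearMap.ker (s.Z.subtype ∘ₗ ψ) = LinearMap.ker ψ :=
        LinearMap.ker_comp_of_ker_eq_bot _ (Submodule.ker_subtype _)
      refine ⟨r', d', s.Z.subtype ∘ₗ ψ, hh, ?_, ⟨?_, ?_, ?_, ?_⟩, fun b => ⟨?_, (hd' b).2⟩⟩
      · rw [LinearMap.range_comp, LinearMap.range_eq_top.2 hψ, Submodule.map_top,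
          Submodule.range_subtype]
      · exact fun p z hz => proj_mem_ker G (G.toGradedProj.pi s.d) (G.gradedAction_pi s.d)
          (s.Z.subtype ∘ₗ ψ) hh p z hz
      · rw [hk]
        exact fun p hp => h1' p (by push_cast at hp; linarith)
      · rw [hk]
        exact fun j p hp => h2' j p (by push_cast at hp; linarith)
      · rw [hk]
        exact h3'
      · rw [(hd' b).1]
        push_cast
        ring)
    d φ hφ hsurj ⟨fun p z hz => proj_mem_ker G g hM φ hφ p z hz, by simpa using h1,
      by simpa using h2, h3⟩ (fun b => by simpa using hd b)
  exact ⟨F, hF⟩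

/-! ### From resolutions of the irrelevant ideal to resolutions of the residue field -/

theorem map_eq_sum_single {r : ℕ} {N : Type*} [AddCommGroup N] [Module A N]
    (φ : (Fin r → A) →ₗ[A] N) (f : Fin r → A) : φ f = ∑ b, f b • φ (Pi.single b 1) := by
  have : f = ∑ b, f b • (Pi.single b (1 : A) : Fin r → A) := by
    ext c
    simp [Finset.sum_apply, Pi.single_apply]
  conv_lhs => rw [this, map_sum]
  simp

/-- The resolution `⋯ → F₁ → F₀ → A` of the residue field that is induced by a resolution `F` of
the irrelevant ideal. -/
def GradedFreeResolution.toResidueResolution {𝒜 : ι → Submodule K A}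
    (F : GradedFreeResolution 𝒜 (subFamily 𝒜 (irrelevantIdeal 𝒜))) : ResidueResolution 𝒜 where
  β i := Nat.rec Unit (fun i _ => Fin (F.rank i)) i
  fin i := match i with
    | 0 => inferInstanceAs (Fintype Unit)
    | i + 1 => inferInstanceAs (Fintype (Fin (F.rank i)))
  deg i := match i with
    | 0 => fun _ => 0
    | i + 1 => F.deg i
  D i := match i with
    | 0 => fun b _ => (F.aug (Pi.single b 1) : A)
    | i + 1 => fun b b' => F.d i (Pi.single b 1) b'
  uniq := inferInstanceAs (Unique Unit)
  deg_zero _ := rfl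
  homogeneous i b b' := match i with
    | 0 => (sub_zero (F.deg 0 b)).symm ▸ F.aug_homogeneous b
    | i + 1 => F.d_homogeneous i b b'
  span_range := by
    apply le_antisymm
    · rw [Ideal.span_le]
      rintro _ ⟨b, rfl⟩
      exact (F.aug _).2
    · intro x hx
      obtain ⟨f, hf⟩ := F.aug_surjective ⟨x, hx⟩
      have : x = ((F.aug f : irrelevantIdeal 𝒜) : A) := by rw [hf]
      rw [this, map_eq_sum_single]
      simp only [Submodule.coe_sum, Submodule.coe_smul, smul_eq_mul]
      exact Ideal.sum_mem _ fun b _ => Ideal.mul_mem_left _ _ (Ideal.subset_span ⟨b, rfl⟩)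
  comp i b b'' := match i with
    | 0 => by
      have h := F.exact_zero.apply_apply_eq_zero (Pi.single b 1)
      rw [map_eq_sum_single] at h
      simpa using congrArg Subtype.val h
    | i + 1 => by
      have h := (F.exact_succ i).apply_apply_eq_zero (Pi.single b 1)
      rw [map_eq_sum_single] at h
      simpa [Finset.sum_apply] using congrFun h b''
  exact i z hz := match i with
    | 0 => by
      have h : F.aug z = 0 := by
        rw [map_eq_sum_single]
        ext
        have := hz ()
        simpa [mul_comm] using this
      obtain ⟨w, hw⟩ := (F.exact_zero z).1 h
      refine ⟨w, fun b' => ?_⟩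
      rw [← hw, map_eq_sum_single]
      simp only [Finset.sum_apply, Pi.smul_apply, smul_eq_mul]
      exact Finset.sum_congr rfl fun b _ => mul_comm _ _
    | i + 1 => by
      have h : F.d i z = 0 := by
        rw [map_eq_sum_single]
        ext b'
        have := hz b'
        simp only [Finset.sum_apply, Pi.smul_apply, smul_eq_mul, Pi.zero_apply]
        rw [← this]
        exact Finset.sum_congr rfl fun b _ => mul_comm _ _
      obtain ⟨w, hw⟩ := (F.exact_succ i z).1 h
      refine ⟨w, fun b' => ?_⟩
      rw [← hw, map_eq_sum_single]
      simp only [Finset.sum_apply, Pi.smul_apply, smul_eq_mul]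
      exact Finset.sum_congr rfl fun b _ => mul_comm _ _

/-- A submodule spanned by homogeneous elements is stable under the projections. -/
theorem proj_mem_span {𝒜 : ι → Submodule K A} {N : Type*} [AddCommGroup N] [Module A N]
    [Module K N] {𝒩 : ι → Submodule K N} (g' : GradedProj 𝒜) (g : GradedProj 𝒩)
    (hN : GradedAction 𝒜 𝒩) {X : Set N} (hX : ∀ x ∈ X, ∃ p, x ∈ 𝒩 p) (p : ι) (x : N)
    (hx : x ∈ Submodule.span A X) : g.π p x ∈ Submodule.span A X := by
  induction hx using Submodule.closure_induction with
  | zero => simp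
  | add x y _ _ hx hy => rw [map_add]; exact add_mem hx hy
  | smul_mem a x hx =>
    obtain ⟨q, hq⟩ := hX x hx
    have := g'.proj_map g (((LinearMap.id : A →ₗ[A] A).smulRight x).toAddMonoidHom)
      (fun p => p + q) (fun _ _ h => by simpa using h) (fun p a ha => hN p q a ha x hq) (p - q) a
    simp only [LinearMap.toAddMonoidHom_coe, LinearMap.smulRight_apply, LinearMap.id_apply,
      sub_add_cancel] at this
    rw [this]
    exact Submodule.smul_mem _ _ (Submodule.subset_span hx)

theorem proj_mem_irrelevantIdeal {𝒜 : ι → Submodule K A} {deg : ι →+ ℤ} (G : PosGrading 𝒜 deg)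
    (p : ι) (x : A) (hx : x ∈ irrelevantIdeal 𝒜) : G.π p x ∈ irrelevantIdeal 𝒜 :=
  proj_mem_span G.toGradedProj G.toGradedProj G.gradedAction
    (fun _ h => h.imp fun _ h' => h'.2) p x hx

/-- Prepending `A` to a resolution of the irrelevant ideal resolves the residue field. -/
theorem exists_residueResolution {𝒜 : ι → Submodule K A} {deg : ι →+ ℤ}
    [IsNoetherianRing A] (G : PosGrading 𝒜 deg) : Nonempty (ResidueResolution 𝒜) := by
  obtain ⟨F⟩ := exists_resolution_of_noetherian G
    (G.toGradedProj.sub (irrelevantIdeal 𝒜) (proj_mem_irrelevantIdeal G))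
    (G.gradedAction.sub (irrelevantIdeal 𝒜))
  exact ⟨F.toResidueResolution⟩

end


section

variable {ι K A : Type*} [AddCommGroup ι] [Field K] [CommRing A] [Algebra K A]

/-! ### `Tor` is balanced -/

section balanced

variable {𝒜 : ι → Submodule K A} {deg : ι →+ ℤ} {M : Type*} [AddCommGroup M] [Module A M]
  [Module K M] {ℳ : ι → Submodule K M}

/-- The image of a homogeneous map is graded. -/
theorem proj_mem_range {N : Type*} [AddCommGroup N] [Module A N] [Module K N]
    {𝒩 : ι → Submodule K N} (G : PosGrading 𝒜 deg) (g : GradedProj 𝒩) (hN : GradedAction 𝒜 𝒩)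
    {r : ℕ} {d : Fin r → ι} (φ : (Fin r → A) →ₗ[A] N)
    (hφ : ∀ b, φ (Pi.single b 1) ∈ 𝒩 (d b)) (p : ι) (x : N) (hx : x ∈ LinearMap.range φ) :
    g.π p x ∈ LinearMap.range φ := by
  obtain ⟨f, rfl⟩ := hx
  have := (G.toGradedProj.pi d).proj_map g φ.toAddMonoidHom id Function.injective_id
    (map_mem_of_freeFamily hN φ hφ) p f
  simp only [LinearMap.toAddMonoidHom_coe, id] at this
  rw [this]
  exact ⟨_, rfl⟩

namespace GradedFreeResolution

theorem cycles_le_boundaries (F : GradedFreeResolution 𝒜 ℳ) {i : ℕ} {p : ι}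
    (h : Subsingleton (F.Tor i p)) : F.cycles i p ≤ F.boundaries i p := by
  have := (Submodule.Quotient.subsingleton_iff).1 h
  intro x hx
  have hx' : (⟨x, hx⟩ : F.cycles i p) ∈ (F.boundaries i p).submoduleOf (F.cycles i p) := by
    rw [this]
    trivial
  exact hx'

variable (F : GradedFreeResolution 𝒜 ℳ)

theorem d_single_mem (i : ℕ) (b : Fin (F.rank (i + 1))) :
    F.d i (Pi.single b 1) ∈ freeFamily 𝒜 (F.deg i) (F.deg (i + 1) b) :=
  mem_freeFamily.2 (F.d_homogeneous i b)

/-- Boundaries of homogeneous tuples lying in a syzygy module are boundaries of tuples in the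
syzygy module, provided that `Tor` vanishes. -/
theorem exists_diff_eq_of_subsingleton_tor (G : PosGrading 𝒜 deg) (P : ResidueResolution 𝒜)
    {p : ι} (j : ℕ) : ∀ i, Subsingleton (F.Tor (i + 1 + j) p) →
    ∀ y : P.β j → (Fin (F.rank i) → A), P.Hom (freeFamily 𝒜 (F.deg i)) j p y →
      (∀ b, y b ∈ LinearMap.range (F.d i)) → P.IsCycle j y →
      (∃ u, P.Hom (freeFamily 𝒜 (F.deg i)) (j + 1) p u ∧ P.diff _ j u = y) →
      ∃ w, P.Hom (freeFamily 𝒜 (F.deg i)) (j + 1) p w ∧ (∀ b, w b ∈ LinearMap.range (F.d i)) ∧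
        P.diff _ j w = y := by
  -- Put `Z_i = range (F.d i)`. The statement is the injectivity of `Tor_j(Z_i) → Tor_j(F_i)` in
  -- degree `p`, whose kernel is the image of `Tor_{j+1}(F_i/Z_i)`. By dimension shifting this is
  -- `Tor_{i+1+j}(M)`. Each induction step trades one unit of `j` for one of `i`.
  induction j with
  | zero =>
    intro i htor y hy hyr _ hu
    obtain ⟨u, -, huy⟩ := hu
    set x := y default with hx
    have hxm : x ∈ (irrelevantIdeal 𝒜 • ⊤ : Submodule A (Fin (F.rank i) → A)) := by
      refine (P.mem_smul_top_iff _ x).2 ⟨u, ?_⟩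
      rw [huy]
      ext1 b
      rw [Unique.eq_default b]
    have hxp : x ∈ freeFamily 𝒜 (F.deg i) p := by
      have := hy default
      rwa [P.deg_zero, sub_zero] at this
    obtain ⟨v, hv, hvx⟩ := exists_lift_of_range G (G.toGradedProj.pi (F.deg i))
      (G.gradedAction_pi _) (F.d i) (F.d_single_mem i) p x hxp (hyr default)
    -- Since `x = d v` lies in `𝔪 F_i`, the class of `v` is a cycle of `F ⊗ K`. The vanishing of
    -- `Tor_{i+1}` then makes `v` a boundary modulo `𝔪 F_{i+1}`, whence `x ∈ 𝔪 Z_i`.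
    have hvc : v ∈ F.cycles (i + 1) p := by
      refine ⟨hv, ?_⟩
      change F.d i v ∈ F.irrelevant i
      rw [hvx]
      exact hxm
    have hvb := (F.cycles_le_boundaries htor hvc).2
    obtain ⟨a, ⟨a', ha'⟩, c, hc, hac⟩ := Submodule.mem_sup.1 hvb
    have hxr : x ∈ irrelevantIdeal 𝒜 • LinearMap.range (F.d i) := by
      rw [← hvx, ← hac, map_add, ← ha', (F.exact_succ i).apply_apply_eq_zero, zero_add,
        ← Submodule.map_top, ← Submodule.map_smul'']
      exact Submodule.mem_map_of_mem hc
    obtain ⟨w, hw, hwz⟩ := P.exists_hom_of_mem_smul_top (p := p)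
      (𝒩 := subFamily (freeFamily 𝒜 (F.deg i)) (LinearMap.range (F.d i)))
      ((G.toGradedProj.pi (F.deg i)).sub _ (proj_mem_range G (G.toGradedProj.pi (F.deg i))
        (G.gradedAction_pi _) (F.d i) (F.d_single_mem i)))
      (GradedAction.sub (G.gradedAction_pi _) _) (z := fun b => ⟨y b, hyr b⟩) hy
      ((Submodule.mem_smul_top_iff _ _ _).2 hxr)
    refine ⟨fun b => w b, hw, fun b => (w b).2, ?_⟩
    have := P.diff_map (LinearMap.range (F.d i)).subtype 0 w
    simp only [Submodule.subtype_apply] at this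
    rw [this, hwz]
  | succ j ih =>
    intro i htor y hy hyr hc _
    have key : P.TorVanishes (fun q => freeFamily 𝒜 (F.deg i) q ⊓
        (LinearMap.range (F.d i)).restrictScalars K) (j + 1) p := by
      -- `Z_i` is covered by `F_{i+1}` with kernel `Z_{i+1}`, and the higher `Tor` of `F_{i+1}` is
      -- zero. What remains is the injectivity statement for `Z_{i+1}` in index `j`.
      refine ResidueResolution.TorVanishes.quotient P (𝒩 := freeFamily 𝒜 (F.deg (i + 1)))
        (G.gradedAction_pi _) (F.d i) ?_ (P.torVanishes_free G _ (Or.inl (by simp))) ?_ ?_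
      · intro q z hz
        exact exists_lift_of_range G (G.toGradedProj.pi (F.deg i))
          (G.gradedAction_pi _) (F.d i) (F.d_single_mem i) q z hz.1 hz.2
      · intro q x hx
        exact ⟨map_mem_of_freeFamily (G.gradedAction_pi _) (F.d i) (F.d_single_mem i) q x hx,
          ⟨x, rfl⟩⟩
      · intro k hk z hz hz0 hzc hzu
        obtain rfl : j = k := by omega
        have hr : ∀ b, z b ∈ LinearMap.range (F.d (i + 1)) :=
          fun b => (F.exact_succ i (z b)).1 (hz0 b)
        obtain ⟨w, hw, hwr, hwz⟩ := ih (i + 1)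
          (by rwa [show i + 1 + 1 + j = i + 1 + (j + 1) by omega]) z hz hr hzc hzu
        refine ⟨w, hw, fun b => ?_, hwz⟩
        exact (F.exact_succ i (w b)).2 (hwr b)
    obtain ⟨w, hw, hwy⟩ := key y (fun b => ⟨hy b, hyr b⟩) hc
    exact ⟨w, fun b => (hw b).1, fun b => (hw b).2, hwy⟩

/-- The vanishing of `Tor` can be tested with a resolution of the residue field. -/
theorem torVanishes (G : PosGrading 𝒜 deg) (P : ResidueResolution 𝒜) (g : GradedProj ℳ)
    (hM : GradedAction 𝒜 ℳ) {i : ℕ} {p : ι} (h : Subsingleton (F.Tor i p)) :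
    P.TorVanishes ℳ i p := by
  cases i with
  | zero =>
    intro z hz _
    have hzp : z default ∈ ℳ p := by
      have := hz default
      rwa [P.deg_zero, sub_zero] at this
    obtain ⟨v, hv, hvx⟩ := exists_lift_of_range G g hM F.aug F.aug_homogeneous p _ hzp
      (F.aug_surjective _)
    have hvb := (F.cycles_le_boundaries h (show v ∈ F.cycles 0 p from hv)).2
    obtain ⟨a, ⟨a', ha'⟩, c, hc, hac⟩ := Submodule.mem_sup.1 hvb
    refine P.exists_hom_of_mem_smul_top g hM hz ?_
    rw [← hvx, ← hac, map_add, ← ha', F.exact_zero.apply_apply_eq_zero, zero_add]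
    have := Submodule.mem_map_of_mem (f := F.aug) hc
    rw [irrelevant, Submodule.map_smul''] at this
    exact Submodule.smul_mono le_rfl le_top this
  | succ i =>
    -- The same shift once more, for `F_0 → M` with kernel `Z_0`.
    refine ResidueResolution.TorVanishes.quotient P (𝒩 := freeFamily 𝒜 (F.deg 0))
      (G.gradedAction_pi _) F.aug ?_ (P.torVanishes_free G _ (Or.inl (by simp))) ?_ ?_
    · intro q z hz
      exact exists_lift_of_range G g hM F.aug F.aug_homogeneous q z hz (F.aug_surjective _)
    · exact map_mem_of_freeFamily hM F.aug F.aug_homogeneous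
    · intro k hk z hz hz0 hzc hzu
      obtain rfl : i = k := by omega
      have hr : ∀ b, z b ∈ LinearMap.range (F.d 0) := fun b => (F.exact_zero (z b)).1 (hz0 b)
      obtain ⟨w, hw, hwr, hwz⟩ := F.exists_diff_eq_of_subsingleton_tor G P i 0
        (by rwa [show 0 + 1 + i = i + 1 by omega]) z hz hr hzc hzu
      exact ⟨w, hw, fun b => (F.exact_zero (w b)).2 (hwr b), hwz⟩

/-- `Tor` vanishes in the degrees in which the free modules have no basis elements. -/
theorem subsingleton_tor {i : ℕ} {p : ι} (h : ∀ b, F.deg i b ≠ p) : Subsingleton (F.Tor i p) := by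
  have hm : F.component i p ≤ (F.irrelevant i).restrictScalars K := by
    intro f hf
    change f ∈ (irrelevantIdeal 𝒜 • ⊤ : Submodule A (Fin (F.rank i) → A))
    have : f = ∑ b, f b • (Pi.single b (1 : A) : Fin (F.rank i) → A) := by
      ext c
      simp [Finset.sum_apply, Pi.single_apply]
    rw [this]
    refine Submodule.sum_mem _ fun b _ => Submodule.smul_mem_smul (Ideal.subset_span
      ⟨p - F.deg i b, sub_ne_zero.2 (h b).symm, mem_freeFamily.1 hf b⟩) trivial
  rw [Submodule.Quotient.subsingleton_iff, eq_top_iff]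
  rintro ⟨x, hx⟩ -
  have hxc : x ∈ F.component i p := by
    cases i with
    | zero => exact hx
    | succ i => exact hx.1
  exact ⟨hxc, Submodule.mem_sup_right (hm hxc)⟩

end GradedFreeResolution

end balanced

/-! ### Chain maps into `N ⊗ P` -/

/-- Exactness of `P` is applied in each coordinate. The finitely many entries of `z` have their
supports in one finite set `s`, and keeping only the preimages for coordinates in `s` gives finitely
supported entries. -/
theorem ResidueResolution.exists_diff_eq_finsupp {𝒜 : ι → Submodule K A}
    (P : ResidueResolution 𝒜) {X : Type*} (i : ℕ) (z : P.β (i + 1) → (X →₀ A))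
    (hz : P.diff _ i z = 0) : ∃ w, P.diff (X →₀ A) (i + 1) w = z := by
  classical
  have key : ∀ x, ∃ w : P.β (i + 2) → A, P.diff A (i + 1) w = fun b => z b x := by
    intro x
    have h := P.diff_map (Finsupp.lapply x : (X →₀ A) →ₗ[A] A) i z
    rw [hz] at h
    obtain ⟨w, hw⟩ := P.exact i (fun b => z b x) (fun b' => by
      simpa [diff_apply] using congrFun h b')
    exact ⟨w, funext hw⟩
  choose W hW using key
  let s : Finset X := Finset.univ.biUnion fun b => (z b).support
  refine ⟨fun c => ∑ x ∈ s, Finsupp.single x (W x c), ?_⟩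
  ext b x
  rw [diff_apply]
  have h1 : ∀ c, (∑ x' ∈ s, Finsupp.single x' (W x' c)) x = if x ∈ s then W x c else 0 := by
    intro c
    simp [Finsupp.finsetSum_apply, Finsupp.single_apply]
  rw [Finsupp.finsetSum_apply]
  simp only [Finsupp.smul_apply, h1]
  split_ifs with hx
  · exact congrFun (hW x) b
  · simp only [smul_zero, Finset.sum_const_zero]
    by_contra h
    exact hx (Finset.mem_biUnion.2 ⟨b, Finset.mem_univ _, Finsupp.mem_support_iff.2 (Ne.symm h)⟩)

end

universe u

/-- A chain map from a complex of free modules to `N ⊗ P` sends the cycles with entries in the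
irrelevant ideal to boundaries. -/
theorem ResidueResolution.exists_diff_eq_of_chainMap {ι K : Type*} {A : Type u} [AddCommGroup ι]
    [Field K] [CommRing A] [Algebra K A] {𝒜 : ι → Submodule K A} (P : ResidueResolution 𝒜)
    (j : ℕ) : ∀ (γ : ℕ → Type) [∀ i, Fintype (γ i)] (E : ∀ i, γ (i + 1) → γ i → A)
    (_ : ∀ i b b'', ∑ b', E (i + 1) b b' * E i b' b'' = 0)
    (N : Type u) [AddCommGroup N] [Module A N] (T : ∀ j, γ (j + 1) → P.β j → N)
    (_ : ∀ j b, P.diff N j (T (j + 1) b) = ∑ b', E (j + 1) b b' • T j b')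
    (z : γ (j + 1) → A) (_ : ∀ b, z b ∈ irrelevantIdeal 𝒜)
    (_ : ∀ b', ∑ b, z b * E j b b' = 0), ∃ w, P.diff N j w = ∑ b, z b • T j b := by
  induction j with
  | zero =>
    intro γ _ E hE N _ _ T hT z hz hc
    have : (∑ b, z b • T 0 b) default ∈ (irrelevantIdeal 𝒜 • ⊤ : Submodule A N) := by
      rw [Finset.sum_apply]
      exact Submodule.sum_mem _ fun b _ => Submodule.smul_mem_smul (hz b) trivial
    obtain ⟨w, hw⟩ := (P.mem_smul_top_iff _ _).1 this
    refine ⟨w, ?_⟩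
    rw [hw]
    ext1 c
    rw [Unique.eq_default c]
  | succ j ih =>
    intro γ _ E hE N _ _ T hT z hz hc
    -- Dimension shifting along the free cover of `N` on its underlying set. The kernel of `π`
    -- replaces `N` in the induction hypothesis, which is why `N` is quantified and shares the
    -- universe of `A`.
    let π : (N →₀ A) →ₗ[A] N := Finsupp.linearCombination A id
    let L : ∀ j, γ (j + 1) → P.β j → (N →₀ A) := fun j b c => Finsupp.single (T j b c) 1
    have hL : ∀ j b c, π (L j b c) = T j b c := fun j b c => by simp [π, L]
    -- The entrywise lift `L` of `T` need not be a chain map. Its defect `U` has values in the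
    -- kernel of `π` and is itself a chain map of degree one less, for the shifted complex with
    -- differentials of opposite sign.
    let U : ∀ k, γ (k + 2) → P.β k → (N →₀ A) := fun k b =>
      P.diff _ k (L (k + 1) b) - ∑ b', E (k + 1) b b' • L k b'
    have hU : ∀ k b c, U k b c ∈ LinearMap.ker π := by
      intro k b c
      have h1 := congrFun (P.diff_map π k (L (k + 1) b)) c
      simp only [hL] at h1
      have h2 := congrFun (hT k b) c
      simp only [U, LinearMap.mem_ker, Pi.sub_apply, map_sub, Finset.sum_apply, Pi.smul_apply,
        map_sum, map_smul, hL]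
      rw [← h1]
      simp only [Finset.sum_apply, Pi.smul_apply] at h2
      rw [h2, sub_self]
    have hUd : ∀ k b, P.diff _ k (U (k + 1) b) = ∑ b', (-E (k + 2) b b') • U k b' := by
      intro k b
      simp only [U, map_sub, diff_diff, map_sum, map_smul, zero_sub, smul_sub, neg_smul,
        Finset.sum_sub_distrib, Finset.sum_neg_distrib, Finset.smul_sum, smul_smul, neg_mul]
      rw [Finset.sum_comm (s := Finset.univ (α := γ (k + 1 + 1)))]
      have hE' : ∀ x, ∑ x_1, E (k + 2) b x_1 * E (k + 1) x_1 x = 0 := hE (k + 1) b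
      simp only [← Finset.sum_smul, Finset.sum_neg_distrib, hE', zero_smul,
        Finset.sum_const_zero, neg_zero, sub_zero]
    obtain ⟨w, hw⟩ := ih (fun k => γ (k + 1)) (fun k b b' => -E (k + 1) b b')
      (fun i b b'' => by simpa using hE (i + 1) b b'') (LinearMap.ker π)
      (fun k b c => ⟨U k b c, hU k b c⟩)
      (fun k b => by
        ext1 c
        apply Subtype.ext
        have h1 := congrFun (P.diff_map (N := LinearMap.ker π) (LinearMap.ker π).subtype k
          (fun c => ⟨U (k + 1) b c, hU (k + 1) b c⟩)) c
        simp only [Submodule.subtype_apply] at h1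
        rw [← h1]
        have h2 := congrFun (hUd k b) c
        simpa [Finset.sum_apply] using h2)
      z hz (fun b' => by simpa using hc b')
    have hw' : P.diff _ j (fun c => (w c : N →₀ A)) = ∑ b, z b • U j b := by
      have h1 := P.diff_map (LinearMap.ker π).subtype j w
      simp only [Submodule.subtype_apply] at h1
      rw [h1, hw]
      ext1 c
      simp [Finset.sum_apply]
    have hzU : ∑ b, z b • U j b = P.diff _ j (∑ b, z b • L (j + 1) b) := by
      simp only [U, smul_sub, Finset.sum_sub_distrib, map_sum, map_smul, Finset.smul_sum,
        smul_smul]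
      rw [Finset.sum_comm]
      simp only [← Finset.sum_smul, hc]
      simp
    -- As `z` is a cycle, `∑ z_b U_b` is the boundary of `∑ z_b L_b`, and by induction it is also
    -- the boundary of `w`. The difference is a cycle of positive index over a free module, hence a
    -- boundary; `π` kills `w` and sends `∑ z_b L_b` to `∑ z_b T_b`.
    obtain ⟨t, ht⟩ := P.exists_diff_eq_finsupp j
      (∑ b, z b • L (j + 1) b - fun c => (w c : N →₀ A)) (by rw [map_sub, hw', hzU, sub_self])
    refine ⟨fun c => π (t c), ?_⟩
    rw [diff_map, ht]
    ext1 c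
    simp only [Pi.sub_apply, map_sub, Finset.sum_apply, Pi.smul_apply, map_sum, map_smul, hL]
    rw [LinearMap.mem_ker.1 (w c).2, sub_zero]


/-! ### The bigrading of `R = K[x₁,…,xₙ,y₁,…,yₘ] / J` -/

section bigraded

variable {K : Type*} [Field K] {n m : ℕ}

/-- The total degree of a bidegree. -/
def totalDegree : ℤ × ℤ →+ ℤ := AddMonoidHom.fst ℤ ℤ + AddMonoidHom.snd ℤ ℤ

@[simp] theorem totalDegree_apply (p : ℤ × ℤ) : totalDegree p = p.1 + p.2 := rfl

/-- The two coordinates of a bidegree; `false` stands for the `x`-degree and `true` for the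
`y`-degree. -/
def coord (c : Bool) : ℤ × ℤ →+ ℤ := if c then AddMonoidHom.snd ℤ ℤ else AddMonoidHom.fst ℤ ℤ

/-- The two unit vectors. -/
def unitDegree (c : Bool) : ℤ × ℤ := if c then (0, 1) else (1, 0)

@[simp] theorem coord_false (p : ℤ × ℤ) : coord false p = p.1 := rfl
@[simp] theorem coord_true (p : ℤ × ℤ) : coord true p = p.2 := rfl
@[simp] theorem unitDegree_false : unitDegree false = (1, 0) := rfl
@[simp] theorem unitDegree_true : unitDegree true = (0, 1) := rfl

theorem coord_bidegree (c : Bool) (v : Fin n ⊕ Fin m) :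
    coord c (bidegree n m v) = if v.isRight = c then 1 else 0 := by
  cases c <;> cases v <;> simp [bidegree]

theorem bidegree_eq_unitDegree {c : Bool} {v : Fin n ⊕ Fin m} (h : v.isRight = c) :
    bidegree n m v = unitDegree c := by
  subst h
  cases v <;> simp [bidegree]

theorem coord_weight (c : Bool) (d : Fin n ⊕ Fin m →₀ ℕ) :
    coord c (Finsupp.weight (bidegree n m) d) =
      ∑ v : Fin n ⊕ Fin m, if v.isRight = c then (d v : ℤ) else 0 := by
  rw [Finsupp.weight_apply, Finsupp.sum_fintype _ _ (by simp), map_sum]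
  refine Finset.sum_congr rfl fun v _ => ?_
  rw [map_nsmul, coord_bidegree]
  split_ifs <;> simp

theorem coord_weight_nonneg (c : Bool) (d : Fin n ⊕ Fin m →₀ ℕ) :
    0 ≤ coord c (Finsupp.weight (bidegree n m) d) := by
  rw [coord_weight]
  exact Finset.sum_nonneg fun v _ => by split_ifs <;> simp

theorem exists_of_coord_weight_pos {c : Bool} {d : Fin n ⊕ Fin m →₀ ℕ}
    (h : 1 ≤ coord c (Finsupp.weight (bidegree n m) d)) : ∃ v, v.isRight = c ∧ d v ≠ 0 := by
  by_contra! hd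
  rw [coord_weight, Finset.sum_eq_zero] at h
  · omega
  · intro v _
    split_ifs with hv
    · simp [hd v hv]
    · rfl

theorem eq_zero_of_coord_weight {c : Bool} {d : Fin n ⊕ Fin m →₀ ℕ}
    (h : coord c (Finsupp.weight (bidegree n m) d) ≤ 0) (v : Fin n ⊕ Fin m) (hv : v.isRight = c) :
    d v = 0 := by
  rw [coord_weight] at h
  have h0 : ∑ v : Fin n ⊕ Fin m, (if v.isRight = c then (d v : ℤ) else 0) = 0 :=
    le_antisymm h (Finset.sum_nonneg fun v _ => by split_ifs <;> simp)
  rw [Finset.sum_eq_zero_iff_of_nonneg (fun v _ => by split_ifs <;> simp)] at h0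
  simpa [hv] using h0 v (Finset.mem_univ v)

variable (J : Ideal (MvPolynomial (Fin n ⊕ Fin m) K))

theorem mk_monomial_mem (d : Fin n ⊕ Fin m →₀ ℕ) (a : K) :
    Ideal.Quotient.mk J (MvPolynomial.monomial d a) ∈
      bicomponent J (Finsupp.weight (bidegree n m) d) :=
  ⟨_, MvPolynomial.isWeightedHomogeneous_monomial _ _ _ rfl, rfl⟩

/-- To prove an additive property of the elements of `R_p`, it suffices to prove it for the classes
of the monomials of degree `p`. -/
theorem bicomponent_induction {p : ℤ × ℤ} {motive : MvPolynomial (Fin n ⊕ Fin m) K ⧸ J → Prop}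
    (monomial : ∀ d a, Finsupp.weight (bidegree n m) d = p →
      motive (Ideal.Quotient.mk J (MvPolynomial.monomial d a)))
    (zero : motive 0) (add : ∀ x y, motive x → motive y → motive (x + y)) :
    ∀ x ∈ bicomponent J p, motive x := by
  rintro _ ⟨f, hf, rfl⟩
  change motive (Ideal.Quotient.mk J f)
  rw [f.as_sum, map_sum]
  exact Finset.sum_induction _ motive add zero fun d hd =>
    monomial d _ (hf (MvPolynomial.mem_support_iff.1 hd))

variable {J} in
/-- The projections of `R` onto its bihomogeneous components. -/
def bicomponentProj (hJ : IsBihomogeneous J) : GradedProj (bicomponent J) where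
  π p := QuotientAddGroup.lift (Submodule.toAddSubgroup J)
    ((Ideal.Quotient.mk J).toAddMonoidHom.comp
      (MvPolynomial.weightedHomogeneousComponent (bidegree n m) p).toAddMonoidHom)
    (fun f hf => Ideal.Quotient.eq_zero_iff_mem.2 (hJ f hf p))
  mem p x := by
    obtain ⟨f, rfl⟩ := Ideal.Quotient.mk_surjective x
    exact ⟨_, MvPolynomial.weightedHomogeneousComponent_mem _ f p, rfl⟩
  same p x hx := by
    obtain ⟨f, hf, rfl⟩ := hx
    exact congrArg (Ideal.Quotient.mk J)
      (MvPolynomial.IsWeightedHomogeneous.weightedHomogeneousComponent_same hf)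
  ne p q hpq x hx := by
    obtain ⟨f, hf, rfl⟩ := hx
    exact (congrArg (Ideal.Quotient.mk J)
      (MvPolynomial.IsWeightedHomogeneous.weightedHomogeneousComponent_ne q hf hpq.symm)).trans
        (map_zero _)
  total := by
    rw [eq_top_iff]
    rintro x -
    obtain ⟨f, rfl⟩ := Ideal.Quotient.mk_surjective x
    rw [f.as_sum, map_sum]
    exact Submodule.sum_mem _ fun d _ => Submodule.mem_iSup_of_mem _ (mk_monomial_mem J d _)

theorem nonneg_of_bicomponent {p : ℤ × ℤ} {x : MvPolynomial (Fin n ⊕ Fin m) K ⧸ J}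
    (hx : x ∈ bicomponent J p) (h : x ≠ 0) : 0 ≤ p := by
  by_contra hp
  refine h (bicomponent_induction J (motive := fun x => x = 0) (fun d a hd => ?_) rfl
    (by rintro x y rfl rfl; simp) x hx)
  refine absurd ?_ hp
  rw [← hd]
  exact ⟨coord_weight_nonneg false d, coord_weight_nonneg true d⟩

theorem bicomponent_eq_bot {p : ℤ × ℤ} (hp : ¬ 0 ≤ p) : bicomponent J p = ⊥ := by
  rw [eq_bot_iff]
  intro x hx
  by_contra h
  exact hp (nonneg_of_bicomponent J hx h)

theorem exists_algebraMap_of_bicomponent_zero {x : MvPolynomial (Fin n ⊕ Fin m) K ⧸ J}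
    (hx : x ∈ bicomponent J 0) : ∃ a : K, algebraMap K _ a = x := by
  refine bicomponent_induction J (motive := fun x => ∃ a : K, algebraMap K _ a = x)
    (fun d a hd => ⟨a, ?_⟩) ⟨0, map_zero _⟩ ?_ x hx
  · have : d = 0 := by
      ext v
      refine eq_zero_of_coord_weight (c := v.isRight) ?_ v rfl
      rw [hd, map_zero]
    rw [this]
    rfl
  · rintro _ _ ⟨a, rfl⟩ ⟨b, rfl⟩
    exact ⟨a + b, map_add _ _ _⟩

variable {J} in
/-- The bigrading of `R`. -/
def bicomponentGrading (hJ : IsBihomogeneous J) : PosGrading (bicomponent J) totalDegree where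
  toGradedProj := bicomponentProj hJ
  one_mem := one_mem_bicomponent J
  mul_mem _ _ _ ha _ hb := mul_mem_bicomponent J ha hb
  pos p a ha ha0 hp := by
    have h := nonneg_of_bicomponent J ha ha0
    have h1 : 0 ≤ p.1 := h.1
    have h2 : 0 ≤ p.2 := h.2
    rw [totalDegree_apply]
    by_contra hle
    exact hp (Prod.ext (show p.1 = 0 by omega) (show p.2 = 0 by omega))
  unit a ha ha0 := by
    obtain ⟨c, rfl⟩ := exists_algebraMap_of_bicomponent_zero J ha
    have hc : c ≠ 0 := by
      rintro rfl
      exact ha0 (map_zero _)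
    exact (IsUnit.mk0 c hc).map _

/-- The ideal generated by the `x_i` (if `c = false`) or the `y_j` (if `c = true`). -/
def sideIdeal (c : Bool) : Ideal (MvPolynomial (Fin n ⊕ Fin m) K ⧸ J) :=
  Ideal.span {x | ∃ v : Fin n ⊕ Fin m, v.isRight = c ∧ x = Ideal.Quotient.mk J (MvPolynomial.X v)}

theorem sideIdeal_false : sideIdeal J false = idealX J := by
  rw [sideIdeal, idealX]
  congr 1
  ext x
  constructor
  · rintro ⟨v, hv, rfl⟩
    cases v with
    | inl i => exact ⟨i, rfl⟩
    | inr j => simp at hv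
  · rintro ⟨i, rfl⟩
    exact ⟨Sum.inl i, rfl, rfl⟩

theorem sideIdeal_true : sideIdeal J true = idealY J := by
  rw [sideIdeal, idealY]
  congr 1
  ext x
  constructor
  · rintro ⟨v, hv, rfl⟩
    cases v with
    | inl i => simp at hv
    | inr j => exact ⟨j, rfl⟩
  · rintro ⟨i, rfl⟩
    exact ⟨Sum.inr i, rfl, rfl⟩

theorem mk_X_mem (v : Fin n ⊕ Fin m) :
    Ideal.Quotient.mk J (MvPolynomial.X v) ∈ bicomponent J (bidegree n m v) :=
  ⟨_, MvPolynomial.isWeightedHomogeneous_X _ _ _, rfl⟩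

/-- Elements of positive `x`-degree (or `y`-degree) are sums of multiples of variables. -/
theorem mem_span_of_coord_pos {c : Bool} {p : ℤ × ℤ} (hp : 1 ≤ coord c p)
    {x : MvPolynomial (Fin n ⊕ Fin m) K ⧸ J} (hx : x ∈ bicomponent J p) :
    x ∈ Submodule.span K {x | ∃ v : Fin n ⊕ Fin m, v.isRight = c ∧
      ∃ y ∈ bicomponent J (p - unitDegree c), x = Ideal.Quotient.mk J (MvPolynomial.X v) * y} := by
  refine bicomponent_induction J (motive := fun x => x ∈ Submodule.span K _) (fun d a hd => ?_)
    (zero_mem _) (fun _ _ => add_mem) x hx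
  rw [← hd] at hp
  obtain ⟨v, hv, hdv⟩ := exists_of_coord_weight_pos hp
  have hle : Finsupp.single v 1 ≤ d := by
    rw [Finsupp.single_le_iff]
    omega
  refine Submodule.subset_span ⟨v, hv, Ideal.Quotient.mk J
    (MvPolynomial.monomial (d - Finsupp.single v 1) a), ?_, ?_⟩
  · convert mk_monomial_mem J (d - Finsupp.single v 1) a using 2
    rw [← hd, sub_eq_iff_eq_add, ← bidegree_eq_unitDegree hv]
    conv_lhs => rw [← tsub_add_cancel_of_le hle]
    rw [map_add, Finsupp.weight_single, one_smul]
  · rw [← map_mul, MvPolynomial.X, MvPolynomial.monomial_mul, one_mul,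
      add_tsub_cancel_of_le hle]

theorem mem_sideIdeal_of_coord_pos {c : Bool} {p : ℤ × ℤ} (hp : 1 ≤ coord c p)
    {x : MvPolynomial (Fin n ⊕ Fin m) K ⧸ J} (hx : x ∈ bicomponent J p) : x ∈ sideIdeal J c := by
  have h := mem_span_of_coord_pos J hp hx
  refine (Submodule.span_le (p := (sideIdeal J c).restrictScalars K)).2 ?_ h
  rintro _ ⟨v, hv, y, -, rfl⟩
  exact Ideal.mul_mem_right _ _ (Ideal.subset_span ⟨v, hv, rfl⟩)

theorem bicomponent_le_mul_unitDegree {c : Bool} {p : ℤ × ℤ} (hp : 1 ≤ coord c p) :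
    bicomponent J p ≤ bicomponent J (unitDegree c) * bicomponent J (p - unitDegree c) := by
  intro x hx
  refine Submodule.span_le.2 ?_ (mem_span_of_coord_pos J hp hx)
  rintro _ ⟨v, hv, y, hy, rfl⟩
  refine Submodule.mul_mem_mul ?_ hy
  rw [← bidegree_eq_unitDegree hv]
  exact mk_X_mem J v

/-- `R` is standard graded. -/
theorem bicomponent_add_le {u w : ℤ × ℤ} (hu : 0 ≤ u) (hw : 0 ≤ w) :
    bicomponent J (u + w) ≤ bicomponent J u * bicomponent J w := by
  -- The first factor is built up one variable at a time: an element of degree `u + unitDegree c +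
  -- w` is a sum of multiples of variables of type `c`, and these are absorbed into the factor of
  -- degree `u`.
  have step : ∀ c u, 0 ≤ u → bicomponent J (u + w) ≤ bicomponent J u * bicomponent J w →
      bicomponent J (u + unitDegree c + w) ≤
        bicomponent J (u + unitDegree c) * bicomponent J w := by
    intro c u hu h
    refine (bicomponent_le_mul_unitDegree J (c := c) ?_).trans ?_
    · have h1 : (0 : ℤ) ≤ u.1 := hu.1
      have h2 : (0 : ℤ) ≤ u.2 := hu.2
      have h3 : (0 : ℤ) ≤ w.1 := hw.1
      have h4 : (0 : ℤ) ≤ w.2 := hw.2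
      cases c <;> simp <;> omega
    · rw [show u + unitDegree c + w - unitDegree c = u + w by abel]
      refine Submodule.mul_le.2 fun a ha b hb => ?_
      refine Submodule.mul_induction_on (h hb) (fun y hy z hz => ?_) (fun y z hy hz => ?_)
      · rw [← mul_assoc]
        refine Submodule.mul_mem_mul ?_ hz
        rw [add_comm u]
        exact mul_mem_bicomponent J ha hy
      · rw [mul_add]
        exact add_mem hy hz
  have base : bicomponent J (0 + w) ≤ bicomponent J 0 * bicomponent J w := by
    intro x hx
    rw [zero_add] at hx
    rw [← one_mul x]
    exact Submodule.mul_mem_mul (one_mem_bicomponent J) hx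
  obtain ⟨u₁, u₂⟩ := u
  lift u₁ to ℕ using hu.1
  lift u₂ to ℕ using hu.2
  clear hu
  induction u₁ with
  | zero =>
    induction u₂ with
    | zero => exact base
    | succ k ih =>
      have := step true _ ⟨by simp, by simp⟩ ih
      simpa using this
  | succ k ih =>
    have := step false _ ⟨by simp, by simp⟩ ih
    simpa using this

/-! ### The retraction that sends one set of variables to zero -/

/-- The endomorphism of the polynomial ring that sends one set of variables to zero. -/
def killVars (K : Type*) [Field K] (n m : ℕ) (c : Bool) :
    MvPolynomial (Fin n ⊕ Fin m) K →ₐ[K] MvPolynomial (Fin n ⊕ Fin m) K :=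
  MvPolynomial.aeval fun v => if v.isRight = c then 0 else MvPolynomial.X v

theorem killVars_monomial_of_pos {c : Bool} {d : Fin n ⊕ Fin m →₀ ℕ} (a : K)
    (h : 1 ≤ coord c (Finsupp.weight (bidegree n m) d)) :
    killVars K n m c (MvPolynomial.monomial d a) = 0 := by
  obtain ⟨v, hv, hd⟩ := exists_of_coord_weight_pos h
  rw [killVars, MvPolynomial.aeval_monomial, Finsupp.prod,
    Finset.prod_eq_zero (Finsupp.mem_support_iff.2 hd), mul_zero]
  rw [if_pos hv, zero_pow hd]

theorem killVars_monomial_of_nonpos {c : Bool} {d : Fin n ⊕ Fin m →₀ ℕ} (a : K)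
    (h : coord c (Finsupp.weight (bidegree n m) d) ≤ 0) :
    killVars K n m c (MvPolynomial.monomial d a) = MvPolynomial.monomial d a := by
  rw [killVars, MvPolynomial.aeval_monomial, MvPolynomial.monomial_eq]
  congr 1
  refine Finsupp.prod_congr fun v hv => ?_
  rw [if_neg]
  intro hc
  exact Finsupp.mem_support_iff.1 hv (eq_zero_of_coord_weight h v hc)

variable {J}

/-- Killing the variables of type `c` fixes the bihomogeneous components free of them and sends the
others to zero, so it preserves every bihomogeneous ideal. -/
theorem killVars_mem (hJ : IsBihomogeneous J) (c : Bool) :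
    J ≤ J.comap (killVars K n m c : MvPolynomial (Fin n ⊕ Fin m) K →+* _) := by
  intro f hf
  rw [Ideal.mem_comap]
  change killVars K n m c f ∈ J
  rw [← MvPolynomial.sum_weightedHomogeneousComponent (bidegree n m) f,
    finsum_eq_sum _ (MvPolynomial.weightedHomogeneousComponent_finsupp f), map_sum]
  refine Ideal.sum_mem _ fun p _ => ?_
  have hp := hJ f hf p
  have hom := MvPolynomial.weightedHomogeneousComponent_isWeightedHomogeneous
    (w := bidegree n m) p f
  set g := MvPolynomial.weightedHomogeneousComponent (bidegree n m) p f
  have hg : killVars K n m c g =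
      ∑ d ∈ g.support, killVars K n m c (MvPolynomial.monomial d (g.coeff d)) := by
    conv_lhs => rw [g.as_sum, map_sum]
  rcases le_or_gt 1 (coord c p) with h | h
  · rw [hg, Finset.sum_eq_zero]
    · exact zero_mem _
    · intro d hd
      refine killVars_monomial_of_pos _ ?_
      rw [hom (MvPolynomial.mem_support_iff.1 hd)]
      exact h
  · have : killVars K n m c g = g := by
      rw [hg]
      conv_rhs => rw [g.as_sum]
      refine Finset.sum_congr rfl fun d hd => killVars_monomial_of_nonpos _ ?_
      rw [hom (MvPolynomial.mem_support_iff.1 hd)]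
      omega
    rw [this]
    exact hp

/-- The endomorphism of `R` that sends one set of variables to zero. -/
def killVarsQuot (hJ : IsBihomogeneous J) (c : Bool) :
    (MvPolynomial (Fin n ⊕ Fin m) K ⧸ J) →+* (MvPolynomial (Fin n ⊕ Fin m) K ⧸ J) :=
  Ideal.quotientMap J (killVars K n m c : MvPolynomial (Fin n ⊕ Fin m) K →+* _)
    (killVars_mem hJ c)

theorem killVarsQuot_eq_self (hJ : IsBihomogeneous J) {c : Bool} {p : ℤ × ℤ} (hp : coord c p ≤ 0)
    {x : MvPolynomial (Fin n ⊕ Fin m) K ⧸ J} (hx : x ∈ bicomponent J p) :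
    killVarsQuot hJ c x = x := by
  refine bicomponent_induction J (motive := fun x => killVarsQuot hJ c x = x) (fun d a hd => ?_)
    (map_zero _) (fun x y h h' => by rw [map_add, h, h']) x hx
  rw [killVarsQuot, Ideal.quotientMap_mk]
  exact congrArg _ (killVars_monomial_of_nonpos a (by rwa [hd]))

theorem killVarsQuot_eq_zero (hJ : IsBihomogeneous J) {c : Bool}
    {x : MvPolynomial (Fin n ⊕ Fin m) K ⧸ J} (hx : x ∈ sideIdeal J c) :
    killVarsQuot hJ c x = 0 := by
  have : sideIdeal J c ≤ RingHom.ker (killVarsQuot hJ c) := by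
    rw [sideIdeal, Ideal.span_le]
    rintro _ ⟨v, hv, rfl⟩
    change killVarsQuot hJ c _ = 0
    rw [killVarsQuot, Ideal.quotientMap_mk]
    simp [killVars, hv]
  exact this hx

theorem killVarsQuot_sub_mem (hJ : IsBihomogeneous J) (c : Bool)
    (x : MvPolynomial (Fin n ⊕ Fin m) K ⧸ J) : killVarsQuot hJ c x - x ∈ sideIdeal J c := by
  induction x using (bicomponentProj hJ).induction with
  | mem p x hx =>
    rcases le_or_gt 1 (coord c p) with h | h
    · have := mem_sideIdeal_of_coord_pos J h hx
      rw [killVarsQuot_eq_zero hJ this]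
      simpa using this
    · rw [killVarsQuot_eq_self hJ (by omega) hx, sub_self]
      exact zero_mem _
  | zero => simp
  | add x y hx hy =>
    rw [map_add, add_sub_add_comm]
    exact add_mem hx hy

theorem killVarsQuot_mem_irrelevantIdeal (hJ : IsBihomogeneous J) (c : Bool)
    {x : MvPolynomial (Fin n ⊕ Fin m) K ⧸ J} (hx : x ∈ irrelevantIdeal (bicomponent J)) :
    killVarsQuot hJ c x ∈ irrelevantIdeal (bicomponent J) := by
  have : irrelevantIdeal (bicomponent J) ≤
      (irrelevantIdeal (bicomponent J)).comap (killVarsQuot hJ c) := by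
    conv_lhs => rw [irrelevantIdeal]
    rw [Ideal.span_le]
    rintro x ⟨p, hp, hx⟩
    change killVarsQuot hJ c x ∈ irrelevantIdeal (bicomponent J)
    rcases le_or_gt 1 (coord c p) with h | h
    · rw [killVarsQuot_eq_zero hJ (mem_sideIdeal_of_coord_pos J h hx)]
      exact zero_mem _
    · rw [killVarsQuot_eq_self hJ (by omega) hx]
      exact Ideal.subset_span ⟨p, hp, hx⟩
  exact this hx

/-- The retraction fixes `x` because of its degree and kills it because of the ideal. -/
theorem eq_zero_of_mem_sideIdeal (hJ : IsBihomogeneous J) {c : Bool} {p : ℤ × ℤ}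
    (hp : coord c p ≤ 0) {x : MvPolynomial (Fin n ⊕ Fin m) K ⧸ J} (hx : x ∈ bicomponent J p)
    (h : x ∈ sideIdeal J c) : x = 0 := by
  rw [← killVarsQuot_eq_self hJ hp hx, killVarsQuot_eq_zero hJ h]

theorem proj_mem_sideIdeal (hJ : IsBihomogeneous J) (c : Bool) (p : ℤ × ℤ)
    (x : MvPolynomial (Fin n ⊕ Fin m) K ⧸ J) (hx : x ∈ sideIdeal J c) :
    (bicomponentProj hJ).π p x ∈ sideIdeal J c := by
  refine proj_mem_span (bicomponentProj hJ) (bicomponentProj hJ)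
    (bicomponentGrading hJ).gradedAction ?_ p x hx
  rintro _ ⟨v, -, rfl⟩
  exact ⟨_, mk_X_mem J v⟩

/-! ### Finiteness of the modules along a subgroup -/

theorem proj_eq_zero_of_mem_sumAlong (hJ : IsBihomogeneous J) {D : AddSubgroup (ℤ × ℤ)}
    {v p : ℤ × ℤ} {x : MvPolynomial (Fin n ⊕ Fin m) K ⧸ J} (hx : x ∈ sumAlong J D v)
    (hp : p - v ∉ D) : (bicomponentProj hJ).π p x = 0 := by
  have : sumAlong J D v ≤ ⨆ q : D, bicomponent J (q + v) :=
    iSup₂_le fun q hq => le_iSup (fun q : D => bicomponent J (q + v)) ⟨q, hq⟩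
  refine Submodule.iSup_induction _ (motive := fun x => (bicomponentProj hJ).π p x = 0) (this hx)
    (fun q x hx => (bicomponentProj hJ).ne _ _ ?_ x hx) (map_zero _)
    (fun x y h h' => by rw [map_add, h, h', add_zero])
  rintro rfl
  exact hp (by simp)

/-- Hilbert's argument: a submodule `N` is recovered from the ideal of `R` that it generates by
restricting to the degrees in `v + D`. Hence `N ↦ ext N` is strictly monotone into the ideals of the
noetherian ring `R`. -/
theorem isNoetherian_moduleAlong (hJ : IsBihomogeneous J) (D : AddSubgroup (ℤ × ℤ))
    (v : ℤ × ℤ) : IsNoetherian (subalgebraAlong J D) (moduleAlong J D v) := by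
  let ext : Submodule (subalgebraAlong J D) (moduleAlong J D v) →
      Ideal (MvPolynomial (Fin n ⊕ Fin m) K ⧸ J) :=
    fun N => Ideal.span ((fun x : moduleAlong J D v => (x : MvPolynomial _ K ⧸ J)) '' N)
  have hproj : ∀ q p, ∀ a ∈ bicomponent J q, ∀ x,
      (bicomponentProj hJ).π p (a * x) = a * (bicomponentProj hJ).π (p - q) x := by
    intro q p a ha x
    have := (bicomponentProj hJ).proj_map (bicomponentProj hJ) (AddMonoidHom.mulLeft a)
      (fun p => q + p) (fun _ _ h => by simpa using h)
      (fun p x hx => mul_mem_bicomponent J ha hx) (p - q) x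
    simpa using this
  have key : ∀ N, ∀ x : moduleAlong J D v, (x : MvPolynomial _ K ⧸ J) ∈ ext N → x ∈ N := by
    intro N x hx
    -- In an `R`-combination of elements of `N`, only the parts of the coefficients with degrees in
    -- `D` contribute to the degrees in `v + D`.
    have claim : ∀ y ∈ ext N, ∃ x' ∈ N, ∀ p, p - v ∈ D → (bicomponentProj hJ).π p y =
        (bicomponentProj hJ).π p (x' : MvPolynomial _ K ⧸ J) := by
      intro y hy
      induction hy using Submodule.closure_induction with
      | zero => exact ⟨0, zero_mem _, fun p _ => rfl⟩
      | add y z _ _ hy hz =>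
        obtain ⟨y', hy', h⟩ := hy
        obtain ⟨z', hz', h'⟩ := hz
        refine ⟨y' + z', add_mem hy' hz', fun p hp => ?_⟩
        rw [map_add, h p hp, h' p hp, Submodule.coe_add, map_add]
      | smul_mem r y hy =>
        obtain ⟨y', hy', rfl⟩ := hy
        induction r using (bicomponentProj hJ).induction with
        | mem q r hr =>
          by_cases hq : q ∈ D
          · have hr' : r ∈ subalgebraAlong J D := by
              change r ∈ sumAlong J D 0
              refine Submodule.mem_iSup_of_mem q (Submodule.mem_iSup_of_mem hq ?_)
              rwa [add_zero]
            exact ⟨_, N.smul_mem ⟨r, hr'⟩ hy', fun p _ => rfl⟩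
          · refine ⟨0, zero_mem _, fun p hp => ?_⟩
            rw [smul_eq_mul, hproj q p r hr, proj_eq_zero_of_mem_sumAlong hJ y'.2]
            · simp
            · intro h
              refine hq ?_
              have := D.sub_mem hp h
              rwa [show p - v - (p - q - v) = q by abel] at this
        | zero => exact ⟨0, zero_mem _, fun p _ => by simp⟩
        | add r s hr hs =>
          obtain ⟨y', hy', h⟩ := hr
          obtain ⟨z', hz', h'⟩ := hs
          refine ⟨y' + z', add_mem hy' hz', fun p hp => ?_⟩
          rw [add_smul, map_add, h p hp, h' p hp, Submodule.coe_add, map_add]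
    obtain ⟨x', hx', h⟩ := claim x hx
    have : x = x' := by
      apply Subtype.ext
      rw [← sub_eq_zero]
      refine (bicomponentProj hJ).eq_zero fun p => ?_
      rw [map_sub]
      by_cases hp : p - v ∈ D
      · rw [h p hp, sub_self]
      · rw [proj_eq_zero_of_mem_sumAlong hJ x.2 hp, proj_eq_zero_of_mem_sumAlong hJ x'.2 hp,
          sub_self]
    rw [this]
    exact hx'
  have hmono : StrictMono ext := by
    refine Monotone.strictMono_of_injective
      (fun N N' h => Ideal.span_mono (Set.image_mono h)) fun N N' h => ?_
    ext x
    exact ⟨fun hx => key N' x (h ▸ Ideal.subset_span ⟨x, hx, rfl⟩),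
      fun hx => key N x (h ▸ Ideal.subset_span ⟨x, hx, rfl⟩)⟩
  rw [isNoetherian_iff']
  exact hmono.wellFoundedGT

theorem isNoetherianRing_subalgebraAlong (hJ : IsBihomogeneous J) (D : AddSubgroup (ℤ × ℤ)) :
    IsNoetherianRing (subalgebraAlong J D) := by
  have := isNoetherian_moduleAlong hJ D 0
  let e : subalgebraAlong J D →ₗ[subalgebraAlong J D] moduleAlong J D 0 :=
    { toFun := fun x => ⟨x, x.2⟩
      map_add' := fun _ _ => rfl
      map_smul' := fun _ _ => rfl }
  exact isNoetherian_of_injective e fun x y h => Subtype.ext (congrArg Subtype.val h)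

end bigraded


/-! ### Strands along a lattice of degrees -/

section strands

variable {ι' : Type*} [AddCommGroup ι']

/-- The combinatorial properties of the degrees `φ s`, `s ∈ I`, that are needed for the
linearity of the strands. The set `S` consists of the shifts `v` for which the strand along `v`
starts in degree `0`. -/
structure DegreeLattice (I : AddSubgroup ι') (φ : ι' →+ ℤ × ℤ) (deg : ι' →+ ℤ)
    (S : Set (ℤ × ℤ)) : Prop where
  inj : ∀ s ∈ I, φ s = 0 → s = 0
  pos : ∀ s ∈ I, 0 ≤ φ s → s ≠ 0 → 0 < deg s
  nonneg : ∀ v ∈ S, 0 ≤ v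
  -- A strand with shift in `S` lives in the indices `s` with `0 ≤ φ s`.
  mono : ∀ v ∈ S, ∀ s ∈ I, 0 ≤ φ s + v → 0 ≤ φ s
  -- Every strand that meets the nonnegative quadrant is a shift of one with shift in `S`.
  exists_mem : ∀ u, (∃ s ∈ I, 0 ≤ φ s + u) → ∃ s ∈ I, φ s + u ∈ S
  sub_mem : ∀ c, ∀ v ∈ S, 1 ≤ coord c v → v - unitDegree c ∈ S
  -- A generator of degree `p` of the resolution of `𝔫_c` contributes the strand along `v - p`,
  -- which starts in degree `deg s`. A generator of `F_i` has total degree `i + 1`, so the `- 1`,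
  -- gained because `v` and `p` are both positive in direction `c`, yields the start `≤ i` needed
  -- for linearity.
  bound : ∀ c, ∀ v ∈ S, ∀ p, 0 ≤ p → 1 ≤ coord c v → 1 ≤ coord c p →
    ∀ s ∈ I, φ s + (v - p) ∈ S → deg s ≤ totalDegree p - 1
  -- This splits an element of a strand into products of a ring element of nonzero degree and an
  -- element of the same strand, giving generation in degree `0`.
  gen : ∀ v ∈ S, ∀ s ∈ I, 0 ≤ φ s + v → s ≠ 0 → ∃ t ∈ I, t ≠ 0 ∧ 0 ≤ φ t ∧ 0 ≤ φ (s - t) + v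

open Classical in
/-- The strand `s ↦ 𝒩 (φ s + v)`, `s ∈ I`, of a bigraded module. -/
def strandFamily {K N : Type*} [Field K] [AddCommGroup N] [Module K N] (I : AddSubgroup ι')
    (φ : ι' →+ ℤ × ℤ) (𝒩 : ℤ × ℤ → Submodule K N) (v : ℤ × ℤ) (s : ι') : Submodule K N :=
  if s ∈ I then 𝒩 (φ s + v) else ⊥

theorem mem_strandFamily {K N : Type*} [Field K] [AddCommGroup N] [Module K N]
    {I : AddSubgroup ι'} {φ : ι' →+ ℤ × ℤ} {𝒩 : ℤ × ℤ → Submodule K N} {v : ℤ × ℤ} {s : ι'}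
    {x : N} : x ∈ strandFamily I φ 𝒩 v s ↔ (s ∈ I ∧ x ∈ 𝒩 (φ s + v)) ∨ x = 0 := by
  rw [strandFamily]
  split_ifs with h
  · constructor
    · exact fun hx => Or.inl ⟨h, hx⟩
    · rintro (⟨-, hx⟩ | rfl)
      · exact hx
      · exact zero_mem _
  · simp [h]

variable {I : AddSubgroup ι'} {φ : ι' →+ ℤ × ℤ} {deg : ι' →+ ℤ} {S : Set (ℤ × ℤ)}
  {K A R : Type*} [Field K] [CommRing A] [Algebra K A] [CommRing R] [Algebra K R] [Algebra A R]
  {𝒜 : ι' → Submodule K A} {ℛ : ℤ × ℤ → Submodule K R}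

/-- This is how a strand is normalised: once `φ s₀ + u` lies in `S`, the strand along `u` is one
that starts in degree `0`, shifted by `s₀`. -/
theorem strandFamily_shift {N : Type*} [AddCommGroup N] [Module K N]
    (𝒩 : ℤ × ℤ → Submodule K N) (u : ℤ × ℤ) {s₀ : ι'} (hs₀ : s₀ ∈ I) (q : ι') :
    strandFamily I φ 𝒩 u q = strandFamily I φ 𝒩 (φ s₀ + u) (q - s₀) := by
  classical
  have h1 : q - s₀ ∈ I ↔ q ∈ I :=
    ⟨fun h => by simpa using I.add_mem h hs₀, fun h => I.sub_mem h hs₀⟩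
  have h2 : φ (q - s₀) + (φ s₀ + u) = φ q + u := by
    rw [map_sub]
    abel
  rw [strandFamily, strandFamily, h2]
  exact if_congr h1.symm rfl rfl

theorem strandFamily_freeFamily {r : ℕ} (d : Fin r → ℤ × ℤ) (v : ℤ × ℤ) :
    strandFamily I φ (freeFamily ℛ d) v =
      fun s => Submodule.pi Set.univ fun b => strandFamily I φ ℛ (v - d b) s := by
  funext s
  ext f
  simp only [Submodule.mem_pi, Set.mem_univ, forall_const]
  by_cases h : s ∈ I
  · simp only [strandFamily, if_pos h, mem_freeFamily, add_sub_assoc]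
  · simp only [strandFamily, if_neg h, Submodule.mem_bot]
    exact funext_iff

theorem gradedAction_strandFamily {N : Type*} [AddCommGroup N] [Module K N] [Module R N]
    [Module A N] [IsScalarTower A R N] {𝒩 : ℤ × ℤ → Submodule K N}
    (hA : ∀ s, ∀ a ∈ 𝒜 s, algebraMap A R a ∈ strandFamily I φ ℛ 0 s)
    (hN : GradedAction ℛ 𝒩) (v : ℤ × ℤ) : GradedAction 𝒜 (strandFamily I φ 𝒩 v) := by
  intro s t a ha x hx
  rw [← algebraMap_smul R a x]
  rw [mem_strandFamily] at hx ⊢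
  rcases mem_strandFamily.1 (hA s a ha) with ⟨hs, ha'⟩ | ha'
  · rcases hx with ⟨ht, hx⟩ | rfl
    · left
      refine ⟨I.add_mem hs ht, ?_⟩
      have := hN _ _ _ ha' _ hx
      rwa [add_zero, ← add_assoc, ← map_add] at this
    · right
      exact smul_zero _
  · right
    rw [ha', zero_smul]

theorem strandFamily_le {N M : Type*} [AddCommGroup N] [Module K N] [AddCommGroup M] [Module K M]
    {𝒩 : ℤ × ℤ → Submodule K N} {ℳ : ℤ × ℤ → Submodule K M} (f : N →+ M)
    (hf : ∀ p, ∀ x ∈ 𝒩 p, f x ∈ ℳ p) (v : ℤ × ℤ) (s : ι') (x : N)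
    (hx : x ∈ strandFamily I φ 𝒩 v s) : f x ∈ strandFamily I φ ℳ v s := by
  rw [mem_strandFamily] at hx ⊢
  rcases hx with ⟨hs, hx⟩ | rfl
  · exact Or.inl ⟨hs, hf _ _ hx⟩
  · exact Or.inr (map_zero f)

/-- Strands of modules that are linear over `R` are linear over the ring `A` of degrees in the
lattice. -/
theorem torVanishes_strandFamily (L : DegreeLattice I φ deg S) (G : PosGrading ℛ totalDegree)
    (hbot : ∀ p, ¬ 0 ≤ p → ℛ p = ⊥) (P : ResidueResolution 𝒜)
    (hA : ∀ s, ∀ a ∈ 𝒜 s, algebraMap A R a ∈ strandFamily I φ ℛ 0 s)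
    (𝔫 : Bool → Ideal R) (h𝔫 : ∀ c p, 1 ≤ coord c p → ∀ x ∈ ℛ p, x ∈ 𝔫 c)
    (hproj : ∀ c p, ∀ x ∈ 𝔫 c, G.π p x ∈ 𝔫 c)
    (F : ∀ c, GradedFreeResolution ℛ (subFamily ℛ (𝔫 c)))
    (hF : ∀ c i b, totalDegree ((F c).deg i b) = i + 1 ∧ 1 ≤ coord c ((F c).deg i b) ∧
      0 ≤ (F c).deg i b)
    (hzero : ∀ v ∈ S, ∀ s, 0 < deg s → P.TorVanishes (strandFamily I φ ℛ v) 0 s)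
    (hfree : ∀ i s, P.TorVanishes (strandFamily I φ ℛ 0) (i + 1) s) (h : ℕ) :
    ∀ v ∈ S, ∀ s, h < deg s → P.TorVanishes (strandFamily I φ ℛ v) h s := by
  -- Outer induction on the homological index, for all `v ∈ S` at once. Inside it, for a fixed
  -- index, the total degree of `v` is bounded by `n` and induction on `n` is used.
  induction h using Nat.strong_induction_on with
  | _ h ihh =>
  cases h with
  | zero => exact fun v hv s hs => hzero v hv s (by simpa using hs)
  | succ k =>
  intro v hv
  obtain ⟨n, hn⟩ : ∃ n : ℕ, totalDegree v < n :=
    ⟨(totalDegree v + 1).toNat, by have := Int.self_le_toNat (totalDegree v + 1); omega⟩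
  induction n generalizing v with
  | zero =>
    have h1 : (0 : ℤ) ≤ v.1 := (L.nonneg v hv).1
    have h2 : (0 : ℤ) ≤ v.2 := (L.nonneg v hv).2
    simp at hn
    omega
  | succ n ihn =>
    intro s hs
    by_cases hv0 : v = 0
    · rw [hv0]
      exact hfree k s
    obtain ⟨c, hc⟩ : ∃ c, 1 ≤ coord c v := by
      have h1 : (0 : ℤ) ≤ v.1 := (L.nonneg v hv).1
      have h2 : (0 : ℤ) ≤ v.2 := (L.nonneg v hv).2
      by_contra! hc
      have h3 := hc false
      have h4 := hc true
      simp only [coord_false, coord_true] at h3 h4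
      exact hv0 (Prod.ext (show v.1 = 0 by omega) (show v.2 = 0 by omega))
    have hfam : ∀ (i j : ℕ) s, (j ≤ k ∨ i = 0 ∧ j = k + 1) → (i : ℤ) + j < deg s →
        P.TorVanishes (strandFamily I φ (freeFamily ℛ ((F c).deg i)) v) j s := by
      intro i j s hij hs
      rw [strandFamily_freeFamily]
      refine ResidueResolution.TorVanishes.pi P fun b => ?_
      obtain ⟨hb1, hb2, hb3⟩ := hF c i b
      rcases hij with hj | ⟨rfl, rfl⟩
      -- The summand for the basis element `b` is zero, or it is a strand with shift in `S`
      -- displaced by `s₀`, where `deg s₀ ≤ i` by `L.bound`. The outer induction hypothesis applies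
      -- as `j ≤ k`.
      · by_cases hex : ∃ s ∈ I, 0 ≤ φ s + (v - (F c).deg i b)
        · obtain ⟨s₀, hs₀, hmem⟩ := L.exists_mem _ hex
          have hbd := L.bound c v hv _ hb3 hc hb2 s₀ hs₀ hmem
          refine ResidueResolution.TorVanishes.shift P
            (strandFamily_shift ℛ (v - (F c).deg i b) hs₀) (ihh j (by omega) _ hmem _ ?_)
          rw [map_sub]
          omega
        · refine ResidueResolution.TorVanishes.of_eq_bot P fun q => ?_
          rw [strandFamily]
          split_ifs with hq
          · exact hbot _ fun h => hex ⟨q, hq, h⟩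
          · rfl
      -- A nonnegative bidegree of total degree `1` with positive `c`-coordinate is the unit vector.
      -- Hence `F_0^v` consists of strands along `v - unitDegree c`, for which the index `k + 1` is
      -- covered by the inner induction.
      · have hbc : (F c).deg 0 b = unitDegree c := by
          have h1 : (0 : ℤ) ≤ ((F c).deg 0 b).1 := hb3.1
          have h2 : (0 : ℤ) ≤ ((F c).deg 0 b).2 := hb3.2
          cases c <;> simp at hb1 hb2 ⊢ <;> ext <;> simp <;> omega
        rw [hbc]
        refine ihn _ (L.sub_mem c v hv hc) ?_ s (by push_cast at hs ⊢; omega)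
        rw [map_sub]
        have : totalDegree (unitDegree c) = 1 := by cases c <;> simp
        push_cast at hn
        omega
    let g : ∀ i, GradedProj (freeFamily ℛ ((F c).deg i)) := fun i => G.toGradedProj.pi _
    -- `Tor_j` of the strand of the `i`-th syzygy module `range (d i)` is controlled by
    -- `Tor_j(F_{i+1}^v)` and by `Tor_{j-1}` of the next syzygy module, so induction on `j` with `i`
    -- free closes up.
    have hsyz : ∀ j ≤ k, ∀ (i : ℕ) s, (i : ℤ) + 1 + j < deg s → P.TorVanishes (fun q =>
        strandFamily I φ (freeFamily ℛ ((F c).deg i)) v q ⊓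
          (LinearMap.range ((F c).d i)).restrictScalars K) j s := by
      intro j
      induction j using Nat.strong_induction_on with
      | _ j ihj =>
      intro hj i s hs
      refine ResidueResolution.TorVanishes.quotient' P
        (gradedAction_strandFamily hA (G.gradedAction_pi ((F c).deg (i + 1))) v)
        (((F c).d i).restrictScalars A) ?_ (hfam (i + 1) j s (Or.inl (by omega))
          (by push_cast at hs ⊢; omega)) ?_
        (𝒵 := fun q => strandFamily I φ (freeFamily ℛ ((F c).deg (i + 1))) v q ⊓
          (LinearMap.range ((F c).d (i + 1))).restrictScalars K) ?_ ?_
      · rintro q y ⟨hy, hy'⟩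
        rcases mem_strandFamily.1 hy with ⟨hq, hy⟩ | rfl
        · obtain ⟨x, hx, hxy⟩ := exists_lift_of_range G (g i) (G.gradedAction_pi _) ((F c).d i)
            ((F c).d_single_mem i) _ y hy hy'
          exact ⟨x, mem_strandFamily.2 (Or.inl ⟨hq, hx⟩), hxy⟩
        · exact ⟨0, zero_mem _, map_zero _⟩
      · exact fun q x hx => ⟨strandFamily_le ((F c).d i).toAddMonoidHom
          (map_mem_of_freeFamily (G.gradedAction_pi _) ((F c).d i) ((F c).d_single_mem i))
          v q x hx, ⟨x, rfl⟩⟩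
      · exact fun q x => and_congr_right fun _ => ((F c).exact_succ i x).symm
      · intro k' hk'
        exact ihj k' (by omega) (by omega) (i + 1) s (by push_cast [hk'] at hs ⊢; omega)
    have hact : GradedAction ℛ (subFamily ℛ (𝔫 c)) := G.gradedAction.sub _
    -- The augmentation maps `F_0^v` onto the whole strand `R^v`, with kernel the strand of `range
    -- (d 0)`.
    refine ResidueResolution.TorVanishes.quotient' P
      (gradedAction_strandFamily hA (G.gradedAction_pi ((F c).deg 0)) v)
      (((𝔫 c).subtype ∘ₗ (F c).aug).restrictScalars A) ?_
      (hfam 0 (k + 1) s (Or.inr ⟨rfl, rfl⟩) (by push_cast at hs ⊢; omega)) ?_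
      (𝒵 := fun q => strandFamily I φ (freeFamily ℛ ((F c).deg 0)) v q ⊓
            (LinearMap.range ((F c).d 0)).restrictScalars K) ?_ ?_
    · intro q y hy
      by_cases hy0 : y = 0
      · exact ⟨0, zero_mem _, by rw [hy0, map_zero]⟩
      rcases mem_strandFamily.1 hy with ⟨hq, hy⟩ | hy
      · have hpos : 0 ≤ φ q + v := by
          by_contra hneg
          rw [hbot _ hneg] at hy
          exact hy0 hy
        -- Surjectivity is where `v ∈ S` matters: a nonzero component has `0 ≤ φ q`, hence its
        -- degree `φ q + v` has positive `c`-coordinate and it lies in `𝔫_c`.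
        have hq0 := L.mono v hv q hq hpos
        have hcq : 1 ≤ coord c (φ q + v) := by
          have h1 : (0 : ℤ) ≤ (φ q).1 := hq0.1
          have h2 : (0 : ℤ) ≤ (φ q).2 := hq0.2
          rw [map_add]
          cases c <;> simp at hc ⊢ <;> omega
        obtain ⟨x, hx, hxy⟩ := exists_lift_of_range G
          (G.toGradedProj.sub (𝔫 c) (hproj c)) hact (F c).aug (F c).aug_homogeneous
          (φ q + v) ⟨y, h𝔫 c _ hcq y hy⟩ hy ((F c).aug_surjective _)
        exact ⟨x, mem_strandFamily.2 (Or.inl ⟨hq, hx⟩), congrArg Subtype.val hxy⟩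
      · exact absurd hy hy0
    · exact strandFamily_le ((𝔫 c).subtype ∘ₗ (F c).aug).toAddMonoidHom
        (map_mem_of_freeFamily hact (F c).aug (F c).aug_homogeneous) v
    · intro q x
      refine and_congr_right fun _ => ?_
      change x ∈ LinearMap.range ((F c).d 0) ↔ ((F c).aug x : R) = 0
      rw [ZeroMemClass.coe_eq_zero]
      exact ((F c).exact_zero x).symm
    · intro k' hk'
      obtain rfl : k = k' := by omega
      exact hsyz k le_rfl 0 s (by push_cast at hs ⊢; omega)

end strands


/-! ### Gradings along a lattice -/

section

variable {ι ι' K N N' : Type*} [AddCommGroup ι'] [Field K] [AddCommGroup N] [Module K N]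
  [AddCommGroup N'] [Module K N']

/-- The projections of a submodule that consists of some of the components of `N`. -/
def GradedProj.restrict {𝒩 : ℤ × ℤ → Submodule K N} (g : GradedProj 𝒩) {I : AddSubgroup ι'}
    {φ : ι' →+ ℤ × ℤ} (hφ : ∀ s ∈ I, φ s = 0 → s = 0) (v : ℤ × ℤ) (j : N' →+ N)
    (hj : Function.Injective j) {𝒩' : ι' → Submodule K N'}
    (h𝒩' : ∀ s x, x ∈ 𝒩' s ↔ j x ∈ strandFamily I φ 𝒩 v s)
    (hrange : ∀ s ∈ I, ∀ y ∈ 𝒩 (φ s + v), ∃ x, j x = y)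
    (hproj : ∀ x p, (∀ s ∈ I, φ s + v ≠ p) → g.π p (j x) = 0) : GradedProj 𝒩' := by
  classical
  have key : ∀ s x, ∃ y, j y = if s ∈ I then g.π (φ s + v) (j x) else 0 := by
    intro s x
    split_ifs with h
    · exact hrange s h _ (g.mem _ _)
    · exact ⟨0, map_zero j⟩
  choose f hf using key
  refine
    { π := fun s => AddMonoidHom.mk' (f s) fun x y => hj ?_
      mem := fun s x => ?_
      same := fun s x hx => hj ?_
      ne := fun s t hst x hx => hj ?_
      total := ?_ }
  · rw [map_add, hf, hf, hf, map_add]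
    split_ifs
    · rw [map_add]
    · rw [add_zero]
  · rw [h𝒩', AddMonoidHom.mk'_apply, hf, strandFamily]
    split_ifs
    · exact g.mem _ _
    · exact zero_mem _
  · rw [AddMonoidHom.mk'_apply, hf]
    rcases mem_strandFamily.1 ((h𝒩' s x).1 hx) with ⟨hs, hx⟩ | hx
    · rw [if_pos hs, g.same _ _ hx]
    · simp [hx]
  · rw [AddMonoidHom.mk'_apply, hf, map_zero]
    rcases mem_strandFamily.1 ((h𝒩' s x).1 hx) with ⟨hs, hx⟩ | hx
    · split_ifs with ht
      · refine g.ne _ _ (fun h => hst ?_) _ hx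
        rw [← sub_eq_zero]
        exact hφ _ (I.sub_mem hs ht) (by rw [map_sub, add_right_cancel h, sub_self])
      · rfl
    · simp [hx]
  · rw [eq_top_iff]
    rintro x -
    have key : ∀ p, ∃ y ∈ ⨆ s, 𝒩' s, j y = g.π p (j x) := by
      intro p
      by_cases hp : ∃ s ∈ I, φ s + v = p
      · obtain ⟨s, hs, rfl⟩ := hp
        obtain ⟨y, hy⟩ := hrange s hs _ (g.mem _ (j x))
        refine ⟨y, Submodule.mem_iSup_of_mem s ((h𝒩' s y).2 ?_), hy⟩
        rw [hy]
        exact mem_strandFamily.2 (Or.inl ⟨hs, g.mem _ _⟩)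
      · push Not at hp
        exact ⟨0, zero_mem _, by rw [map_zero, hproj x p hp]⟩
    choose y hy hjy using key
    obtain ⟨t, ht⟩ := g.sum_proj (j x)
    have : x = ∑ p ∈ t, y p := hj (by rw [map_sum, ← ht]; simp [hjy])
    rw [this]
    exact Submodule.sum_mem _ fun p _ => hy p

end

section

variable {ι K A : Type*} [AddCommGroup ι] [Field K] [CommRing A] [Algebra K A]

/-- Nakayama's lemma for the lowest component of a graded module. -/
theorem ResidueResolution.TorVanishes.eq_bot {𝒜 : ι → Submodule K A} {deg : ι →+ ℤ}
    (G : PosGrading 𝒜 deg) (P : ResidueResolution 𝒜) {N : Type*} [AddCommGroup N] [Module A N]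
    [Module K N] {𝒩 : ι → Submodule K N} {p : ι} (h : P.TorVanishes 𝒩 0 p)
    (hlow : ∀ q, deg q < deg p → 𝒩 q = ⊥) : 𝒩 p = ⊥ := by
  rw [eq_bot_iff]
  intro x hx
  obtain ⟨w, hw, hwx⟩ := h (fun _ => x) (fun b => by
    rw [P.deg_zero, sub_zero]
    exact hx) trivial
  have := congrFun hwx default
  rw [ResidueResolution.diff_apply] at this
  rw [Submodule.mem_bot, ← this]
  refine Finset.sum_eq_zero fun b _ => ?_
  by_cases hD : P.D 0 b default = 0
  · rw [hD, zero_smul]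
  · have hD' := P.homogeneous 0 b default
    rw [P.deg_zero, sub_zero] at hD'
    have hm : P.D 0 b default ∈ irrelevantIdeal 𝒜 := by
      rw [← P.span_range]
      exact Ideal.subset_span ⟨b, rfl⟩
    have hne : P.deg 1 b ≠ 0 := fun h0 => hD (G.eq_zero_of_mem hm (h0 ▸ hD'))
    have hpos := G.pos _ _ hD' hD hne
    have hwb := hw b
    rw [hlow _ (by rw [map_sub]; omega), Submodule.mem_bot] at hwb
    rw [hwb, smul_zero]

end

/-! ### The algebra and the modules along a lattice of degrees -/

section

variable {K : Type*} [Field K] {n m : ℕ} (J : Ideal (MvPolynomial (Fin n ⊕ Fin m) K))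
  {ι' : Type*} [AddCommGroup ι']

instance moduleAlong.instModule (D : AddSubgroup (ℤ × ℤ)) (v : ℤ × ℤ) :
    Module (subalgebraAlong J D) (moduleAlong J D v) :=
  (moduleAlong J D v).module

open Classical in
/-- The grading of `⨁_{p ∈ D} R_p` by the elements of `I`. -/
def algebraFamily (D : AddSubgroup (ℤ × ℤ)) (I : AddSubgroup ι') (φ : ι' →+ ℤ × ℤ) (s : ι') :
    Submodule K (subalgebraAlong J D) :=
  if s ∈ I then subalgebraComponent J D (φ s) else ⊥

open Classical in
/-- The grading of `⨁_{p ∈ D} R_{p + v}` by the elements of `I`. -/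
def moduleFamily (D : AddSubgroup (ℤ × ℤ)) (v : ℤ × ℤ) (I : AddSubgroup ι') (φ : ι' →+ ℤ × ℤ)
    (s : ι') : Submodule K (moduleAlong J D v) :=
  if s ∈ I then moduleComponent J D v (φ s) else ⊥

variable {J} {D : AddSubgroup (ℤ × ℤ)} {I : AddSubgroup ι'} {φ : ι' →+ ℤ × ℤ} {deg : ι' →+ ℤ}
  {S : Set (ℤ × ℤ)}

theorem mem_algebraFamily (s : ι') (x : subalgebraAlong J D) :
    x ∈ algebraFamily J D I φ s ↔
      (x : MvPolynomial _ K ⧸ J) ∈ strandFamily I φ (bicomponent J) 0 s := by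
  rw [algebraFamily, strandFamily, add_zero]
  split_ifs
  · rfl
  · simp

theorem mem_moduleFamily (v : ℤ × ℤ) (s : ι') (x : moduleAlong J D v) :
    x ∈ moduleFamily J D v I φ s ↔
      (x : MvPolynomial _ K ⧸ J) ∈ strandFamily I φ (bicomponent J) v s := by
  rw [moduleFamily, strandFamily]
  split_ifs
  · rfl
  · simp

theorem mem_sumAlong_of_mem (hD : ∀ p, p ∈ D ↔ ∃ s ∈ I, φ s = p) (v : ℤ × ℤ) {s : ι'}
    (hs : s ∈ I) {x : MvPolynomial (Fin n ⊕ Fin m) K ⧸ J} (hx : x ∈ bicomponent J (φ s + v)) :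
    x ∈ sumAlong J D v :=
  Submodule.mem_iSup_of_mem (φ s) (Submodule.mem_iSup_of_mem ((hD _).2 ⟨s, hs, rfl⟩) hx)

theorem proj_eq_zero_of_forall_ne (hJ : IsBihomogeneous J) (hD : ∀ p, p ∈ D ↔ ∃ s ∈ I, φ s = p)
    {v p : ℤ × ℤ} {x : MvPolynomial (Fin n ⊕ Fin m) K ⧸ J} (hx : x ∈ sumAlong J D v)
    (h : ∀ s ∈ I, φ s + v ≠ p) : (bicomponentProj hJ).π p x = 0 := by
  refine proj_eq_zero_of_mem_sumAlong hJ hx fun hp => ?_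
  obtain ⟨s, hs, hsp⟩ := (hD _).1 hp
  exact h s hs (by rw [hsp, sub_add_cancel])

/-- The grading of `⨁_{p ∈ D} R_p`. -/
def algebraFamilyGrading (hJ : IsBihomogeneous J) (L : DegreeLattice I φ deg S)
    (hD : ∀ p, p ∈ D ↔ ∃ s ∈ I, φ s = p) : PosGrading (algebraFamily J D I φ) deg where
  toGradedProj := (bicomponentProj hJ).restrict L.inj 0
    ((subalgebraAlong J D).val : subalgebraAlong J D →+ MvPolynomial (Fin n ⊕ Fin m) K ⧸ J)
    Subtype.val_injective mem_algebraFamily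
    (fun _ hs y hy => ⟨⟨y, mem_sumAlong_of_mem hD 0 hs hy⟩, rfl⟩)
    (fun x _ h => proj_eq_zero_of_forall_ne hJ hD
      (show (x : MvPolynomial (Fin n ⊕ Fin m) K ⧸ J) ∈ sumAlong J D 0 from x.2) h)
  one_mem := by
    rw [mem_algebraFamily, mem_strandFamily]
    refine Or.inl ⟨I.zero_mem, ?_⟩
    rw [map_zero, zero_add]
    exact one_mem_bicomponent J
  mul_mem p q a ha b hb := by
    rw [mem_algebraFamily, mem_strandFamily] at *
    rcases ha with ⟨hp, ha⟩ | ha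
    · rcases hb with ⟨hq, hb⟩ | hb
      · left
        refine ⟨I.add_mem hp hq, ?_⟩
        have := mul_mem_bicomponent J ha hb
        rw [add_zero, add_zero] at this
        rwa [add_zero, map_add]
      · right
        rw [MulMemClass.coe_mul, hb, mul_zero]
    · right
      rw [MulMemClass.coe_mul, ha, zero_mul]
  pos p a ha ha0 hp := by
    have ha0' : (a : MvPolynomial (Fin n ⊕ Fin m) K ⧸ J) ≠ 0 := fun h => ha0 (Subtype.ext h)
    rcases mem_strandFamily.1 ((mem_algebraFamily _ _).1 ha) with ⟨hp', ha⟩ | ha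
    · rw [add_zero] at ha
      exact L.pos p hp' (nonneg_of_bicomponent J ha ha0') hp
    · exact absurd ha ha0'
  unit a ha ha0 := by
    have ha0' : (a : MvPolynomial (Fin n ⊕ Fin m) K ⧸ J) ≠ 0 := fun h => ha0 (Subtype.ext h)
    rcases mem_strandFamily.1 ((mem_algebraFamily _ _).1 ha) with ⟨-, ha⟩ | ha
    · rw [map_zero, add_zero] at ha
      obtain ⟨c, hc⟩ := exists_algebraMap_of_bicomponent_zero J ha
      have hc0 : c ≠ 0 := by
        rintro rfl
        rw [map_zero] at hc
        exact ha0' hc.symm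
      have : a = algebraMap K _ c := Subtype.ext hc.symm
      rw [this]
      exact (IsUnit.mk0 c hc0).map _
    · exact absurd ha ha0'

/-- The projections of `⨁_{p ∈ D} R_{p + v}`. -/
def moduleFamilyProj (hJ : IsBihomogeneous J) (L : DegreeLattice I φ deg S)
    (hD : ∀ p, p ∈ D ↔ ∃ s ∈ I, φ s = p) (v : ℤ × ℤ) : GradedProj (moduleFamily J D v I φ) :=
  (bicomponentProj hJ).restrict L.inj v (moduleAlong J D v).subtype.toAddMonoidHom
    Subtype.val_injective (mem_moduleFamily v)
    (fun _ hs y hy => ⟨⟨y, mem_sumAlong_of_mem hD v hs hy⟩, rfl⟩)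
    (fun x _ h => proj_eq_zero_of_forall_ne hJ hD
      (show (x : MvPolynomial (Fin n ⊕ Fin m) K ⧸ J) ∈ sumAlong J D v from x.2) h)

/-- A resolution of the ideal `𝔫_x` (if `c = false`) or `𝔫_y` (if `c = true`) that is linear. -/
def HasSideResolution (J : Ideal (MvPolynomial (Fin n ⊕ Fin m) K)) (c : Bool) : Prop :=
  ∃ F : GradedFreeResolution (bicomponent J) (subFamily (bicomponent J) (sideIdeal J c)),
    ∀ i b, totalDegree (F.deg i b) = i + 1 ∧ 1 ≤ coord c (F.deg i b) ∧ 0 ≤ F.deg i b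

theorem algebraMap_mem_strandFamily (s : ι') (a : subalgebraAlong J D)
    (ha : a ∈ algebraFamily J D I φ s) :
    algebraMap (subalgebraAlong J D) (MvPolynomial (Fin n ⊕ Fin m) K ⧸ J) a ∈
      strandFamily I φ (bicomponent J) 0 s :=
  (mem_algebraFamily s a).1 ha

/-- The strands of `R` that start in degree zero are generated in degree zero. -/
theorem torVanishes_strandFamily_zero (hJ : IsBihomogeneous J) (L : DegreeLattice I φ deg S)
    (hD : ∀ p, p ∈ D ↔ ∃ s ∈ I, φ s = p) (P : ResidueResolution (algebraFamily J D I φ)) :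
    ∀ v ∈ S, ∀ s, 0 < deg s → P.TorVanishes (strandFamily I φ (bicomponent J) v) 0 s := by
  have G := algebraFamilyGrading hJ L hD
  intro v hv s hs z hz _
  have hzd : z default ∈ strandFamily I φ (bicomponent J) v s := by
    have := hz default
    rwa [P.deg_zero, sub_zero] at this
  suffices h : ∃ w : P.β 1 → _, P.Hom (strandFamily I φ (bicomponent J) v) 1 s w ∧
      P.diff _ 0 w default = z default by
    obtain ⟨w, hw, hwz⟩ := h
    refine ⟨w, hw, ?_⟩
    ext1 b
    rw [Unique.eq_default b, hwz]
  by_cases hz0 : z default = 0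
  · exact ⟨0, fun b => zero_mem _, by rw [map_zero, hz0]; rfl⟩
  rcases mem_strandFamily.1 hzd with ⟨hsI, hzs⟩ | h
  · have hpos := nonneg_of_bicomponent J hzs hz0
    have hs0 : s ≠ 0 := by
      rintro rfl
      simp at hs
    -- As `R` is standard graded, the element is a sum of products `a * y` with `a ∈ A` of degree `t
    -- ≠ 0` and `y` in the strand. An expression of `a` through the generators of the irrelevant
    -- ideal, multiplied by `y`, gives one for `a * y`.
    obtain ⟨t, ht, ht0, hφt, hst⟩ := L.gen v hv s hsI hpos hs0
    have hx : z default ∈ bicomponent J (φ t) * bicomponent J (φ (s - t) + v) := by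
      refine bicomponent_add_le J hφt hst ?_
      rwa [map_sub, ← add_assoc, add_sub_cancel]
    refine Submodule.mul_induction_on hx (fun a ha y hy => ?_) ?_
    · have haA : a ∈ subalgebraAlong J D :=
        mem_sumAlong_of_mem hD 0 ht (by rwa [add_zero])
      obtain ⟨w, hw, hwa⟩ := P.torVanishes_ring_zero G ht0 (fun _ => ⟨a, haA⟩) (fun b => by
        rw [P.deg_zero, sub_zero, mem_algebraFamily, mem_strandFamily, add_zero]
        exact Or.inl ⟨ht, ha⟩) trivial
      refine ⟨fun b => (w b : MvPolynomial _ K ⧸ J) * y, fun b => ?_, ?_⟩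
      · have hwb := hw b
        rw [mem_algebraFamily, mem_strandFamily, add_zero] at hwb
        rw [mem_strandFamily]
        rcases hwb with ⟨htb, hwb⟩ | hwb
        · left
          constructor
          · have := I.add_mem htb (I.sub_mem hsI ht)
            rwa [show t - P.deg (0 + 1) b + (s - t) = s - P.deg (0 + 1) b by abel] at this
          · have := mul_mem_bicomponent J hwb hy
            rwa [← add_assoc, ← map_add,
              show t - P.deg (0 + 1) b + (s - t) = s - P.deg (0 + 1) b by abel] at this
        · right
          change (w b : MvPolynomial _ K ⧸ J) * y = 0
          rw [hwb, zero_mul]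
      · have h1 := congrArg Subtype.val (congrFun hwa default)
        rw [ResidueResolution.diff_apply] at h1 ⊢
        simp only [AddSubmonoidClass.coe_finsetSum, smul_eq_mul, MulMemClass.coe_mul] at h1
        rw [← h1, Finset.sum_mul]
        refine Finset.sum_congr rfl fun b _ => ?_
        rw [mul_assoc]
        rfl
    · rintro x y ⟨w, hw, rfl⟩ ⟨w', hw', rfl⟩
      exact ⟨w + w', fun b => add_mem (hw b) (hw' b), by rw [map_add]; rfl⟩
  · exact absurd h hz0

/-- The strand along `0` is `A` itself, hence free. -/
theorem torVanishes_strandFamily_succ (hJ : IsBihomogeneous J) (L : DegreeLattice I φ deg S)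
    (hD : ∀ p, p ∈ D ↔ ∃ s ∈ I, φ s = p) (P : ResidueResolution (algebraFamily J D I φ)) :
    ∀ i s, P.TorVanishes (strandFamily I φ (bicomponent J) 0) (i + 1) s := by
  have G := algebraFamilyGrading hJ L hD
  intro i s
  refine ResidueResolution.TorVanishes.to_ambient P (𝒵 := algebraFamily J D I φ)
    (Algebra.linearMap (subalgebraAlong J D) (MvPolynomial (Fin n ⊕ Fin m) K ⧸ J))
    Subtype.val_injective algebraMap_mem_strandFamily ?_ (P.torVanishes_ring_succ G i s)
  intro q x hx
  rcases mem_strandFamily.1 hx with ⟨hq, hx'⟩ | rfl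
  · exact ⟨⟨x, mem_sumAlong_of_mem hD 0 hq hx'⟩, (mem_algebraFamily _ _).2 hx, rfl⟩
  · exact ⟨0, zero_mem _, map_zero _⟩

theorem moduleFamily_eq_bot (L : DegreeLattice I φ deg S) {v : ℤ × ℤ} {s₀ : ι'} (hs₀ : s₀ ∈ I)
    (hmem : φ s₀ + v ∈ S) (s : ι') (hs : deg s < deg s₀) : moduleFamily J D v I φ s = ⊥ := by
  rw [eq_bot_iff]
  intro x hx
  by_contra hx0
  have hx0' : (x : MvPolynomial (Fin n ⊕ Fin m) K ⧸ J) ≠ 0 := fun h => hx0 (Subtype.ext h)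
  rw [mem_moduleFamily, strandFamily_shift _ _ hs₀] at hx
  rcases mem_strandFamily.1 hx with ⟨hsI, hx⟩ | hx
  · have h1 := L.mono _ hmem _ hsI (nonneg_of_bicomponent J hx hx0')
    have h2 := L.pos _ hsI h1 (by
      intro h
      rw [sub_eq_zero] at h
      rw [h] at hs
      exact lt_irrefl _ hs)
    rw [map_sub] at h2
    omega
  · exact hx0' hx

theorem gradedAction_moduleFamily (v : ℤ × ℤ) :
    GradedAction (algebraFamily J D I φ) (moduleFamily J D v I φ) := by
  have hR : GradedAction (bicomponent J) (bicomponent J) :=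
    fun p q a ha x hx => mul_mem_bicomponent J ha hx
  have h := gradedAction_strandFamily (𝒜 := algebraFamily J D I φ) (𝒩 := bicomponent J)
    algebraMap_mem_strandFamily hR v
  intro p q a ha x hx
  exact (mem_moduleFamily v (p + q) _).2 (h p q a ha x ((mem_moduleFamily v q x).1 hx))

theorem torVanishes_moduleFamily (hD : ∀ p, p ∈ D ↔ ∃ s ∈ I, φ s = p)
    (P : ResidueResolution (algebraFamily J D I φ)) {v : ℤ × ℤ} {i : ℕ} {s s₀ : ι'} (hs₀ : s₀ ∈ I)
    (h : P.TorVanishes (strandFamily I φ (bicomponent J) (φ s₀ + v)) i (s - s₀)) :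
    P.TorVanishes (moduleFamily J D v I φ) i s := by
  refine ResidueResolution.TorVanishes.of_injective P
    (𝒩 := strandFamily I φ (bicomponent J) v)
    (moduleAlong J D v).subtype Subtype.val_injective
    (fun p z hz => (mem_moduleFamily v p z).1 hz) ?_
    (ResidueResolution.TorVanishes.shift P (strandFamily_shift (bicomponent J) v hs₀) h)
  intro q x hx
  rcases mem_strandFamily.1 hx with ⟨hq, hx'⟩ | rfl
  · exact ⟨⟨x, mem_sumAlong_of_mem hD v hq hx'⟩, (mem_moduleFamily _ _ _).2 hx, rfl⟩
  · exact ⟨0, zero_mem _, map_zero _⟩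

/-- If `𝔫_x` and `𝔫_y` have linear resolutions, so do the modules `⨁_{p ∈ D} R_{p + v}`. -/
theorem exists_linear_resolution_moduleFamily (hJ : IsBihomogeneous J) (hJ' : J ≠ ⊤)
    (hside : ∀ c, HasSideResolution J c) (L : DegreeLattice I φ deg S)
    (hD : ∀ p, p ∈ D ↔ ∃ s ∈ I, φ s = p) (v : ℤ × ℤ) (hv : 0 ≤ v) :
    ∃ (e : ℤ) (F : GradedFreeResolution (algebraFamily J D I φ) (moduleFamily J D v I φ)),
      (∀ i b, deg (F.deg i b) = i + e) ∧ ∀ s, deg s < e → moduleFamily J D v I φ s = ⊥ := by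
  have : Nontrivial (MvPolynomial (Fin n ⊕ Fin m) K ⧸ J) := Ideal.Quotient.nontrivial_iff.2 hJ'
  have : Nontrivial (subalgebraAlong J D) :=
    ⟨0, 1, fun h => zero_ne_one (congrArg Subtype.val h)⟩
  have : IsNoetherianRing (subalgebraAlong J D) := isNoetherianRing_subalgebraAlong hJ D
  have : IsNoetherian (subalgebraAlong J D) (moduleAlong J D v) := isNoetherian_moduleAlong hJ D v
  let G := algebraFamilyGrading hJ L hD
  obtain ⟨P⟩ := exists_residueResolution G
  -- The shift `s₀` moves `v` into `S`; its degree becomes the initial degree `e` of the linear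
  -- resolution.
  obtain ⟨s₀, hs₀, hmem⟩ := L.exists_mem v ⟨0, I.zero_mem, by simpa using hv⟩
  choose F hF using hside
  have htor := torVanishes_strandFamily L (bicomponentGrading hJ)
    (fun p hp => bicomponent_eq_bot J hp) P algebraMap_mem_strandFamily (sideIdeal J)
    (fun c p hp x hx => mem_sideIdeal_of_coord_pos J hp hx) (proj_mem_sideIdeal hJ) F hF
    (torVanishes_strandFamily_zero hJ L hD P) (torVanishes_strandFamily_succ hJ L hD P)
  obtain ⟨F', hF'⟩ := exists_linear_resolution G P (moduleFamilyProj hJ L hD v)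
    (gradedAction_moduleFamily v) (deg s₀) (moduleFamily_eq_bot L hs₀ hmem)
    (fun i s hs => torVanishes_moduleFamily hD P hs₀ (htor i _ hmem _ (by rw [map_sub]; omega)))
    Set.univ (fun _ _ => trivial) (fun _ _ _ _ => trivial)
  exact ⟨deg s₀, F', fun i b => (hF' i b).1, moduleFamily_eq_bot L hs₀ hmem⟩

end


/-! ### Diagonals and Veronese lattices -/

/-- The parametrisation `s ↦ (sa, sb)` of the diagonal. -/
def diagonalHom (a b : ℕ) : ℤ →+ ℤ × ℤ :=
  AddMonoidHom.mk' (fun s => (s * a, s * b)) fun s t => by ext <;> simp [add_mul]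

@[simp] theorem diagonalHom_apply (a b : ℕ) (s : ℤ) :
    diagonalHom a b s = (s * a, s * b) := rfl

theorem mem_diagonal_iff (a b : ℕ) (p : ℤ × ℤ) :
    p ∈ diagonal a b ↔ ∃ s ∈ (⊤ : AddSubgroup ℤ), diagonalHom a b s = p := by
  simp [diagonal, AddSubgroup.mem_zmultiples_iff]

theorem nonneg_of_mul_add {a s v : ℤ} (ha : 0 ≤ a) (h : 0 ≤ s * a + v) (hs : s < 0) : a ≤ v := by
  nlinarith

/-- The hypotheses force `1 ≤ a`, and then `s - 1 + w ≤ (s - 1) * a + w < 0`. This bounds the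
starting degree of a shifted strand. -/
theorem lt_of_mul_add_lt {a s w : ℤ} (ha : 0 ≤ a) (h : s * a + w < a) (h0 : 0 ≤ s * a + w)
    (hs : 1 ≤ s) : s + w ≤ 0 := by
  have ha' : 1 ≤ a := by
    by_contra
    have : a = 0 := by omega
    subst this
    omega
  nlinarith [mul_nonneg (sub_nonneg.2 hs) (sub_nonneg.2 ha')]

/-- A strand along the diagonal starts in degree `0` when `v` lies in the nonnegative quadrant but
one step back along `(a, b)` leaves it. -/
theorem diagonal_degreeLattice {a b : ℕ} (hab : (a, b) ≠ (0, 0)) :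
    DegreeLattice (⊤ : AddSubgroup ℤ) (diagonalHom a b) (AddMonoidHom.id ℤ)
      {v | 0 ≤ v ∧ ¬ 0 ≤ v - ((a : ℤ), (b : ℤ))} := by
  have ha : (0 : ℤ) ≤ a := by positivity
  have hb : (0 : ℤ) ≤ b := by positivity
  have hab' : (0 : ℤ) < a ∨ (0 : ℤ) < b := by
    by_contra! h
    exact hab (by ext <;> simp <;> omega)
  have mono : ∀ v ∈ {v : ℤ × ℤ | 0 ≤ v ∧ ¬ 0 ≤ v - ((a : ℤ), (b : ℤ))}, ∀ s : ℤ,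
      0 ≤ diagonalHom a b s + v → 0 ≤ s := by
    rintro ⟨v1, v2⟩ ⟨-, h⟩ s hs
    by_contra! hneg
    simp only [diagonalHom_apply, Prod.mk_add_mk, Prod.zero_eq_mk, Prod.mk_le_mk,
      Prod.mk_sub_mk] at hs h
    have h1 := nonneg_of_mul_add ha hs.1 hneg
    have h2 := nonneg_of_mul_add hb hs.2 hneg
    exact h ⟨by omega, by omega⟩
  refine
    { inj := fun s _ h => ?_
      pos := fun s _ h hs => ?_
      nonneg := fun v hv => hv.1
      mono := fun v hv s _ hs => ?_
      exists_mem := fun u hu => ?_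
      sub_mem := fun c v hv hc => ?_
      bound := fun c v hv p hp hcv hcp s _ hs => ?_
      gen := fun v hv s _ hs hs0 => ?_ }
  · simp only [diagonalHom_apply, Prod.mk_eq_zero, mul_eq_zero] at h
    omega
  · simp only [diagonalHom_apply, Prod.zero_eq_mk, Prod.mk_le_mk] at h
    rw [AddMonoidHom.id_apply]
    by_contra! hneg
    have hneg : s < 0 := by omega
    rcases hab' with h' | h'
    · nlinarith
    · nlinarith
  · have := mono v hv s hs
    simp only [diagonalHom_apply, Prod.zero_eq_mk, Prod.mk_le_mk]
    exact ⟨by positivity, by positivity⟩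
  · obtain ⟨s, -, hs⟩ := hu
    -- The least index at which the strand meets the quadrant. It exists because one of `a`, `b` is
    -- positive, so indices below `-(|u.1| + |u.2|)` leave the quadrant.
    obtain ⟨t, ht, hmin⟩ := Int.exists_least_of_bdd
      (P := fun s => 0 ≤ diagonalHom a b s + u) ⟨-(|u.1| + |u.2|), fun z hz => by
        obtain ⟨u1, u2⟩ := u
        simp only [diagonalHom_apply, Prod.mk_add_mk, Prod.zero_eq_mk, Prod.mk_le_mk] at hz
        by_contra! hlt
        have h1 := le_abs_self u1
        have h2 := le_abs_self u2
        have h3 := abs_nonneg u1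
        have h4 := abs_nonneg u2
        rcases hab' with h' | h' <;> nlinarith⟩ ⟨s, hs⟩
    refine ⟨t, trivial, ht, fun h => ?_⟩
    have := hmin (t - 1) (by
      convert h using 1
      ext <;> simp [sub_mul] <;> ring)
    omega
  · obtain ⟨v1, v2⟩ := v
    obtain ⟨h1, h2⟩ := hv
    simp only [Prod.mk_sub_mk, Prod.zero_eq_mk, Prod.mk_le_mk] at h1 h2
    cases c <;>
      simp only [coord_false, coord_true, unitDegree_false, unitDegree_true, Prod.mk_sub_mk,
        Set.mem_ofPred_eq, Prod.zero_eq_mk, Prod.mk_le_mk] at hc ⊢ <;> omega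
  · obtain ⟨v1, v2⟩ := v
    obtain ⟨p1, p2⟩ := p
    have hv1 := hv.1
    obtain ⟨h1, h2⟩ := hs
    simp only [diagonalHom_apply, Prod.mk_add_mk, Prod.mk_sub_mk, Prod.zero_eq_mk, Prod.mk_le_mk]
      at h1 h2 hv1 hp
    rw [AddMonoidHom.id_apply, totalDegree_apply]
    by_contra! hlt
    have hc : (1 ≤ v1 ∧ 1 ≤ p1) ∨ (1 ≤ v2 ∧ 1 ≤ p2) := by
      cases c <;> simp only [coord_false, coord_true] at hcv hcp <;> omega
    have hs1 : 1 ≤ s := by omega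
    -- The shifted vector fails to dominate `(a, b)` in some coordinate, and there `s` is at most
    -- the difference of the entries of `p` and `v`. The missing `1` comes from `v` if this is the
    -- coordinate `c`, and otherwise from the entry of `p` in the coordinate `c`.
    rcases lt_or_ge (s * a + (v1 - p1)) a with h | h
    · have := lt_of_mul_add_lt ha h h1.1 hs1
      omega
    · rcases lt_or_ge (s * b + (v2 - p2)) b with h' | h'
      · have := lt_of_mul_add_lt hb h' h1.2 hs1
        omega
      · exact h2 ⟨by omega, by omega⟩
  · have h := mono v hv s hs
    have hv1 := hv.1
    obtain ⟨v1, v2⟩ := v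
    simp only [Prod.zero_eq_mk, Prod.mk_le_mk] at hv1
    have h' : 0 ≤ s - 1 := by omega
    refine ⟨1, trivial, one_ne_zero, ?_, ?_⟩
    · simp only [diagonalHom_apply, one_mul, Prod.zero_eq_mk, Prod.mk_le_mk]
      exact ⟨ha, hb⟩
    · simp only [diagonalHom_apply, Prod.mk_add_mk, Prod.zero_eq_mk, Prod.mk_le_mk]
      exact ⟨add_nonneg (mul_nonneg h' ha) hv1.1, add_nonneg (mul_nonneg h' hb) hv1.2⟩

/-- The parametrisation `(s, t) ↦ (sa, tb)` of the Veronese lattice. -/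
def veroneseHom (a b : ℕ) : ℤ × ℤ →+ ℤ × ℤ :=
  AddMonoidHom.mk' (fun s => (s.1 * a, s.2 * b)) fun s t => by ext <;> simp [add_mul]

@[simp] theorem veroneseHom_apply (a b : ℕ) (s : ℤ × ℤ) :
    veroneseHom a b s = (s.1 * a, s.2 * b) := rfl

/-- The indices of the components of the Veronese subring. -/
def veroneseIndex (a b : ℕ) : AddSubgroup (ℤ × ℤ) where
  carrier := {s | (a = 0 → s.1 = 0) ∧ (b = 0 → s.2 = 0)}
  zero_mem' := by simp
  add_mem' := by
    rintro s t ⟨h1, h2⟩ ⟨h3, h4⟩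
    exact ⟨fun h => by simp [h1 h, h3 h], fun h => by simp [h2 h, h4 h]⟩
  neg_mem' := by
    rintro s ⟨h1, h2⟩
    exact ⟨fun h => by simp [h1 h], fun h => by simp [h2 h]⟩

theorem mem_veroneseLattice_iff (a b : ℕ) (p : ℤ × ℤ) :
    p ∈ veroneseLattice a b ↔ ∃ s ∈ veroneseIndex a b, veroneseHom a b s = p := by
  have key : ∀ (a : ℕ) (x : ℤ), x ∈ AddSubgroup.zmultiples (a : ℤ) ↔
      ∃ s : ℤ, (a = 0 → s = 0) ∧ s * a = x := by
    intro a x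
    rw [AddSubgroup.mem_zmultiples_iff]
    constructor
    · rintro ⟨s, rfl⟩
      by_cases ha : a = 0
      · exact ⟨0, fun _ => rfl, by simp [ha]⟩
      · exact ⟨s, fun h => absurd h ha, by simp⟩
    · rintro ⟨s, -, rfl⟩
      exact ⟨s, by simp⟩
  rw [veroneseLattice, AddSubgroup.mem_prod, key, key]
  constructor
  · rintro ⟨⟨s, hs, hs'⟩, t, ht, ht'⟩
    exact ⟨(s, t), ⟨hs, ht⟩, Prod.ext hs' ht'⟩
  · rintro ⟨s, ⟨h1, h2⟩, rfl⟩
    exact ⟨⟨s.1, h1, rfl⟩, s.2, h2, rfl⟩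

section

variable {a : ℕ} {s : ℤ}

theorem nonneg_of_mul_nonneg_of_index (hs : a = 0 → s = 0) {v : ℤ} (hv : a ≠ 0 → v < a)
    (h : 0 ≤ s * a + v) : 0 ≤ s := by
  by_cases ha : a = 0
  · rw [hs ha]
  · by_contra! hneg
    have := nonneg_of_mul_add (by positivity) h hneg
    have := hv ha
    omega

theorem exists_index_mul_add {u : ℤ} (h : ∃ s : ℤ, (a = 0 → s = 0) ∧ 0 ≤ s * a + u) :
    ∃ s : ℤ, (a = 0 → s = 0) ∧ 0 ≤ s * a + u ∧ (a ≠ 0 → s * a + u < a) := by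
  by_cases ha : a = 0
  · obtain ⟨s, hs, hs'⟩ := h
    exact ⟨s, hs, hs', fun h => absurd ha h⟩
  -- The index is chosen so that the shifted coordinate is the remainder of `u` modulo `a`.
  · have e : -(u / a) * a + u = u % a := by
      have := Int.emod_add_mul_ediv u a
      linarith
    refine ⟨-(u / a), fun h => absurd h ha, ?_, fun _ => ?_⟩
    · rw [e]
      exact Int.emod_nonneg _ (by omega)
    · rw [e]
      exact Int.emod_lt_of_pos _ (by omega)

/-- The coordinatewise form of `DegreeLattice.bound`. The improved inequality is used in one
coordinate only, and adding the two coordinates gives the total degree minus `1`. -/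
theorem index_le (hs : a = 0 → s = 0) {v p : ℤ} (hv : 0 ≤ v) (hp : 0 ≤ p)
    (h : 0 ≤ s * a + (v - p)) (h' : a ≠ 0 → s * a + (v - p) < a) :
    s ≤ p ∧ (1 ≤ v → 1 ≤ p → s ≤ p - 1) := by
  by_cases ha : a = 0
  · rw [hs ha]
    omega
  · by_cases h1 : 1 ≤ s
    · have := lt_of_mul_add_lt (by positivity) (h' ha) h h1
      omega
    · omega

end

/-- The two coordinates are independent: a strand starts in degree `0` when each coordinate of `v`
is a remainder modulo `a` or `b`. If `a` or `b` is zero, the index in that direction is fixed at `0`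
and the coordinate of `v` is any nonnegative integer. -/
theorem veronese_degreeLattice (a b : ℕ) :
    DegreeLattice (veroneseIndex a b) (veroneseHom a b) totalDegree
      {v | 0 ≤ v ∧ (a ≠ 0 → v.1 < a) ∧ (b ≠ 0 → v.2 < b)} := by
  have ha : (0 : ℤ) ≤ a := by positivity
  have hb : (0 : ℤ) ≤ b := by positivity
  refine
    { inj := fun s hs h => ?_
      pos := fun s hs h hs0 => ?_
      nonneg := fun v hv => hv.1
      mono := fun v hv s hs h => ?_
      exists_mem := fun u hu => ?_
      sub_mem := fun c v hv hc => ?_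
      bound := fun c v hv p hp hcv hcp s hs h => ?_
      gen := fun v hv s hs h hs0 => ?_ }
  · obtain ⟨h1, h2⟩ := hs
    simp only [veroneseHom_apply, Prod.mk_eq_zero, mul_eq_zero] at h
    ext
    · exact h.1.elim id fun h => h1 (by exact_mod_cast h)
    · exact h.2.elim id fun h => h2 (by exact_mod_cast h)
  · obtain ⟨s1, s2⟩ := s
    simp only [veroneseHom_apply, Prod.zero_eq_mk, Prod.mk_le_mk] at h
    have h1 := nonneg_of_mul_nonneg_of_index (v := 0) hs.1 (by omega) (by simpa using h.1)
    have h2 := nonneg_of_mul_nonneg_of_index (v := 0) hs.2 (by omega) (by simpa using h.2)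
    simp only [ne_eq, Prod.mk_eq_zero] at hs0
    simp only at h1 h2
    rw [totalDegree_apply]
    simp only
    omega
  · obtain ⟨v1, v2⟩ := v
    simp only [veroneseHom_apply, Prod.mk_add_mk, Prod.zero_eq_mk, Prod.mk_le_mk] at h ⊢
    have h1 := nonneg_of_mul_nonneg_of_index hs.1 hv.2.1 h.1
    have h2 := nonneg_of_mul_nonneg_of_index hs.2 hv.2.2 h.2
    exact ⟨by positivity, by positivity⟩
  · obtain ⟨s, hs, hs'⟩ := hu
    obtain ⟨u1, u2⟩ := u
    simp only [veroneseHom_apply, Prod.mk_add_mk, Prod.zero_eq_mk, Prod.mk_le_mk] at hs'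
    obtain ⟨t1, h1, h2, h3⟩ := exists_index_mul_add ⟨s.1, hs.1, hs'.1⟩
    obtain ⟨t2, h4, h5, h6⟩ := exists_index_mul_add ⟨s.2, hs.2, hs'.2⟩
    exact ⟨(t1, t2), ⟨h1, h4⟩, ⟨h2, h5⟩, h3, h6⟩
  · obtain ⟨v1, v2⟩ := v
    obtain ⟨h1, h2, h3⟩ := hv
    simp only [Prod.zero_eq_mk, Prod.mk_le_mk] at h1 h2 h3
    cases c <;>
      simp only [coord_false, coord_true, unitDegree_false, unitDegree_true, Prod.mk_sub_mk,
        Set.mem_ofPred_eq, Prod.zero_eq_mk, Prod.mk_le_mk] at hc ⊢ <;> omega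
  · obtain ⟨v1, v2⟩ := v
    obtain ⟨p1, p2⟩ := p
    have hv1 := hv.1
    obtain ⟨h1, h2, h3⟩ := h
    simp only [veroneseHom_apply, Prod.mk_add_mk, Prod.mk_sub_mk, Prod.zero_eq_mk, Prod.mk_le_mk]
      at h1 h2 h3 hv1 hp
    have h4 := index_le hs.1 hv1.1 hp.1 h1.1 h2
    have h5 := index_le hs.2 hv1.2 hp.2 h1.2 h3
    rw [totalDegree_apply, totalDegree_apply]
    cases c <;> simp only [coord_false, coord_true] at hcv hcp <;> omega
  · obtain ⟨v1, v2⟩ := v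
    obtain ⟨s1, s2⟩ := s
    obtain ⟨hv1, hv2, hv3⟩ := hv
    simp only [veroneseHom_apply, Prod.mk_add_mk, Prod.zero_eq_mk, Prod.mk_le_mk] at h hv1
    have h1 : 0 ≤ s1 := nonneg_of_mul_nonneg_of_index hs.1 hv2 h.1
    have h2 : 0 ≤ s2 := nonneg_of_mul_nonneg_of_index hs.2 hv3 h.2
    by_cases h0 : s1 = 0
    · have h0' : s2 ≠ 0 := fun h' => hs0 (by rw [h0, h']; rfl)
      refine ⟨(0, 1), ⟨fun _ => rfl, fun hb0 => absurd (hs.2 hb0) h0'⟩, by simp, ?_, ?_⟩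
      · simp [Prod.zero_eq_mk, Prod.mk_le_mk]
      · have : 0 ≤ s2 - 1 := by omega
        simp only [Prod.mk_sub_mk, veroneseHom_apply, Prod.mk_add_mk, Prod.zero_eq_mk,
          Prod.mk_le_mk, sub_zero]
        exact ⟨h.1, add_nonneg (mul_nonneg this hb) hv1.2⟩
    · refine ⟨(1, 0), ⟨fun ha0 => absurd (hs.1 ha0) h0, fun _ => rfl⟩, by simp, ?_, ?_⟩
      · simp [Prod.zero_eq_mk, Prod.mk_le_mk]
      · have : 0 ≤ s1 - 1 := by omega
        simp only [Prod.mk_sub_mk, veroneseHom_apply, Prod.mk_add_mk, Prod.zero_eq_mk,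
          Prod.mk_le_mk, sub_zero]
        exact ⟨add_nonneg (mul_nonneg this ha) hv1.1, h.2⟩

section

variable {K : Type*} [Field K] {n m : ℕ} (J : Ideal (MvPolynomial (Fin n ⊕ Fin m) K))

theorem diagonalGrading_eq (a b : ℕ) :
    diagonalGrading J a b = algebraFamily J (diagonal a b) ⊤ (diagonalHom a b) := by
  funext s
  rw [algebraFamily, if_pos (AddSubgroup.mem_top s)]
  rfl

theorem sidediagonalGrading_eq (a b c d : ℕ) :
    sidediagonalGrading J a b c d =
      moduleFamily J (diagonal a b) (c, d) ⊤ (diagonalHom a b) := by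
  funext s
  rw [moduleFamily, if_pos (AddSubgroup.mem_top s)]
  rfl

theorem veroneseGrading_eq (a b : ℕ) :
    veroneseGrading J a b =
      algebraFamily J (veroneseLattice a b) (veroneseIndex a b) (veroneseHom a b) := by
  funext s
  rw [algebraFamily, veroneseGrading]
  classical exact if_congr Iff.rfl rfl rfl

theorem relativeVeroneseGrading_eq (a b c d : ℕ) :
    relativeVeroneseGrading J a b c d =
      moduleFamily J (veroneseLattice a b) (c, d) (veroneseIndex a b) (veroneseHom a b) := by
  funext s
  rw [moduleFamily, relativeVeroneseGrading]
  classical exact if_congr Iff.rfl rfl rfl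

end

/-! ### From the degrees of the basis elements to the regularity -/

section

variable {K A M : Type*} [Field K] [CommRing A] [Algebra K A] [AddCommGroup M] [Module A M]
  [Module K M] {𝒜 : ℤ → Submodule K A} {ℳ : ℤ → Submodule K M}

/-- A resolution with basis elements in the degrees `i + e` shows that a module that lives in
degrees `≥ e` has a linear resolution. -/
theorem GradedFreeResolution.hasLinearResolution {deg : ℤ →+ ℤ} (hdeg : ∀ s, deg s = s)
    [IsNoetherianRing A] (G : PosGrading 𝒜 deg) (g : GradedProj ℳ) (hM : GradedAction 𝒜 ℳ) {e : ℤ}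
    (F : GradedFreeResolution 𝒜 ℳ) (hF : ∀ i b, F.deg i b = i + e)
    (hlow : ∀ s, s < e → ℳ s = ⊥) : HasLinearResolution 𝒜 ℳ := by
  -- All basis elements of `F_0` have degree `e`. If the component of degree `e` vanishes, then the
  -- augmentation is zero and so is the module; otherwise `e` is the initial degree.
  by_cases he : ℳ e = ⊥
  · left
    have haug : F.aug = 0 := by
      refine LinearMap.ext fun f => ?_
      rw [map_eq_sum_single]
      refine Finset.sum_eq_zero fun b _ => ?_
      have := F.aug_homogeneous b
      rw [hF, Nat.cast_zero, zero_add, he, Submodule.mem_bot] at this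
      rw [this, smul_zero]
    refine ⟨fun x y => ?_⟩
    obtain ⟨f, rfl⟩ := F.aug_surjective x
    obtain ⟨f', rfl⟩ := F.aug_surjective y
    rw [haug]
    rfl
  · right
    have hT : ∀ i j, Nontrivial (F.Tor i j) → j = i + e := by
      intro i j h
      by_contra hne
      exact not_subsingleton_iff_nontrivial.2 h
        (F.subsingleton_tor fun b hb => hne (by rw [← hb, hF]))
    refine ⟨e, ⟨F, le_antisymm ?_ ?_⟩, he, fun j hj => not_lt.1 fun h => hj (hlow j h)⟩
    · refine iSup_le fun s => EReal.sub_le_of_le_add (iSup₂_le fun j hj => ?_)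
      rw [hT s j hj, ← EReal.coe_add, EReal.coe_le_coe_iff]
      push_cast
      linarith
    -- The lower bound for the regularity comes from the index `0`: by Nakayama's lemma the nonzero
    -- component of lowest degree `e` contributes to `Tor_0`.
    · refine le_trans ?_ (le_iSup (fun s : ℕ => F.t s - ((s : ℝ) : EReal)) 0)
      rw [Nat.cast_zero, EReal.coe_zero, sub_zero]
      refine le_iSup₂_of_le e ?_ le_rfl
      change Nontrivial _
      rw [← not_subsingleton_iff_nontrivial]
      intro hsub
      obtain ⟨P⟩ := exists_residueResolution G
      exact he ((F.torVanishes G P g hM hsub).eq_bot G P fun q hq =>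
        hlow q (by rwa [hdeg, hdeg] at hq))

end

/-! ### Linearity of sidediagonal and relative Veronese modules -/

section

variable {K : Type*} [Field K] {n m : ℕ} {J : Ideal (MvPolynomial (Fin n ⊕ Fin m) K)}

theorem sidediagonalIsLinear (hJ : IsBihomogeneous J) (hJ' : J ≠ ⊤)
    (hside : ∀ c, HasSideResolution J c) {a b : ℕ} (hab : (a, b) ≠ (0, 0)) (c d : ℕ) :
    SidediagonalIsLinear J a b c d := by
  obtain ⟨e, F, hF, hlow⟩ := exists_linear_resolution_moduleFamily hJ hJ' hside
    (diagonal_degreeLattice hab) (mem_diagonal_iff a b) (c, d)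
    ⟨by positivity, by positivity⟩
  rw [SidediagonalIsLinear, diagonalGrading_eq, sidediagonalGrading_eq]
  have := isNoetherianRing_subalgebraAlong hJ (diagonal a b)
  exact F.hasLinearResolution (fun _ => rfl)
    (algebraFamilyGrading hJ (diagonal_degreeLattice hab) (mem_diagonal_iff a b))
    (moduleFamilyProj hJ (diagonal_degreeLattice hab) (mem_diagonal_iff a b) _)
    (gradedAction_moduleFamily _) hF hlow

theorem relativeVeroneseIsLinear (hJ : IsBihomogeneous J) (hJ' : J ≠ ⊤)
    (hside : ∀ c, HasSideResolution J c) (a b c d : ℕ) :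
    RelativeVeroneseIsLinear J a b c d := by
  obtain ⟨e, F, hF, -⟩ := exists_linear_resolution_moduleFamily hJ hJ' hside
    (veronese_degreeLattice a b) (mem_veroneseLattice_iff a b) (c, d)
    ⟨by positivity, by positivity⟩
  rw [RelativeVeroneseIsLinear, veroneseGrading_eq, relativeVeroneseGrading_eq]
  refine ⟨e, F, fun i p hp => F.subsingleton_tor fun b hb => hp ?_⟩
  rw [← hb]
  exact hF i b

end


/-! ### Coarsening of gradings -/

section

variable {ι K N : Type*} [Field K] [AddCommGroup N] [Module K N]

/-- The components of the `ℤ`-grading obtained from a grading by a degree function. -/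
def coarse (𝒩 : ι → Submodule K N) (deg : ι → ℤ) (i : ℤ) : Submodule K N :=
  ⨆ p ∈ {p | deg p = i}, 𝒩 p

variable {𝒩 : ι → Submodule K N} {deg : ι → ℤ}

theorem le_coarse (p : ι) : 𝒩 p ≤ coarse 𝒩 deg (deg p) :=
  le_iSup₂_of_le p rfl le_rfl

theorem coarse_induction {i : ℤ} {motive : N → Prop} (mem : ∀ p, deg p = i → ∀ x ∈ 𝒩 p, motive x)
    (zero : motive 0) (add : ∀ x y, motive x → motive y → motive (x + y)) (x : N)
    (hx : x ∈ coarse 𝒩 deg i) : motive x := by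
  rw [coarse, iSup_subtype'] at hx
  exact Submodule.iSup_induction _ (motive := motive) hx (fun p x hx => mem p p.2 x hx) zero add

theorem GradedProj.finite_support (g : GradedProj 𝒩) (x : N) :
    (Function.support fun p => g.π p x).Finite := by
  classical
  obtain ⟨s, hs⟩ := g.exists_sum x
  refine s.finite_toSet.subset fun p hp => ?_
  by_contra hps
  -- Enlarging `s` by `p` does not change the sum of the projections, so the projection onto the
  -- component `p` is zero.
  have h := hs (insert p s) (Finset.subset_insert p s)
  rw [Finset.sum_insert hps, hs s subset_rfl, add_eq_right] at h
  exact hp h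

/-- The projection onto a component of a coarsened grading. -/
def GradedProj.coarseProj (g : GradedProj 𝒩) (deg : ι → ℤ) (i : ℤ) : N →+ N :=
  AddMonoidHom.mk' (fun x => ∑ᶠ p ∈ {p | deg p = i}, g.π p x) fun x y => by
    simp only [map_add]
    exact finsum_mem_add_distrib' ((g.finite_support x).inter_of_right _)
      ((g.finite_support y).inter_of_right _)

theorem GradedProj.coarseProj_apply (g : GradedProj 𝒩) (i : ℤ) (x : N) :
    g.coarseProj deg i x = ∑ᶠ p ∈ {p | deg p = i}, g.π p x := rfl

/-- The projections of a coarsened grading. -/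
def GradedProj.coarsen (g : GradedProj 𝒩) (deg : ι → ℤ) : GradedProj (coarse 𝒩 deg) where
  π i := g.coarseProj deg i
  mem i x := by
    rw [coarseProj_apply]
    exact finsum_mem_induction (· ∈ coarse 𝒩 deg i) (zero_mem _) (fun _ _ => add_mem)
      fun p hp => (show deg p = i from hp) ▸ le_coarse p (g.mem p x)
  same i x hx := by
    refine coarse_induction (motive := fun x : N => g.coarseProj deg i x = x)
      (fun p hp x hx => ?_) (map_zero _) (fun x y h h' => by rw [map_add, h, h']) x hx
    rw [coarseProj_apply, finsum_eq_single _ p, finsum_eq_if,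
      if_pos (show p ∈ {p | deg p = i} from hp), g.same p x hx]
    intro q hq
    rw [g.ne p q hq.symm x hx, finsum_zero]
  ne i j hij x hx := by
    refine coarse_induction (motive := fun x : N => g.coarseProj deg j x = 0)
      (fun p hp x hx => ?_) (map_zero _) (fun x y h h' => by rw [map_add, h, h', add_zero]) x hx
    rw [coarseProj_apply]
    refine finsum_mem_eq_zero_of_forall_eq_zero fun q hq => g.ne p q ?_ x hx
    rintro rfl
    exact hij (hp.symm.trans hq)
  total := by
    rw [eq_top_iff, ← g.total]
    exact iSup_le fun p => (le_coarse p).trans (le_iSup (coarse 𝒩 deg) (deg p))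

end

section

variable {ι K A : Type*} [AddCommGroup ι] [Field K] [CommRing A] [Algebra K A]
  {𝒜 : ι → Submodule K A} {deg : ι →+ ℤ}

/-- Nonzero components in nonzero degrees have positive total degree, so coarsening adds nothing in
degree `0`. -/
theorem PosGrading.coarse_zero_le (G : PosGrading 𝒜 deg) : coarse 𝒜 deg 0 ≤ 𝒜 0 := by
  refine iSup₂_le fun p hp x hx => ?_
  by_cases hp0 : p = 0
  · rwa [hp0] at hx
  · by_cases hx0 : x = 0
    · rw [hx0]
      exact zero_mem _
    · have := G.pos p x hx hx0 hp0
      have hp' : deg p = 0 := hp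
      omega

/-- The coarsened grading of a positively graded algebra. -/
def PosGrading.coarsen (G : PosGrading 𝒜 deg) :
    PosGrading (coarse 𝒜 deg) (AddMonoidHom.id ℤ) where
  toGradedProj := G.toGradedProj.coarsen deg
  one_mem := by
    have := le_coarse (deg := deg) 0 G.one_mem
    rwa [map_zero] at this
  mul_mem i j a ha b hb := by
    have h : coarse 𝒜 deg i * coarse 𝒜 deg j ≤ coarse 𝒜 deg (i + j) := by
      rw [coarse, coarse]
      simp only [Submodule.iSup_mul, Submodule.mul_iSup, iSup_le_iff]
      intro q hq p hp
      refine Submodule.mul_le.2 fun a ha b hb => ?_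
      have := le_coarse (deg := deg) _ (G.mul_mem _ _ a ha b hb)
      rw [map_add] at this
      convert this using 2
      simp only [Set.mem_ofPred_eq] at hp hq
      omega
    exact h (Submodule.mul_mem_mul ha hb)
  pos i a ha ha0 hi := by
    by_contra hneg
    refine ha0 (coarse_induction (motive := fun x : A => x = 0) (fun p hp x hx => ?_) rfl
      (by rintro x y rfl rfl; simp) a ha)
    by_contra hx0
    have := G.pos p x hx hx0 (by
      rintro rfl
      rw [map_zero] at hp
      exact hi hp.symm)
    rw [AddMonoidHom.id_apply] at hneg
    omega
  unit a ha ha0 := G.unit a (G.coarse_zero_le ha) ha0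

theorem PosGrading.irrelevantIdeal_coarse (G : PosGrading 𝒜 deg) :
    irrelevantIdeal (coarse 𝒜 deg) = irrelevantIdeal 𝒜 := by
  apply le_antisymm
  · refine Ideal.span_le.2 ?_
    rintro x ⟨i, hi, hx⟩
    refine coarse_induction (motive := fun x => x ∈ irrelevantIdeal 𝒜) (fun p hp x hx => ?_)
      (zero_mem _) (fun _ _ => add_mem) x hx
    refine Ideal.subset_span ⟨p, ?_, hx⟩
    rintro rfl
    exact hi (by rw [← hp, map_zero])
  · refine Ideal.span_le.2 ?_
    rintro x ⟨p, hp, hx⟩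
    by_cases hx0 : x = 0
    · rw [hx0]
      exact zero_mem _
    · exact Ideal.subset_span ⟨deg p, (G.pos p x hx hx0 hp).ne', le_coarse p hx⟩

/-- A resolution of the residue field for a coarsened grading. -/
def ResidueResolution.coarsen (P : ResidueResolution 𝒜) (G : PosGrading 𝒜 deg) :
    ResidueResolution (coarse 𝒜 deg) where
  β := P.β
  fin := P.fin
  deg i b := deg (P.deg i b)
  D := P.D
  uniq := P.uniq
  deg_zero b := by rw [P.deg_zero, map_zero]
  homogeneous i b b' := by
    rw [← map_sub]
    exact le_coarse _ (P.homogeneous i b b')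
  span_range := by rw [P.span_range, G.irrelevantIdeal_coarse]
  comp := P.comp
  exact := P.exact

/-! ### The residue field -/

theorem residueGrading_of_ne {p : ι} (hp : p ≠ 0) : residueGrading 𝒜 p = ⊥ := by
  rw [eq_bot_iff]
  rintro _ ⟨x, hx, rfl⟩
  exact Ideal.Quotient.eq_zero_iff_mem.2 (Ideal.subset_span ⟨p, hp, hx⟩)

theorem residueGrading_zero (g : GradedProj 𝒜) : residueGrading 𝒜 0 = ⊤ := by
  rw [eq_top_iff]
  rintro x -
  obtain ⟨x, rfl⟩ := Ideal.Quotient.mk_surjective x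
  induction x using g.induction with
  | mem p x hx =>
    by_cases hp : p = 0
    · subst hp
      exact ⟨x, hx, rfl⟩
    · have h : x ∈ irrelevantIdeal 𝒜 := Ideal.subset_span ⟨p, hp, hx⟩
      rw [Ideal.Quotient.eq_zero_iff_mem.2 h]
      exact zero_mem _
  | zero => exact zero_mem (residueGrading 𝒜 0)
  | add x y hx hy => exact add_mem hx hy

open Classical in
/-- The projections of the residue field. -/
def residueProj (g : GradedProj 𝒜) : GradedProj (residueGrading 𝒜) where
  π p := if p = 0 then AddMonoidHom.id _ else 0
  mem p x := by
    split_ifs with h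
    · rw [h, residueGrading_zero g]
      trivial
    · exact zero_mem _
  same p x hx := by
    split_ifs with h
    · rfl
    · rw [residueGrading_of_ne h, Submodule.mem_bot] at hx
      rw [hx, map_zero]
  ne p q hpq x hx := by
    split_ifs with h
    · rw [residueGrading_of_ne (h ▸ hpq), Submodule.mem_bot] at hx
      rw [hx, map_zero]
    · rfl
  total := by
    rw [eq_top_iff, ← residueGrading_zero g]
    exact le_iSup (residueGrading 𝒜) 0

theorem gradedAction_residueGrading (G : PosGrading 𝒜 deg) :
    GradedAction 𝒜 (residueGrading 𝒜) := by
  rintro p q a ha _ ⟨x, hx, rfl⟩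
  exact ⟨a * x, G.mul_mem p q a ha x hx, rfl⟩

end

/-! ### Koszul algebras -/

section

variable {K A : Type*} [Field K] [CommRing A] [Algebra K A]

theorem GradedFreeResolution.le_of_reg_eq_zero {M : Type*} [AddCommGroup M] [Module A M]
    [Module K M] {𝒜 : ℤ → Submodule K A} {ℳ : ℤ → Submodule K M} (F : GradedFreeResolution 𝒜 ℳ)
    (hF : F.reg = 0) {i : ℕ} {j : ℤ} (h : (i : ℤ) < j) : Subsingleton (F.Tor i j) := by
  by_contra hne
  have h1 : F.t i - ((i : ℝ) : EReal) ≤ 0 := by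
    rw [← hF]
    exact le_iSup (fun s : ℕ => F.t s - ((s : ℝ) : EReal)) i
  rw [EReal.sub_nonpos] at h1
  have h2 : ((j : ℝ) : EReal) ≤ F.t i :=
    le_iSup₂_of_le (f := fun (j : ℤ) (_ : j ∈ {j : ℤ | Nontrivial (F.Tor i j)}) =>
      ((j : ℝ) : EReal)) j (not_subsingleton_iff_nontrivial.1 hne) le_rfl
  have h3 : ((j : ℝ) : EReal) ≤ ((i : ℝ) : EReal) := h2.trans h1
  rw [EReal.coe_le_coe_iff] at h3
  have h4 : j ≤ (i : ℤ) := by exact_mod_cast h3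
  omega

/-- Over a Koszul algebra, the irrelevant ideal has a linear resolution. -/
theorem torVanishes_irrelevantIdeal {𝒜 : ℤ → Submodule K A}
    (G : PosGrading 𝒜 (AddMonoidHom.id ℤ)) (hK : IsKoszulAlgebra 𝒜) (P : ResidueResolution 𝒜)
    {i : ℕ} {j : ℤ} (hij : i + 1 < j) :
    P.TorVanishes (subFamily 𝒜 (irrelevantIdeal 𝒜)) i j := by
  obtain ⟨F, hF⟩ := hK
  refine ResidueResolution.TorVanishes.kernel P G.gradedAction
    (irrelevantIdeal 𝒜).subtype Subtype.val_injective (irrelevantIdeal 𝒜).mkQ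
    (fun p x hx h => ⟨⟨x, (Submodule.Quotient.mk_eq_zero _).1 h⟩, hx, rfl⟩)
    (fun p z hz => ⟨hz, (Submodule.Quotient.mk_eq_zero _).2 z.2⟩)
    (ℳ := residueGrading 𝒜) (fun p x hx => ⟨x, hx, rfl⟩) ?_ ?_
    (F.torVanishes G P (residueProj G.toGradedProj) (gradedAction_residueGrading G)
      (F.le_of_reg_eq_zero hF (by push_cast; omega)))
  · rintro p _ ⟨x, hx, rfl⟩
    exact ⟨x, hx, rfl⟩
  · cases i with
    | zero => exact P.torVanishes_ring_zero G (by omega)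
    | succ i => exact P.torVanishes_ring_succ G i j

end

section

variable {ι K A : Type*} [AddCommGroup ι] [Field K] [CommRing A] [Algebra K A]
  {𝒜 : ι → Submodule K A} {deg : ι →+ ℤ}

/-- A cycle homogeneous for the fine grading is homogeneous for the coarse one, where it bounds.
Projecting the bounding chain to the fine degrees gives one that is finely homogeneous. -/
theorem torVanishes_irrelevantIdeal_of_coarse (G : PosGrading 𝒜 deg)
    (hK : IsKoszulAlgebra (coarse 𝒜 deg)) (P : ResidueResolution 𝒜) {i : ℕ} {p : ι}
    (hp : i + 1 < deg p) : P.TorVanishes (subFamily 𝒜 (irrelevantIdeal 𝒜)) i p := by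
  have h := torVanishes_irrelevantIdeal G.coarsen hK (P.coarsen G) hp
  rw [G.irrelevantIdeal_coarse] at h
  intro z hz hc
  obtain ⟨w, -, hwz⟩ := h z (fun b => by
    have : (z b : A) ∈ coarse 𝒜 deg _ := le_coarse (deg := deg) _ (hz b)
    rw [map_sub] at this
    exact this) (by
      cases i with
      | zero => trivial
      | succ i => exact hc)
  exact ⟨_, fun b => GradedProj.mem _ _ _, P.exists_hom_of_diff_eq
    (G.toGradedProj.sub (irrelevantIdeal 𝒜) (proj_mem_irrelevantIdeal G))
    (G.gradedAction.sub (irrelevantIdeal 𝒜)) hz hwz⟩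

/-- The Koszul property makes the irrelevant ideal linear with generators of total degree `1`. Its
resolution, preceded by `A`, has basis elements of total degree `i` in index `i`. -/
theorem exists_linear_residueResolution [Nontrivial A] [IsNoetherianRing A]
    (G : PosGrading 𝒜 deg) (hK : IsKoszulAlgebra (coarse 𝒜 deg)) :
    ∃ P : ResidueResolution 𝒜, ∀ i b, deg (P.deg i b) = i := by
  obtain ⟨P⟩ := exists_residueResolution G
  obtain ⟨F, hF⟩ := exists_linear_resolution G P
    (G.toGradedProj.sub (irrelevantIdeal 𝒜) (proj_mem_irrelevantIdeal G))
    (G.gradedAction.sub (irrelevantIdeal 𝒜)) 1 (fun p hp => by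
      rw [eq_bot_iff]
      rintro ⟨x, hx⟩ hxp
      have hxp' : x ∈ 𝒜 p := hxp
      rw [Submodule.mem_bot]
      ext
      by_contra hx0
      by_cases hp0 : p = 0
      · exact hx0 (G.eq_zero_of_mem hx (hp0 ▸ hxp'))
      · have := G.pos p x hxp' hx0 hp0
        omega)
    (fun i p hp => torVanishes_irrelevantIdeal_of_coarse G hK P hp)
    Set.univ (fun _ _ => trivial) (fun _ _ _ _ => trivial)
  refine ⟨F.toResidueResolution, fun i b => ?_⟩
  cases i with
  | zero => exact map_zero deg
  | succ i => exact_mod_cast (hF i b).1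

end

/-! ### Ideals with a retraction -/

/-- The index sets of the bases, shifted by one. -/
def shiftIndex (β : ℕ → Type) : ℕ → Type
  | 0 => Empty
  | i + 1 => β i

instance (β : ℕ → Type) [∀ i, Fintype (β i)] : ∀ i, Fintype (shiftIndex β i)
  | 0 => inferInstanceAs (Fintype Empty)
  | i + 1 => inferInstanceAs (Fintype (β i))

/-- The matrices of a resolution, shifted by one, with a ring homomorphism applied. -/
def ResidueResolution.shiftMatrix {ι K A : Type*} [AddCommGroup ι] [Field K] [CommRing A]
    [Algebra K A] {𝒜 : ι → Submodule K A} (P : ResidueResolution 𝒜) (κ : A →+* A) :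
    ∀ i, shiftIndex P.β (i + 1) → shiftIndex P.β i → A
  | 0 => fun _ b => b.elim
  | i + 1 => fun b b' => κ (P.D i b b')

section

variable {ι K : Type*} {A : Type u} [AddCommGroup ι] [Field K] [CommRing A] [Algebra K A]
  {𝒜 : ι → Submodule K A} {deg : ι →+ ℤ}

/-- If `𝔫` is the kernel of a homogeneous retraction `κ` of an algebra whose residue field has a
linear resolution, then `𝔫` has a linear resolution. -/
theorem torVanishes_of_retraction (G : PosGrading 𝒜 deg) (P : ResidueResolution 𝒜)
    (hP : ∀ i b, deg (P.deg i b) = i) (𝔫 : Ideal A) (h𝔫 : ∀ p, ∀ x ∈ 𝔫, G.π p x ∈ 𝔫) (κ : A →+* A)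
    (hκ : ∀ x, κ x - x ∈ 𝔫) (hκ0 : ∀ x ∈ 𝔫, κ x = 0)
    (hκm : ∀ x ∈ irrelevantIdeal 𝒜, κ x ∈ irrelevantIdeal 𝒜) {i : ℕ} {p : ι}
    (hp : i + 1 < deg p) : P.TorVanishes (subFamily 𝒜 𝔫) i p := by
  classical
  intro z hz hc
  have hring : P.TorVanishes 𝒜 i p := by
    cases i with
    | zero => exact P.torVanishes_ring_zero G (by rintro rfl; simp at hp)
    | succ i => exact P.torVanishes_ring_succ G i p
  -- Over the ring the cycle bounds a chain `u`. The remaining task is to replace `u` by a chain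
  -- with entries in `𝔫`, that is, to show that `u` is a boundary modulo `𝔫`.
  obtain ⟨u, hu, huz⟩ := hring (fun b => z b) hz (hc.map P 𝔫.subtype)
  -- The basis of `P_{i+1}` has total degree `i + 1 < deg p`, so the entries of `u` have nonzero
  -- degree.
  have hum : ∀ b, u b ∈ irrelevantIdeal 𝒜 := fun b => by
    refine Ideal.subset_span ⟨_, fun h => ?_, hu b⟩
    have h' := congrArg deg h
    rw [map_sub, hP, map_zero] at h'
    push_cast at h'
    omega
  have hmk : ∀ x, 𝔫.mkQ (κ x) = 𝔫.mkQ x := fun x => (Submodule.Quotient.eq _).2 (hκ x)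
  -- The complex `κ(P)` maps basis element by basis element to `A/𝔫 ⊗ P`, a chain map since `κ` is
  -- the identity modulo `𝔫`. The chain `κ(u)` is a cycle of `κ(P)`, because `κ` kills `z`. The
  -- index shift with an empty bottom term matches the numbering of the general statement.
  obtain ⟨w, hw⟩ := P.exists_diff_eq_of_chainMap (i + 1) (shiftIndex P.β) (P.shiftMatrix κ)
    (by
      rintro (_ | i) b b''
      · exact b''.elim
      · have h := congrArg κ (P.comp i b b'')
        rw [map_sum, map_zero] at h
        simp only [map_mul] at h
        exact h)
    (A ⧸ 𝔫) (fun j (b : P.β j) => (Pi.single b (𝔫.mkQ 1) : P.β j → A ⧸ 𝔫))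
    (by
      intro j (b : P.β (j + 1))
      ext c
      have h1 : P.diff (A ⧸ 𝔫) j (Pi.single b (𝔫.mkQ 1)) c = P.D j b c • 𝔫.mkQ 1 := by
        rw [ResidueResolution.diff_apply, Finset.sum_eq_single b]
        · rw [Pi.single_eq_same]
        · intro b' _ hb'
          rw [Pi.single_eq_of_ne hb', smul_zero]
        · simp
      have h2 : (∑ b' : P.β j, κ (P.D j b b') • (Pi.single b' (𝔫.mkQ 1) : P.β j → A ⧸ 𝔫)) c =
          κ (P.D j b c) • 𝔫.mkQ 1 := by
        rw [Finset.sum_apply, Finset.sum_eq_single c]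
        · rw [Pi.smul_apply, Pi.single_eq_same]
        · intro b' _ hb'
          rw [Pi.smul_apply, Pi.single_eq_of_ne hb'.symm, smul_zero]
        · simp
      refine h1.trans (Eq.trans ?_ h2.symm)
      rw [← map_smul, ← map_smul, smul_eq_mul, smul_eq_mul, mul_one, mul_one, hmk])
    (fun b : P.β (i + 1) => κ (u b)) (fun b => hκm _ (hum b))
    (by
      intro (b' : P.β i)
      have h := congrArg κ (congrFun huz b')
      rw [ResidueResolution.diff_apply, map_sum, hκ0 _ (z b').2] at h
      simp only [smul_eq_mul, map_mul] at h
      refine Eq.trans ?_ h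
      exact Finset.sum_congr rfl fun b _ => mul_comm _ _)
  have hw' : ∀ b, P.diff (A ⧸ 𝔫) (i + 1) w b = 𝔫.mkQ (u b) := by
    intro b
    have h := congrFun hw b
    refine h.trans ?_
    change (∑ b' : P.β (i + 1), κ (u b') • (Pi.single b' (𝔫.mkQ 1) : P.β (i + 1) → A ⧸ 𝔫)) b = _
    rw [Finset.sum_apply, Finset.sum_eq_single b]
    · rw [Pi.smul_apply, Pi.single_eq_same, ← map_smul, smul_eq_mul, mul_one, hmk]
    · intro b' _ hb'
      rw [Pi.smul_apply, Pi.single_eq_of_ne hb'.symm, smul_zero]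
    · simp
  -- Since `κ(u)` and `u` agree modulo `𝔫`, the class of `u` is the boundary of `w`. Subtracting the
  -- boundary of a lift `v` of `w` moves `u` into `𝔫` and keeps its boundary equal to `z`.
  choose v hv using fun b => Submodule.mkQ_surjective 𝔫 (w b)
  have hmem : ∀ b, u b - P.diff A (i + 1) v b ∈ 𝔫 := by
    intro b
    rw [← Submodule.Quotient.eq, ← Submodule.mkQ_apply, ← Submodule.mkQ_apply, ← hw' b,
      ← congrFun (P.diff_map 𝔫.mkQ (i + 1) v) b]
    simp only [hv]
  have hdiff : P.diff 𝔫 i (fun b => ⟨_, hmem b⟩) = z := by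
    ext b
    have h := congrFun (P.diff_map 𝔫.subtype i fun b => ⟨_, hmem b⟩) b
    refine h.symm.trans ?_
    change P.diff A i (u - P.diff A (i + 1) v) b = _
    rw [map_sub, P.diff_diff, sub_zero, huz]
  exact ⟨_, fun b => GradedProj.mem _ _ _, P.exists_hom_of_diff_eq
    (G.toGradedProj.sub 𝔫 h𝔫) (G.gradedAction.sub 𝔫) hz hdiff⟩

end

/-! ### Linear resolutions of the ideals generated by the variables -/

section

variable {K : Type*} [Field K] {n m : ℕ} {J : Ideal (MvPolynomial (Fin n ⊕ Fin m) K)}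

theorem pos_of_subFamily_sideIdeal_ne_bot (hJ : IsBihomogeneous J) {c : Bool} {p : ℤ × ℤ}
    (h : subFamily (bicomponent J) (sideIdeal J c) p ≠ ⊥) : 1 ≤ coord c p ∧ 0 ≤ p := by
  obtain ⟨⟨x, hx⟩, hxp, hx0⟩ := Submodule.exists_mem_ne_zero_of_ne_bot h
  have hx0' : x ≠ 0 := fun h => hx0 (Subtype.ext h)
  refine ⟨?_, nonneg_of_bicomponent J hxp hx0'⟩
  by_contra hc
  exact hx0' (eq_zero_of_mem_sideIdeal hJ (by omega) hxp hx)

theorem subFamily_sideIdeal_eq_bot (hJ : IsBihomogeneous J) {c : Bool} {p : ℤ × ℤ}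
    (hp : totalDegree p < 1) : subFamily (bicomponent J) (sideIdeal J c) p = ⊥ := by
  by_contra h
  obtain ⟨h1, h2, h3⟩ := pos_of_subFamily_sideIdeal_ne_bot hJ h
  rw [totalDegree_apply] at hp
  simp only [Prod.fst_zero, Prod.snd_zero] at h2 h3
  cases c <;> simp only [coord_false, coord_true] at h1 <;> omega

/-- The ideal lives in nonnegative degrees with positive `c`-coordinate, and multiplication by
elements of `R` does not leave this region. So all basis elements of the minimal resolution stay in
it, as required by the strand argument. -/
theorem hasSideResolution_of_torVanishes (hJ : IsBihomogeneous J) (hJ' : J ≠ ⊤) (c : Bool)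
    (P : ResidueResolution (bicomponent J)) (h : ∀ (i : ℕ) p, i + 1 < totalDegree p →
      P.TorVanishes (subFamily (bicomponent J) (sideIdeal J c)) i p) : HasSideResolution J c := by
  have : Nontrivial (MvPolynomial (Fin n ⊕ Fin m) K ⧸ J) := Ideal.Quotient.nontrivial_iff.2 hJ'
  obtain ⟨F, hF⟩ := exists_linear_resolution (bicomponentGrading hJ) P
    ((bicomponentProj hJ).sub (sideIdeal J c) (proj_mem_sideIdeal hJ c))
    ((bicomponentGrading hJ).gradedAction.sub (sideIdeal J c)) 1
    (fun p hp => subFamily_sideIdeal_eq_bot hJ hp) h {p | 1 ≤ coord c p ∧ 0 ≤ p}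
    (fun p hp => pos_of_subFamily_sideIdeal_ne_bot hJ hp) (fun p q hq hpq => by
      have h0 : 0 ≤ p - q := by
        by_contra h0
        exact hpq (bicomponent_eq_bot J h0)
      have h1 : q ≤ p := sub_nonneg.1 h0
      refine ⟨le_trans hq.1 ?_, hq.2.trans h1⟩
      cases c
      · exact h1.1
      · exact h1.2)
  exact ⟨F, fun i b => ⟨(hF i b).1, (hF i b).2⟩⟩

theorem hasSideResolution_of_isKoszulAlgebra (hJ : IsBihomogeneous J) (hJ' : J ≠ ⊤)
    (hK : IsKoszulAlgebra (totalComponent J)) (c : Bool) : HasSideResolution J c := by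
  have : Nontrivial (MvPolynomial (Fin n ⊕ Fin m) K ⧸ J) := Ideal.Quotient.nontrivial_iff.2 hJ'
  obtain ⟨P, hP⟩ := exists_linear_residueResolution (bicomponentGrading hJ) hK
  exact hasSideResolution_of_torVanishes hJ hJ' c P fun i p hp =>
    torVanishes_of_retraction (bicomponentGrading hJ) P hP (sideIdeal J c)
      (proj_mem_sideIdeal hJ c) (killVarsQuot hJ c) (killVarsQuot_sub_mem hJ c)
      (fun x hx => killVarsQuot_eq_zero hJ hx)
      (fun x hx => killVarsQuot_mem_irrelevantIdeal hJ c hx) hp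

/-- The ideal is generated by classes of variables, which have total degree `1`. If the integer `a`
of the given resolution differs from `1`, then `Tor_0` vanishes in the degree of these variables,
Nakayama's lemma kills them, and the ideal is zero. -/
theorem hasSideResolution_of_hasBigradedLinearResolution (hJ : IsBihomogeneous J) (hJ' : J ≠ ⊤)
    (c : Bool) (h : HasBigradedLinearResolution (bicomponent J) (idealGrading J (sideIdeal J c))) :
    HasSideResolution J c := by
  obtain ⟨a, F, hF⟩ := h
  obtain ⟨P⟩ := exists_residueResolution (bicomponentGrading hJ)
  have htor : ∀ (i : ℕ) p, totalDegree p ≠ i + a →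
      P.TorVanishes (subFamily (bicomponent J) (sideIdeal J c)) i p := fun i p hp =>
    F.torVanishes (bicomponentGrading hJ) P
      ((bicomponentProj hJ).sub (sideIdeal J c) (proj_mem_sideIdeal hJ c))
      ((bicomponentGrading hJ).gradedAction.sub (sideIdeal J c)) (hF i p hp)
  refine hasSideResolution_of_torVanishes hJ hJ' c P fun i p hp => ?_
  by_cases ha : a = 1
  · exact htor i p (by omega)
  · have hdeg : totalDegree (unitDegree c) = 1 := by cases c <;> simp
    have hbot := (htor 0 (unitDegree c) (by rw [hdeg]; push_cast; omega)).eq_bot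
      (bicomponentGrading hJ) P fun q hq => subFamily_sideIdeal_eq_bot hJ (by omega)
    have hI : sideIdeal J c = ⊥ := by
      rw [sideIdeal, Ideal.span_eq_bot]
      rintro _ ⟨v, hv, rfl⟩
      have hmem : (⟨_, Ideal.subset_span ⟨v, hv, rfl⟩⟩ : sideIdeal J c) ∈
          subFamily (bicomponent J) (sideIdeal J c) (unitDegree c) := by
        rw [mem_subFamily, ← bidegree_eq_unitDegree hv]
        exact mk_X_mem J v
      rw [hbot, Submodule.mem_bot] at hmem
      exact congrArg Subtype.val hmem
    have hsub : Subsingleton (sideIdeal J c) := by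
      rw [hI]
      infer_instance
    exact ResidueResolution.TorVanishes.of_eq_bot P fun q => Subsingleton.elim _ _

end

end

/-! ### The main statement -/

theorem corollary2p5 {K : Type*} [Field K] (n m : ℕ)
    (J : Ideal (MvPolynomial (Fin n ⊕ Fin m) K)) (hJ : IsBihomogeneous J) (hJ' : J ≠ ⊤) :
    (IsKoszulAlgebra (totalComponent J) →
      ∀ a b : ℕ, (a, b) ≠ (0, 0) → ∀ c d : ℕ,
        SidediagonalIsLinear J a b c d ∧ RelativeVeroneseIsLinear J a b c d) ∧
    (HasBigradedLinearResolution (bicomponent J) (idealGrading J (idealX J)) →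
      HasBigradedLinearResolution (bicomponent J) (idealGrading J (idealY J)) →
      ∀ a b : ℕ, (a, b) ≠ (0, 0) → ∀ c d : ℕ,
        SidediagonalIsLinear J a b c d ∧ RelativeVeroneseIsLinear J a b c d) := by
  constructor
  · intro hK a b hab c d
    have hside := hasSideResolution_of_isKoszulAlgebra hJ hJ' hK
    exact ⟨sidediagonalIsLinear hJ hJ' hside hab c d, relativeVeroneseIsLinear hJ hJ' hside a b c d⟩
  · intro hX hY a b hab c d
    have hside : ∀ c, HasSideResolution J c := fun c => by
      refine hasSideResolution_of_hasBigradedLinearResolution hJ hJ' c ?_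
      cases c
      · rwa [sideIdeal_false]
      · rwa [sideIdeal_true]
    exact ⟨sidediagonalIsLinear hJ hJ' hside hab c d, relativeVeroneseIsLinear hJ hJ' hside a b c d⟩
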